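/- Let bi-DSN be the following problem. The input is a directed graph $G=(V,E)$ with nonnegative edge weights that is bidirected, i.e. for every edge $uv\in E$ the reverse edge $vu$ is also in $E$ and has the same weight, together with a set $\mathcal D\subseteq V\times V$ of $k$ demand pairs. A solution is a subgraph $N\subseteq G$ that contains a directed $s\to t$ path for every $(s,t)\in\mathcal D$; the aim is to minimize the total edge weight of $N$. Write $n=|V|$. An $\alpha$-approximation is an algorithm that, whenever a solution exists, computes a solution whose total weight is at most $\alpha$ times the minimum. Then bi-DSN admits (1) a $4$-approximation in time polynomial in $n$, and (2) a $2$-approximation in time $2^{O(k\log k)}\cdot n^{O(1)}$. Here running time is the number of steps of a random access machine in which additions, subtractions, halvings and comparisons (of indices and of weights), memory accesses and assignments cost one step each, and multiplication is not available. -/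

import Mathlib

/-!
Directed Steiner Network on bidirected graphs, and the machine model that running times
refer to.
-/

namespace BiDSN

/-! ## The problem -/

/-- An instance of Directed Steiner Network: a directed graph on the vertices `0, …, n - 1`
with nonnegative real edge weights, and a set of demand pairs. -/
structure Instance where
  /-- the number of vertices -/
  n : ℕ
  /-- the directed edges -/
  edges : Finset (ℕ × ℕ)
  /-- the edge weights; the values outside `edges` play no role -/
  weight : ℕ × ℕ → ℝ
  /-- the demand pairs -/
  demands : Finset (ℕ × ℕ)
  edges_lt : ∀ e ∈ edges, e.1 < n ∧ e.2 < n
  demands_lt : ∀ d ∈ demands, d.1 < n ∧ d.2 < n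
  weight_nonneg : ∀ e ∈ edges, 0 ≤ weight e

namespace Instance

/-- The number of demand pairs. -/
def k (I : Instance) : ℕ := I.demands.card

/-- For every edge `uv` the reverse edge `vu` exists and has the same weight. -/
def Bidirected (I : Instance) : Prop :=
  ∀ u v, (u, v) ∈ I.edges → (v, u) ∈ I.edges ∧ I.weight (v, u) = I.weight (u, v)

/-- `N` is the edge set of a subgraph of the input graph that contains a directed path from
`s` to `t` for every demand `(s, t)`. -/
def Feasible (I : Instance) (N : Finset (ℕ × ℕ)) : Prop :=
  N ⊆ I.edges ∧
    ∀ d ∈ I.demands, Relation.ReflTransGen (fun u v => (u, v) ∈ N) d.1 d.2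

/-- The total edge weight of a network. -/
noncomputable def cost (I : Instance) (N : Finset (ℕ × ℕ)) : ℝ := ∑ e ∈ N, I.weight e

/-- `N` is feasible and at most a factor `α` more expensive than every feasible network
(equivalently, than an optimum one: there are only finitely many networks). -/
def IsApprox (I : Instance) (α : ℝ) (N : Finset (ℕ × ℕ)) : Prop :=
  I.Feasible N ∧ ∀ M, I.Feasible M → I.cost N ≤ α * I.cost M

end Instance

/-! ## The machine

A random access machine, programmed by structured programs. Its memory consists of
two-dimensional tables, of natural numbers (used for indices and counters) and of weights.
Every arithmetic operation, memory access, comparison and assignment costs one step. The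
arithmetic operations are addition, subtraction and halving only. There is no multiplication
(with it, unit cost would not be realistic), there is no rounding of weights, and the only
weight constant is `0`. Hence on rational inputs the numbers that occur within `t` steps have
encodings polynomial in `t` and the input length, and the number of steps is polynomially
related to the running time of a Turing machine. -/

/-- The contents of the memory: `idx a i j` and `wt a i j` are the entries in row `i` and
column `j` of the `a`-th table of natural numbers and of the `a`-th table of weights. -/
structure Mem where
  idx : ℕ → ℕ → ℕ → ℕ
  wt : ℕ → ℕ → ℕ → ℝ

/-- Expressions of natural-number type. -/
inductive IExp where
  | const (c : ℕ)
  | cell (a : ℕ) (i j : IExp)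
  | add (e f : IExp)
  | sub (e f : IExp)
  | half (e : IExp)

namespace IExp

/-- Value of an expression; subtraction is truncated, halving rounds down. -/
def eval (σ : Mem) : IExp → ℕ
  | const c => c
  | cell a i j => σ.idx a (i.eval σ) (j.eval σ)
  | add e f => e.eval σ + f.eval σ
  | sub e f => e.eval σ - f.eval σ
  | half e => e.eval σ / 2

/-- Number of steps for evaluating an expression. -/
def steps : IExp → ℕ
  | const _ => 1
  | cell _ i j => i.steps + j.steps + 1
  | add e f => e.steps + f.steps + 1
  | sub e f => e.steps + f.steps + 1
  | half e => e.steps + 1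

end IExp

/-- Expressions of weight type. -/
inductive WExp where
  | zero
  | cell (a : ℕ) (i j : IExp)
  | add (e f : WExp)
  | sub (e f : WExp)
  | half (e : WExp)

namespace WExp

/-- Value of an expression. -/
noncomputable def eval (σ : Mem) : WExp → ℝ
  | zero => 0
  | cell a i j => σ.wt a (i.eval σ) (j.eval σ)
  | add e f => e.eval σ + f.eval σ
  | sub e f => e.eval σ - f.eval σ
  | half e => e.eval σ / 2

/-- Number of steps for evaluating an expression. -/
def steps : WExp → ℕ
  | zero => 1
  | cell _ i j => i.steps + j.steps + 1
  | add e f => e.steps + f.steps + 1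
  | sub e f => e.steps + f.steps + 1
  | half e => e.steps + 1

end WExp

/-- Conditions for branching. -/
inductive Test where
  | ile (e f : IExp)
  | wle (e f : WExp)
  | not (b : Test)
  | and (b c : Test)

namespace Test

/-- Truth of a condition. -/
def Holds (σ : Mem) : Test → Prop
  | ile e f => e.eval σ ≤ f.eval σ
  | wle e f => e.eval σ ≤ f.eval σ
  | not b => ¬ b.Holds σ
  | and b c => b.Holds σ ∧ c.Holds σ

/-- Number of steps for evaluating a condition. -/
def steps : Test → ℕ
  | ile e f => e.steps + f.steps + 1
  | wle e f => e.steps + f.steps + 1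
  | not b => b.steps + 1
  | and b c => b.steps + c.steps + 1

end Test

namespace Mem

/-- Write the value `x` into entry `(i, j)` of the `a`-th table of natural numbers. -/
def setIdx (σ : Mem) (a i j x : ℕ) : Mem :=
  { σ with idx := fun b r c => if b = a ∧ r = i ∧ c = j then x else σ.idx b r c }

/-- Write the value `x` into entry `(i, j)` of the `a`-th table of weights. -/
def setWt (σ : Mem) (a i j : ℕ) (x : ℝ) : Mem :=
  { σ with wt := fun b r c => if b = a ∧ r = i ∧ c = j then x else σ.wt b r c }

end Mem

/-- Programs. `setIdx a i j e` and `setWt a i j e` assign the value of `e` to entry `(i, j)`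
of the `a`-th table of the respective kind. -/
inductive Prog where
  | skip
  | setIdx (a : ℕ) (i j e : IExp)
  | setWt (a : ℕ) (i j : IExp) (e : WExp)
  | seq (P Q : Prog)
  | ite (b : Test) (P Q : Prog)
  | loop (b : Test) (P : Prog)

/-- `Run P σ t τ`: the program `P`, started with memory `σ`, halts after exactly `t` steps
with memory `τ`. (`Prog.loop b P` repeats `P` as long as `b` holds.) -/
inductive Run : Prog → Mem → ℕ → Mem → Prop where
  | skip (σ : Mem) : Run Prog.skip σ 1 σ
  | setIdx (σ : Mem) (a : ℕ) (i j e : IExp) :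
      Run (Prog.setIdx a i j e) σ (i.steps + j.steps + e.steps + 1)
        (σ.setIdx a (i.eval σ) (j.eval σ) (e.eval σ))
  | setWt (σ : Mem) (a : ℕ) (i j : IExp) (e : WExp) :
      Run (Prog.setWt a i j e) σ (i.steps + j.steps + e.steps + 1)
        (σ.setWt a (i.eval σ) (j.eval σ) (e.eval σ))
  | seq {P Q : Prog} {σ τ ρ : Mem} {s t : ℕ} :
      Run P σ s τ → Run Q τ t ρ → Run (Prog.seq P Q) σ (s + t) ρ
  | ite_true {b : Test} {P Q : Prog} {σ τ : Mem} {t : ℕ} :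
      b.Holds σ → Run P σ t τ → Run (Prog.ite b P Q) σ (b.steps + t) τ
  | ite_false {b : Test} {P Q : Prog} {σ τ : Mem} {t : ℕ} :
      ¬ b.Holds σ → Run Q σ t τ → Run (Prog.ite b P Q) σ (b.steps + t) τ
  | loop_done {b : Test} {P : Prog} {σ : Mem} :
      ¬ b.Holds σ → Run (Prog.loop b P) σ b.steps σ
  | loop_step {b : Test} {P : Prog} {σ τ ρ : Mem} {s t : ℕ} :
      b.Holds σ → Run P σ s τ → Run (Prog.loop b P) τ t ρ →
        Run (Prog.loop b P) σ (b.steps + s + t) ρ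

/-! ## Algorithms for the problem -/

namespace Instance

/-- The initial memory on input `I`. Among the tables of natural numbers, entry `(0, 0)` of
table `0` holds the number of vertices, table `1` is the adjacency matrix, and table `2` is the
0-1 matrix of the demands. Table `0` of the weights is the matrix of edge weights. All other
entries are `0`. -/
noncomputable def input (I : Instance) : Mem where
  idx := fun a i j =>
    if a = 0 then (if i = 0 ∧ j = 0 then I.n else 0)
    else if a = 1 then (if (i, j) ∈ I.edges then 1 else 0)
    else if a = 2 then (if (i, j) ∈ I.demands then 1 else 0)
    else 0
  wt := fun a i j => if a = 0 ∧ (i, j) ∈ I.edges then I.weight (i, j) else 0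

/-- The network that a final memory describes: `uv` is chosen if and only if entry `(u, v)` of
table `3` of natural numbers is nonzero, where `u, v < n`. -/
def output (I : Instance) (σ : Mem) : Finset (ℕ × ℕ) :=
  (Finset.range I.n ×ˢ Finset.range I.n).filter (fun e => σ.idx 3 e.1 e.2 ≠ 0)

end Instance

/-- `P` is an `α`-approximation algorithm for Directed Steiner Network on bidirected graphs
with running time `T n k`, where `n` is the number of vertices and `k` the number of demands:
it halts within this time on every bidirected input graph, and outputs an `α`-approximate
solution whenever there is a solution at all. -/
def ApproximatesInTime (P : Prog) (α : ℝ) (T : ℕ → ℕ → ℝ) : Prop :=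
  ∀ I : Instance, I.Bidirected →
    ∃ (t : ℕ) (σ : Mem), Run P I.input t σ ∧ (t : ℝ) ≤ T I.n I.k ∧
      ((∃ M, I.Feasible M) → I.IsApprox α (I.output σ))

end BiDSN

/-! Forgetting edge directions turns the problem into Steiner Forest. A directed solution connects
every demand pair in the underlying undirected graph, so the undirected optimum is no larger.
Conversely, in a bidirected graph every edge of an undirected solution can be taken in both
directions, which at most doubles the cost. An undirected solution within a factor `α` of the
optimum thus yields ratio `2 * α` (`Instance.isApprox_of_connects`). It remains to solve Steiner
Forest within a factor 2 in polynomial time, and exactly in time polynomial in `4 ^ k` and `n`.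

Factor 2 is obtained by the local ratio method. Zero weight edges chosen so far split the vertices
into classes; a class is active if it separates some demand. In every round each edge is charged `ε`
for every active class that it leaves, with the largest `ε` that keeps the remaining weights
nonnegative, and the classes are merged along an edge that became free. For such a charge every
solution pays at least `ε` times the number of active classes
(`Instance.Connects.card_activeLabels_le`). An irredundant solution that is sparse, in the sense
that it has no more crossing edges than classes touched by them, pays at most twice that: degrees
are at most 2 on average, and an inactive class that is touched has degree at least 2, since a
single edge into it would be redundant (`Instance.sum_leaves_le`). The final solution arises only by
pruning at the end, so the invariant `Instance.LocalRatio` carries the inequality for all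
candidates, and sparsity is traced back from the final classes to the earlier ones
(`Instance.LocalRatio.step`).

The exact algorithm is a dynamic program in the style of Dreyfus and Wagner. A state is a set `A` of
terminals and a vertex `v`. A network realizes it if it connects the demand pairs inside `A`, and
connects to `v` the terminals of `A` whose partner is missing. States move along edges, unite at a
common vertex, and change the vertex freely when no terminal is waiting for its partner. An
induction on the number of edges shows that these rules reach the cost of every network in few
rounds (`TerminalData.derivable_of_realizes`). Once the optimum value is known, deleting edges as
long as a solution of that value remains leaves an optimum solution.

Running times come from the syntax: `Ensures` asserts total correctness together with the time bound
`Prog.timeBound`, which is polynomial in a bound on all loop lengths. Finally `4 ^ k` is below `2 ^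
(2 * k * log k)` up to a constant factor (`four_pow_le`). -/

namespace BiDSN

/-! ## Reasoning about programs -/

namespace Prog

/-- Whether a program contains an assignment to the given table of natural numbers. -/
def modI : Prog → ℕ → Bool
  | skip, _ => false
  | setIdx a _ _ _, b => a == b
  | setWt _ _ _ _, _ => false
  | seq P Q, b => P.modI b || Q.modI b
  | ite _ P Q, b => P.modI b || Q.modI b
  | loop _ P, b => P.modI b

/-- Whether a program contains an assignment to the given table of weights. -/
def modW : Prog → ℕ → Bool
  | skip, _ => false
  | setIdx _ _ _ _, _ => false
  | setWt a _ _ _, b => a == b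
  | seq P Q, b => P.modW b || Q.modW b
  | ite _ P Q, b => P.modW b || Q.modW b
  | loop _ P, b => P.modW b

/-- A bound on the running time of a program all of whose loops make at most `B` rounds. -/
def timeBound (B : ℕ) : Prog → ℕ
  | skip => 1
  | setIdx _ i j e => i.steps + j.steps + e.steps + 1
  | setWt _ i j e => i.steps + j.steps + e.steps + 1
  | seq P Q => P.timeBound B + Q.timeBound B
  | ite b P Q => b.steps + P.timeBound B + Q.timeBound B
  | loop b P => B * (b.steps + P.timeBound B) + b.steps

/-- The degree depends on the program text only: a loop adds one, and compositions and branches add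
the degrees of their parts. A bound on the loop lengths thereby becomes a bound on the running time.
-/
theorem timeBound_le_poly (P : Prog) :
    ∃ c d : ℕ, ∀ B, P.timeBound B ≤ c * (B + 1) ^ d := by
  have key : ∀ B d e : ℕ, (B + 1) ^ d ≤ (B + 1) ^ (d + e) := fun B d e =>
    Nat.pow_le_pow_right (Nat.succ_pos _) (Nat.le_add_right _ _)
  have one : ∀ B d : ℕ, 1 ≤ (B + 1) ^ d := fun B d => Nat.one_le_pow _ _ (Nat.succ_pos _)
  induction P with
  | skip => exact ⟨1, 0, fun B => by simp [timeBound]⟩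
  | setIdx a i j e => exact ⟨_, 0, fun B => by simp only [timeBound, pow_zero, mul_one]; exact le_rfl⟩
  | setWt a i j e => exact ⟨_, 0, fun B => by simp only [timeBound, pow_zero, mul_one]; exact le_rfl⟩
  | seq P Q hP hQ =>
    obtain ⟨c, d, h⟩ := hP
    obtain ⟨c', d', h'⟩ := hQ
    refine ⟨c + c', d + d', fun B => ?_⟩
    have h1 := (h B).trans (Nat.mul_le_mul_left c (key B d d'))
    have h2 := (h' B).trans (Nat.mul_le_mul_left c' (key B d' d))
    rw [add_comm d' d] at h2
    simp only [timeBound, add_mul]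
    omega
  | ite b P Q hP hQ =>
    obtain ⟨c, d, h⟩ := hP
    obtain ⟨c', d', h'⟩ := hQ
    refine ⟨b.steps + c + c', d + d', fun B => ?_⟩
    have h1 := (h B).trans (Nat.mul_le_mul_left c (key B d d'))
    have h2 := (h' B).trans (Nat.mul_le_mul_left c' (key B d' d))
    have h3 := Nat.mul_le_mul_left b.steps (one B (d + d'))
    rw [add_comm d' d] at h2
    simp only [timeBound, add_mul]
    omega
  | loop b P hP =>
    obtain ⟨c, d, h⟩ := hP
    refine ⟨b.steps + c, d + 1, fun B => ?_⟩
    have h3 := Nat.mul_le_mul_left b.steps (one B d)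
    calc B * (b.steps + P.timeBound B) + b.steps
        ≤ B * (b.steps * (B + 1) ^ d + c * (B + 1) ^ d) + b.steps * (B + 1) ^ d := by
          have := h B
          gcongr <;> omega
      _ ≤ (b.steps + c) * (B + 1) ^ (d + 1) := by
          rw [pow_succ]
          nlinarith [Nat.zero_le (c * (B + 1) ^ d)]

end Prog

/-- `τ` differs from `σ` at most in tables that occur in assignments of `P`. -/
def Frame (P : Prog) (σ τ : Mem) : Prop :=
  (∀ a, P.modI a = false → τ.idx a = σ.idx a) ∧ (∀ a, P.modW a = false → τ.wt a = σ.wt a)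

namespace Mem

@[simp] theorem idx_setIdx_of_ne (σ : Mem) {a b : ℕ} (i j x : ℕ) (h : b ≠ a) :
    (σ.setIdx a i j x).idx b = σ.idx b := by
  funext r c
  simp [setIdx, h]

@[simp] theorem idx_setIdx (σ : Mem) (a i j x r c : ℕ) :
    (σ.setIdx a i j x).idx a r c = if r = i ∧ c = j then x else σ.idx a r c := by
  simp [setIdx]

@[simp] theorem wt_setIdx (σ : Mem) (a i j x : ℕ) : (σ.setIdx a i j x).wt = σ.wt := rfl

@[simp] theorem wt_setWt_of_ne (σ : Mem) {a b : ℕ} (i j : ℕ) (x : ℝ) (h : b ≠ a) :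
    (σ.setWt a i j x).wt b = σ.wt b := by
  funext r c
  simp [setWt, h]

@[simp] theorem wt_setWt (σ : Mem) (a i j : ℕ) (x : ℝ) (r c : ℕ) :
    (σ.setWt a i j x).wt a r c = if r = i ∧ c = j then x else σ.wt a r c := by
  simp [setWt]

@[simp] theorem idx_setWt (σ : Mem) (a i j : ℕ) (x : ℝ) : (σ.setWt a i j x).idx = σ.idx := rfl

end Mem

namespace Frame

variable {P Q : Prog} {σ τ ρ : Mem}

theorem refl (P : Prog) (σ : Mem) : Frame P σ σ := ⟨fun _ _ => rfl, fun _ _ => rfl⟩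

theorem trans (h : Frame P σ τ) (h' : Frame P τ ρ) : Frame P σ ρ :=
  ⟨fun a ha => (h'.1 a ha).trans (h.1 a ha), fun a ha => (h'.2 a ha).trans (h.2 a ha)⟩

theorem mono (h : Frame P σ τ) (hI : ∀ a, Q.modI a = false → P.modI a = false)
    (hW : ∀ a, Q.modW a = false → P.modW a = false) : Frame Q σ τ :=
  ⟨fun a ha => h.1 a (hI a ha), fun a ha => h.2 a (hW a ha)⟩

end Frame

/-- What survives a run can be read off from the syntax. For concrete programs the conditions on
`modI` and `modW` are then closed by `rfl`. -/
theorem Run.frame {P : Prog} {σ τ : Mem} {t : ℕ} (h : Run P σ t τ) : Frame P σ τ := by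
  induction h with
  | skip σ => exact Frame.refl _ _
  | setIdx σ a i j e =>
    refine ⟨fun b hb => ?_, fun b _ => rfl⟩
    have : b ≠ a := by rintro rfl; simp [Prog.modI] at hb
    exact Mem.idx_setIdx_of_ne _ _ _ _ this
  | setWt σ a i j e =>
    refine ⟨fun b _ => rfl, fun b hb => ?_⟩
    have : b ≠ a := by rintro rfl; simp [Prog.modW] at hb
    exact Mem.wt_setWt_of_ne _ _ _ _ this
  | seq _ _ h1 h2 =>
    refine Frame.trans (h1.mono ?_ ?_) (h2.mono ?_ ?_) <;> intro a ha <;>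
      simp_all [Prog.modI, Prog.modW]
  | ite_true _ _ h1 =>
    refine h1.mono ?_ ?_ <;> intro a ha <;> simp_all [Prog.modI, Prog.modW]
  | ite_false _ _ h1 =>
    refine h1.mono ?_ ?_ <;> intro a ha <;> simp_all [Prog.modI, Prog.modW]
  | loop_done _ => exact Frame.refl _ _
  | loop_step _ _ _ h1 h2 => exact Frame.trans (h1.mono (fun _ h => h) (fun _ h => h)) h2

/-- Started in `σ`, the program `P` halts within the time that it needs if all its loops make at
most `B` rounds, and its final memory satisfies `Q`. -/
def Ensures (B : ℕ) (P : Prog) (σ : Mem) (Q : Mem → Prop) : Prop :=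
  ∃ t τ, Run P σ t τ ∧ t ≤ P.timeBound B ∧ Q τ

namespace Ensures

variable {B : ℕ} {P P' : Prog} {σ : Mem} {Q R : Mem → Prop}

theorem mono (h : Ensures B P σ Q) (hQ : ∀ τ, Frame P σ τ → Q τ → R τ) : Ensures B P σ R := by
  obtain ⟨t, τ, hr, ht, hq⟩ := h
  exact ⟨t, τ, hr, ht, hQ τ hr.frame hq⟩

theorem skip (h : Q σ) : Ensures B Prog.skip σ Q := ⟨_, _, Run.skip σ, le_rfl, h⟩

theorem setIdx {a : ℕ} {i j e : IExp} (h : Q (σ.setIdx a (i.eval σ) (j.eval σ) (e.eval σ))) :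
    Ensures B (Prog.setIdx a i j e) σ Q := ⟨_, _, Run.setIdx σ a i j e, le_rfl, h⟩

theorem setWt {a : ℕ} {i j : IExp} {e : WExp}
    (h : Q (σ.setWt a (i.eval σ) (j.eval σ) (e.eval σ))) :
    Ensures B (Prog.setWt a i j e) σ Q := ⟨_, _, Run.setWt σ a i j e, le_rfl, h⟩

/-- The frame of the first part is handed on to the second, so intermediate assertions need to
mention only what has changed. -/
theorem seq (h : Ensures B P σ Q) (h' : ∀ τ, Frame P σ τ → Q τ → Ensures B P' τ R) :
    Ensures B (Prog.seq P P') σ R := by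
  obtain ⟨t, τ, hr, ht, hq⟩ := h
  obtain ⟨t', τ', hr', ht', hq'⟩ := h' τ hr.frame hq
  exact ⟨_, _, Run.seq hr hr', Nat.add_le_add ht ht', hq'⟩

theorem seq' (h : Ensures B P σ (fun τ => Ensures B P' τ R)) :
    Ensures B (Prog.seq P P') σ R := h.seq fun _ _ h => h

theorem ite {b : Test} (h : b.Holds σ → Ensures B P σ Q) (h' : ¬ b.Holds σ → Ensures B P' σ Q) :
    Ensures B (Prog.ite b P P') σ Q := by
  by_cases hb : b.Holds σ
  · obtain ⟨t, τ, hr, ht, hq⟩ := h hb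
    exact ⟨_, _, Run.ite_true hb hr, by simp only [Prog.timeBound]; omega, hq⟩
  · obtain ⟨t, τ, hr, ht, hq⟩ := h' hb
    exact ⟨_, _, Run.ite_false hb hr, by simp only [Prog.timeBound]; omega, hq⟩

end Ensures

/-! ### Variables, tests and counting loops -/

/-- The entry `(0, 0)` of a table, used as a variable. -/
abbrev IExp.var (a : ℕ) : IExp := .cell a (.const 0) (.const 0)

/-- The entry `(0, 0)` of a table of weights, used as a variable. -/
abbrev WExp.var (a : ℕ) : WExp := .cell a (.const 0) (.const 0)

/-- Equality of natural numbers. -/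
abbrev Test.ieq (e f : IExp) : Test := .and (.ile e f) (.ile f e)

/-- Being a positive natural number. -/
abbrev Test.pos (e : IExp) : Test := .ile (.const 1) e

namespace Prog

/-- Assignment to a variable. -/
abbrev setVar (a : ℕ) (e : IExp) : Prog := .setIdx a (.const 0) (.const 0) e

/-- Conditional execution. -/
abbrev cond (b : Test) (P : Prog) : Prog := .ite b P .skip

/-- Execute `P` for all values of variable `x` below the value of variable `b`. -/
def forLoop (x b : ℕ) (P : Prog) : Prog :=
  .seq (setVar x (.const 0))
    (.loop (.not (.ile (.var b) (.var x)))
      (.seq P (setVar x (.add (.var x) (.const 1)))))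

end Prog

/-- `hb` ties the loop test to the counter, so exactly `N` rounds are made. Induction on the
remaining rounds gives termination, the time bound and the postcondition together. -/
theorem Ensures.loop_of_counter {B : ℕ} {b : Test} {P : Prog} {Q : Mem → Prop} {N : ℕ}
    (Inv : ℕ → Mem → Prop) (hN : N ≤ B)
    (hb : ∀ i τ, i ≤ N → Inv i τ → (b.Holds τ ↔ i < N))
    (step : ∀ i τ, i < N → Inv i τ → Ensures B P τ (Inv (i + 1)))
    (post : ∀ τ, Inv N τ → Q τ) (σ : Mem) (h0 : Inv 0 σ) : Ensures B (Prog.loop b P) σ Q := by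
  have key : ∀ r i σ, i + r = N → Inv i σ →
      ∃ t τ, Run (Prog.loop b P) σ t τ ∧ t ≤ r * (b.steps + P.timeBound B) + b.steps ∧ Q τ := by
    intro r
    induction r with
    | zero =>
      intro i σ hi h
      obtain rfl : i = N := by omega
      have : ¬ b.Holds σ := fun h' => lt_irrefl _ ((hb _ _ le_rfl h).1 h')
      exact ⟨_, _, Run.loop_done this, by simp, post _ h⟩
    | succ r ih =>
      intro i σ hi h
      have hlt : i < N := by omega
      obtain ⟨s, τ, hr, hs, hτ⟩ := step i σ hlt h
      obtain ⟨t, ρ, hr', ht, hρ⟩ := ih (i + 1) τ (by omega) hτ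
      refine ⟨_, _, Run.loop_step ((hb _ _ hlt.le h).2 hlt) hr hr', ?_, hρ⟩
      rw [Nat.succ_mul]
      omega
  obtain ⟨t, τ, hr, ht, hτ⟩ := key N 0 σ (by omega) h0
  refine ⟨t, τ, hr, ht.trans ?_, hτ⟩
  simp only [Prog.timeBound]
  gcongr

/-- The counter `x` is written outside the body, so the invariant must survive writes to it
(`stab`). The side condition `hx` is Boolean in order to be decided by evaluation. -/
theorem Ensures.forLoop {B : ℕ} {x b : ℕ} {P : Prog} {σ : Mem} {Q : Mem → Prop} {N : ℕ}
    (hN : σ.idx b 0 0 = N) (hB : N ≤ B)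
    (hx : (x != b && !P.modI x && !P.modI b) = true)
    (Inv : ℕ → Mem → Prop)
    (stab : ∀ i τ y, Inv i τ → Inv i (τ.setIdx x 0 0 y))
    (h0 : Inv 0 σ)
    (step : ∀ i τ, i < N → Frame (Prog.forLoop x b P) σ τ → τ.idx x 0 0 = i → Inv i τ →
      Ensures B P τ (Inv (i + 1)))
    (post : ∀ τ, Inv N τ → Q τ) :
    Ensures B (Prog.forLoop x b P) σ Q := by
  simp only [Bool.and_eq_true, bne_iff_ne, ne_eq, Bool.not_eq_true'] at hx
  obtain ⟨⟨hxb, hPx⟩, hPb⟩ := hx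
  have hF : Frame (Prog.forLoop x b P) σ (σ.setIdx x 0 0 0) := by
    refine ⟨fun a ha => ?_, fun _ _ => rfl⟩
    have : a ≠ x := by rintro rfl; simp [Prog.forLoop, Prog.modI] at ha
    exact Mem.idx_setIdx_of_ne _ _ _ _ this
  refine Ensures.seq' (Ensures.setIdx ?_)
  refine Ensures.loop_of_counter
    (fun i τ => Frame (Prog.forLoop x b P) σ τ ∧ τ.idx x 0 0 = i ∧ Inv i τ) hB ?_ ?_ ?_ _ ?_
  · rintro i τ - ⟨hf, hi, -⟩
    have : τ.idx b 0 0 = N := by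
      rw [hf.1 b, hN]
      simp [Prog.forLoop, Prog.modI, hPb, hxb]
    simp [Test.Holds, IExp.eval, this, hi]
  · rintro i τ hi ⟨hf, hxi, hInv⟩
    refine Ensures.seq (step i τ hi hf hxi hInv) fun τ' hf' hI => Ensures.setIdx ⟨?_, ?_, ?_⟩
    · refine hf.trans ⟨fun a ha => ?_, fun a ha => ?_⟩
      · have hne : a ≠ x := by rintro rfl; simp [Prog.forLoop, Prog.modI] at ha
        have hPa : P.modI a = false := by
          simp [Prog.forLoop, Prog.modI] at ha
          exact ha.2.1
        simp only [IExp.eval]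
        rw [Mem.idx_setIdx_of_ne _ _ _ _ hne]
        exact hf'.1 a hPa
      · have hPa : P.modW a = false := by
          simpa [Prog.forLoop, Prog.modW] using ha
        exact hf'.2 a hPa
    · simp [IExp.eval, hf'.1 x hPx, hxi]
    · exact stab _ _ _ hI
  · exact fun τ h => post τ h.2.2
  · exact ⟨hF, by simp [IExp.eval], stab _ _ _ h0⟩

namespace Prog

/-- Two nested counting loops. -/
def forLoop₂ (x b y d : ℕ) (P : Prog) : Prog := forLoop x b (forLoop y d P)

end Prog

/-- The invariant refers to the set of visited pairs and not to their order, so an application only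
has to treat a single insertion. -/
theorem Ensures.forLoop₂ {B : ℕ} {x b y d : ℕ} {P : Prog} {σ : Mem} {Q : Mem → Prop} {N M : ℕ}
    (hN : σ.idx b 0 0 = N) (hM : σ.idx d 0 0 = M) (hNB : N ≤ B) (hMB : M ≤ B)
    (hx : (x != b && x != y && x != d && y != b && y != d && !P.modI x && !P.modI b && !P.modI y
      && !P.modI d) = true)
    (Inv : Finset (ℕ × ℕ) → Mem → Prop)
    (stab : ∀ S τ c, Inv S τ → Inv S (τ.setIdx x 0 0 c))
    (stab' : ∀ S τ c, Inv S τ → Inv S (τ.setIdx y 0 0 c))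
    (h0 : Inv ∅ σ)
    (step : ∀ u v S τ, u < N → v < M → S ⊆ Finset.range N ×ˢ Finset.range M → (u, v) ∉ S →
      Frame (Prog.forLoop₂ x b y d P) σ τ → τ.idx x 0 0 = u → τ.idx y 0 0 = v → Inv S τ →
      Ensures B P τ (Inv (insert (u, v) S)))
    (post : ∀ τ, Inv (Finset.range N ×ˢ Finset.range M) τ → Q τ) :
    Ensures B (Prog.forLoop₂ x b y d P) σ Q := by
  simp only [Bool.and_eq_true, bne_iff_ne, ne_eq, Bool.not_eq_true'] at hx
  obtain ⟨⟨⟨⟨⟨⟨⟨⟨hxb, hxy⟩, hxd⟩, hyb⟩, hyd⟩, hPx⟩, hPb⟩, hPy⟩, hPd⟩ := hx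
  have hmodI : ∀ a, (Prog.forLoop₂ x b y d P).modI a = (x == a || y == a || P.modI a) := by
    intro a
    simp only [Prog.forLoop₂, Prog.forLoop, Prog.modI]
    cases x == a <;> cases y == a <;> cases P.modI a <;> rfl
  have hmodI' : ∀ a, (Prog.forLoop y d P).modI a = (y == a || P.modI a) := by
    intro a
    simp only [Prog.forLoop, Prog.modI]
    cases y == a <;> cases P.modI a <;> rfl
  have hmodW : ∀ a, (Prog.forLoop₂ x b y d P).modW a = P.modW a := by
    intro a; simp [Prog.forLoop₂, Prog.forLoop, Prog.modW]
  have hmodW' : ∀ a, (Prog.forLoop y d P).modW a = P.modW a := by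
    intro a; simp [Prog.forLoop, Prog.modW]
  -- The visited pairs are those lexicographically before `(u, v)`; a completed row is the start of
  -- the next one.
  let A : ℕ → ℕ → Finset (ℕ × ℕ) := fun u v =>
    (Finset.range N ×ˢ Finset.range M).filter (fun p => p.1 < u ∨ p.1 = u ∧ p.2 < v)
  have hA0 : A 0 0 = ∅ := by ext p; simp [A]
  have hAM : ∀ u, A u M = A (u + 1) 0 := by
    intro u; ext p
    simp only [A, Finset.mem_filter, Finset.mem_product, Finset.mem_range]
    omega
  have hAN : A N 0 = Finset.range N ×ˢ Finset.range M := by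
    ext p
    simp only [A, Finset.mem_filter, Finset.mem_product, Finset.mem_range]
    omega
  have hAs : ∀ u v, u < N → v < M → insert (u, v) (A u v) = A u (v + 1) := by
    rintro u v hu hv; ext ⟨p, q⟩
    simp only [A, Finset.mem_filter, Finset.mem_product, Finset.mem_range, Finset.mem_insert,
      Prod.mk.injEq]
    omega
  refine Ensures.forLoop hN hNB ?_ (fun u τ => Inv (A u 0) τ) (fun _ _ _ h => stab _ _ _ h)
    (by simpa [hA0] using h0) ?_ (fun τ h => post τ (by simpa [hAN] using h))
  · simp [hmodI', hxb, hPx, hPb, Ne.symm hxy, hyb]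
  intro u τ hu hf hxu hI
  have hdτ : τ.idx d 0 0 = M := by
    rw [← hM, hf.1 d ((hmodI d).trans (by simp [hxd, hyd, hPd]))]
  refine Ensures.forLoop hdτ hMB ?_ (fun v τ => Inv (A u v) τ) (fun _ _ _ h => stab' _ _ _ h)
    hI ?_ (fun τ h => by simpa [hAM] using h)
  · simp [hyd, hPy, hPd]
  intro v τ' hv hf' hyv hI'
  rw [← hAs u v hu hv]
  refine step u v (A u v) τ' hu hv (Finset.filter_subset _ _) (by simp [A]) ?_ ?_ hyv hI'
  · refine hf.trans (hf'.mono (fun a ha => ?_) (fun a ha => ?_))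
    · replace ha := (hmodI a).symm.trans ha
      rw [hmodI']
      revert ha
      cases x == a <;> cases y == a <;> cases P.modI a <;> simp
    · exact (hmodW' a).trans ((hmodW a).symm.trans ha)
  · rw [hf'.1 x (by simp [hmodI', hPx, Ne.symm hxy]), hxu]

/-! ## Undirected connectivity -/

/-- `x` and `y` are connected in the undirected graph that underlies `S`. -/
def Conn (S : Set (ℕ × ℕ)) : ℕ → ℕ → Prop := Relation.EqvGen (fun a b => (a, b) ∈ S)

namespace Conn

variable {S T : Set (ℕ × ℕ)} {x y z u v : ℕ}

theorem refl (S : Set (ℕ × ℕ)) (x : ℕ) : Conn S x x := Relation.EqvGen.refl x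

theorem symm (h : Conn S x y) : Conn S y x := Relation.EqvGen.symm _ _ h

theorem trans (h : Conn S x y) (h' : Conn S y z) : Conn S x z := Relation.EqvGen.trans _ _ _ h h'

theorem edge (h : (x, y) ∈ S) : Conn S x y := Relation.EqvGen.rel _ _ h

theorem mono (hST : S ⊆ T) (h : Conn S x y) : Conn T x y :=
  Relation.EqvGen.mono (fun _ _ hab => hST hab) _ _ h

theorem invariant {p : ℕ → Prop} (hp : ∀ e ∈ S, p e.1 ↔ p e.2) (h : Conn S x y) : p x ↔ p y := by
  induction h with
  | rel a b hab => exact hp _ hab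
  | refl a => exact Iff.rfl
  | symm a b _ ih => exact ih.symm
  | trans a b c _ _ ih ih' => exact ih.trans ih'

theorem exists_crossing {p : ℕ → Prop} (h : Conn S x y) (hp : ¬(p x ↔ p y)) :
    ∃ e ∈ S, ¬(p e.1 ↔ p e.2) := by
  by_contra! hcon
  exact hp (h.invariant hcon)

/-- No edge of `S` leaves `p`, so a connection that starts inside `p` uses only edges that belong to
`T` as well. -/
theorem of_mem_iff {p : ℕ → Prop} (hp : ∀ e ∈ S, p e.1 ↔ p e.2)
    (hT : ∀ e ∈ S, p e.1 → e ∈ T) (h : Conn S x y) (hx : p x) : Conn T x y := by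
  induction h with
  | rel a b hab => exact Conn.edge (hT _ hab hx)
  | refl a => exact Conn.refl _ _
  | symm a b hab ih => exact Conn.symm (ih ((Conn.invariant (S := S) hp hab).2 hx))
  | trans a b c hab _ ih ih' =>
    exact Conn.trans (ih hx) (ih' ((Conn.invariant (S := S) hp hab).1 hx))

/-- One passage through the new edge suffices: two in opposite directions cancel, and two in the
same direction can be replaced by one, between the start of the first and the end of the second. -/
theorem insert_iff : Conn (insert (u, v) S) x y ↔
    Conn S x y ∨ (Conn S x u ∧ Conn S v y) ∨ (Conn S x v ∧ Conn S u y) := by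
  constructor
  · intro h
    induction h with
    | rel a b hab =>
      rcases hab with hab | hab
      · obtain ⟨rfl, rfl⟩ := Prod.mk.inj hab
        exact Or.inr (Or.inl ⟨refl _ _, refl _ _⟩)
      · exact Or.inl (edge hab)
    | refl a => exact Or.inl (refl _ _)
    | symm a b _ ih =>
      rcases ih with h | ⟨h1, h2⟩ | ⟨h1, h2⟩
      · exact Or.inl h.symm
      · exact Or.inr (Or.inr ⟨h2.symm, h1.symm⟩)
      · exact Or.inr (Or.inl ⟨h2.symm, h1.symm⟩)
    | trans a b c _ _ ih ih' =>
      rcases ih with h | ⟨h1, h2⟩ | ⟨h1, h2⟩ <;> rcases ih' with h' | ⟨h1', h2'⟩ | ⟨h1', h2'⟩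
      · exact Or.inl (h.trans h')
      · exact Or.inr (Or.inl ⟨h.trans h1', h2'⟩)
      · exact Or.inr (Or.inr ⟨h.trans h1', h2'⟩)
      · exact Or.inr (Or.inl ⟨h1, h2.trans h'⟩)
      · exact Or.inr (Or.inl ⟨h1, h2'⟩)
      · exact Or.inl (h1.trans h2')
      · exact Or.inr (Or.inr ⟨h1, h2.trans h'⟩)
      · exact Or.inl (h1.trans h2')
      · exact Or.inr (Or.inr ⟨h1, h2'⟩)
  · have hm : S ⊆ insert (u, v) S := Set.subset_insert _ _
    have he : Conn (insert (u, v) S) u v := edge (Set.mem_insert _ _)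
    rintro (h | ⟨h1, h2⟩ | ⟨h1, h2⟩)
    · exact h.mono hm
    · exact ((h1.mono hm).trans he).trans (h2.mono hm)
    · exact ((h1.mono hm).trans he.symm).trans (h2.mono hm)

end Conn

/-- The labels `L` of the vertices below `n` represent the connected components of `S`. -/
def Labels (n : ℕ) (L : ℕ → ℕ) (S : Set (ℕ × ℕ)) : Prop :=
  ∀ x < n, ∀ y < n, L x = L y ↔ Conn S x y

theorem labels_id (n : ℕ) {L : ℕ → ℕ} (hL : ∀ x < n, L x = x) : Labels n L ∅ := by
  intro x hx y hy
  rw [hL x hx, hL y hy]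
  refine ⟨fun h => h ▸ Conn.refl _ _, fun h => ?_⟩
  exact (h.invariant (p := fun z => x = z) (by simp)).1 rfl

/-- The class of `v` takes over the label of `u`; by `Conn.insert_iff` exactly these two classes are
joined. -/
theorem Labels.merge {n : ℕ} {L L' : ℕ → ℕ} {S : Set (ℕ × ℕ)} (h : Labels n L S) {u v : ℕ}
    (hu : u < n) (hv : v < n) (hL' : ∀ x < n, L' x = if L x = L v then L u else L x) :
    Labels n L' (insert (u, v) S) := by
  intro x hx y hy
  rw [Conn.insert_iff, ← h x hx y hy, ← h x hx u hu, ← h v hv y hy, ← h x hx v hv, ← h u hu y hy,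
    hL' x hx, hL' y hy]
  split_ifs <;> grind

/-! ## From undirected to bidirected networks -/

namespace Instance

variable (I : Instance)

/-- `N` is a subgraph that connects the demand pairs when edge directions are ignored. -/
def Connects (N : Finset (ℕ × ℕ)) : Prop :=
  N ⊆ I.edges ∧ ∀ d ∈ I.demands, Conn (N : Set (ℕ × ℕ)) d.1 d.2

/-- No edge of `X` can be removed without losing the property `φ`. -/
def _root_.BiDSN.Irredundant (φ : Finset (ℕ × ℕ) → Prop) (X : Finset (ℕ × ℕ)) : Prop :=
  φ X ∧ ∀ e ∈ X, ¬ φ (X.erase e)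

variable {I}

/-- The lower bound half of the reduction: the undirected optimum does not exceed the directed one.
-/
theorem Connects.of_feasible {N : Finset (ℕ × ℕ)} (h : I.Feasible N) : I.Connects N :=
  ⟨h.1, fun d hd => by
    obtain ⟨s, t⟩ := d
    have h' : Relation.ReflTransGen (fun u v => (u, v) ∈ N) s t := h.2 _ hd
    clear hd
    induction h' with
    | refl => exact Conn.refl _ _
    | tail _ hbc ih => exact ih.trans (Conn.edge hbc)⟩

theorem cost_nonneg {N : Finset (ℕ × ℕ)} (h : N ⊆ I.edges) : 0 ≤ I.cost N :=
  Finset.sum_nonneg fun e he => I.weight_nonneg e (h he)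

theorem cost_union_le {N M : Finset (ℕ × ℕ)} (hN : N ⊆ I.edges) :
    I.cost (N ∪ M) ≤ I.cost N + I.cost M := by
  have h1 : I.cost (N ∪ M) + I.cost (N ∩ M) = I.cost N + I.cost M := Finset.sum_union_inter
  have h2 : 0 ≤ I.cost (N ∩ M) := cost_nonneg fun e he => hN (Finset.mem_inter.1 he).1
  linarith

/-- By bidirectedness the reversed edges exist and cost the same, and with them every undirected
path can be followed in either direction. -/
theorem isApprox_of_connects (hI : I.Bidirected) {α : ℝ} {X : Finset (ℕ × ℕ)} (hX : I.Connects X)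
    (hα : ∀ M, I.Connects M → I.cost X ≤ α * I.cost M) :
    I.IsApprox (2 * α) (X ∪ X.image Prod.swap) := by
  have hsw : X.image Prod.swap ⊆ I.edges := by
    intro e he
    obtain ⟨⟨a, b⟩, hf, rfl⟩ := Finset.mem_image.1 he
    exact (hI a b (hX.1 hf)).1
  refine ⟨⟨Finset.union_subset hX.1 hsw, fun d hd => ?_⟩, fun M hM => ?_⟩
  · have key : ∀ x y, Conn (X : Set (ℕ × ℕ)) x y →
        Relation.ReflTransGen (fun u v => (u, v) ∈ X ∪ X.image Prod.swap) x y ∧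
        Relation.ReflTransGen (fun u v => (u, v) ∈ X ∪ X.image Prod.swap) y x := by
      intro x y h
      induction h with
      | rel a b hab =>
        refine ⟨.single (Finset.mem_union_left _ hab), .single (Finset.mem_union_right _ ?_)⟩
        exact Finset.mem_image.2 ⟨(a, b), hab, rfl⟩
      | refl a => exact ⟨.refl, .refl⟩
      | symm a b _ ih => exact ih.symm
      | trans a b c _ _ ih ih' => exact ⟨ih.1.trans ih'.1, ih'.2.trans ih.2⟩
    exact (key _ _ (hX.2 d hd)).1
  · have h1 : I.cost (X.image Prod.swap) = I.cost X := by
      unfold cost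
      rw [Finset.sum_image (fun a _ b _ h => Prod.swap_injective h)]
      exact Finset.sum_congr rfl fun e he => (hI e.1 e.2 (hX.1 he)).2
    have h2 := hα M (.of_feasible hM)
    have h3 := cost_union_le (M := X.image Prod.swap) hX.1
    linarith

end Instance

/-! ## The local ratio method for connecting demand pairs -/

namespace Instance

variable (I : Instance)

/-- The class of vertices with label `a` separates some demand pair. -/
def Active (L : ℕ → ℕ) (a : ℕ) : Prop := ∃ d ∈ I.demands, ¬(L d.1 = a ↔ L d.2 = a)

open Classical in
/-- The indicator of the active classes. -/
noncomputable def act (L : ℕ → ℕ) (a : ℕ) : ℕ := if I.Active L a then 1 else 0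

/-- The number of active classes that an edge leaves. -/
noncomputable def leaves (L : ℕ → ℕ) (e : ℕ × ℕ) : ℕ :=
  if L e.1 = L e.2 then 0 else I.act L (L e.1) + I.act L (L e.2)

open Classical in
/-- The labels of the active classes. -/
noncomputable def activeLabels (L : ℕ → ℕ) : Finset ℕ :=
  (I.demands.image (fun d => L d.1) ∪ I.demands.image (fun d => L d.2)).filter (I.Active L)

/-- The labels of the end points of edges in `Y`. -/
def _root_.BiDSN.touched (L : ℕ → ℕ) (Y : Finset (ℕ × ℕ)) : Finset ℕ :=
  Y.image (fun e => L e.1) ∪ Y.image (fun e => L e.2)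

/-- No set of edges of `X` between different classes has more edges than it touches classes. -/
def _root_.BiDSN.Sparse (L : ℕ → ℕ) (X : Finset (ℕ × ℕ)) : Prop :=
  ∀ Y ⊆ X, (∀ e ∈ Y, L e.1 ≠ L e.2) → Y.card ≤ (touched L Y).card

variable {I}

theorem mem_activeLabels {L : ℕ → ℕ} {a : ℕ} : a ∈ I.activeLabels L ↔ I.Active L a := by
  classical
  simp only [activeLabels, Finset.mem_filter, Finset.mem_union, Finset.mem_image,
    and_iff_right_iff_imp]
  rintro ⟨d, hd, h⟩
  by_cases h1 : L d.1 = a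
  · exact Or.inl ⟨d, hd, h1⟩
  · by_cases h2 : L d.2 = a
    · exact Or.inr ⟨d, hd, h2⟩
    · exact absurd (iff_of_false h1 h2) h

/-- The number of end points of `e` with label `a`. -/
def _root_.BiDSN.incidence (L : ℕ → ℕ) (e : ℕ × ℕ) (a : ℕ) : ℕ :=
  (if L e.1 = a then 1 else 0) + (if L e.2 = a then 1 else 0)

/-- Double counting of the incidences between edges and classes, weighted by `g`. -/
theorem _root_.BiDSN.sum_endpoints (L : ℕ → ℕ) (Y : Finset (ℕ × ℕ)) (g : ℕ → ℕ) :
    ∑ e ∈ Y, (g (L e.1) + g (L e.2)) = ∑ a ∈ touched L Y, g a * ∑ e ∈ Y, incidence L e a := by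
  simp_rw [Finset.mul_sum]
  rw [Finset.sum_comm]
  refine Finset.sum_congr rfl fun e he => ?_
  have h1 : L e.1 ∈ touched L Y := Finset.mem_union_left _ (Finset.mem_image_of_mem _ he)
  have h2 : L e.2 ∈ touched L Y :=
    Finset.mem_union_right _ (Finset.mem_image_of_mem (fun e => L e.2) he)
  simp [incidence, mul_add, Finset.sum_add_distrib, h1, h2]

theorem sum_leaves (L : ℕ → ℕ) (X : Finset (ℕ × ℕ)) :
    ∑ e ∈ X, I.leaves L e = ∑ a ∈ touched L (X.filter fun e => L e.1 ≠ L e.2),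
      I.act L a * ∑ e ∈ X.filter (fun e => L e.1 ≠ L e.2), incidence L e a := by
  rw [← sum_endpoints, Finset.sum_filter]
  refine Finset.sum_congr rfl fun e _ => ?_
  unfold leaves
  split_ifs <;> tauto

/-- Every solution leaves every active class. -/
theorem Connects.card_activeLabels_le {N : Finset (ℕ × ℕ)} (hN : I.Connects N) (L : ℕ → ℕ) :
    (I.activeLabels L).card ≤ ∑ e ∈ N, I.leaves L e := by
  classical
  have hcr : ∀ a, I.Active L a →
      ∃ e ∈ N.filter (fun e => L e.1 ≠ L e.2), L e.1 = a ∨ L e.2 = a := by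
    rintro a ⟨d, hd, hda⟩
    obtain ⟨e, he, h⟩ := (hN.2 d hd).exists_crossing (p := fun z => L z = a) hda
    refine ⟨e, Finset.mem_filter.2 ⟨he, fun h' => h (by simp [h'])⟩, ?_⟩
    tauto
  rw [sum_leaves, Finset.card_eq_sum_ones]
  have hsub : I.activeLabels L ⊆ touched L (N.filter fun e => L e.1 ≠ L e.2) := by
    intro a ha
    obtain ⟨e, he, h | h⟩ := hcr a (mem_activeLabels.1 ha)
    · exact Finset.mem_union_left _ (Finset.mem_image.2 ⟨e, he, h⟩)
    · exact Finset.mem_union_right _ (Finset.mem_image.2 ⟨e, he, h⟩)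
  refine le_trans (Finset.sum_le_sum fun a ha => ?_)
    (Finset.sum_le_sum_of_subset_of_nonneg hsub fun _ _ _ => Nat.zero_le _)
  have hact := mem_activeLabels.1 ha
  obtain ⟨e, he, h⟩ := hcr a hact
  have h1 : incidence L e a ≤ ∑ e ∈ N.filter (fun e => L e.1 ≠ L e.2), incidence L e a :=
    Finset.single_le_sum (f := fun e => incidence L e a) (fun _ _ => Nat.zero_le _) he
  have h2 : 1 ≤ incidence L e a := by
    rcases h with h | h <;> simp [incidence, h]
  simp only [act, hact, if_true, one_mul]
  exact h2.trans h1

/-- If the class met a single crossing edge `e`, that edge would be its only exit. By irredundancy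
some demand needs `e`, and so the class separates this demand and is active. -/
theorem two_le_incidence {X : Finset (ℕ × ℕ)} (hX : Irredundant I.Connects X) (L : ℕ → ℕ) {a : ℕ}
    (ha : a ∈ touched L (X.filter fun e => L e.1 ≠ L e.2)) (hact : ¬ I.Active L a) :
    2 ≤ ∑ e ∈ X.filter (fun e => L e.1 ≠ L e.2), incidence L e a := by
  classical
  obtain ⟨e, he, hea⟩ : ∃ e ∈ X.filter (fun e => L e.1 ≠ L e.2), L e.1 = a ∨ L e.2 = a := by
    rcases Finset.mem_union.1 ha with h | h <;> obtain ⟨e, he, h⟩ := Finset.mem_image.1 h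
    · exact ⟨e, he, Or.inl h⟩
    · exact ⟨e, he, Or.inr h⟩
  by_contra! hlt
  have h1 : 1 ≤ incidence L e a := by rcases hea with h | h <;> simp [incidence, h]
  have hother : ∀ e' ∈ X.filter (fun e => L e.1 ≠ L e.2), e' ≠ e → incidence L e' a = 0 := by
    intro e' he' hne
    rw [← Finset.add_sum_erase _ _ he] at hlt
    have := Finset.single_le_sum (f := fun e => incidence L e a) (fun _ _ => Nat.zero_le _)
      (Finset.mem_erase.2 ⟨hne, he'⟩)
    omega
  obtain ⟨heX, hecr⟩ := Finset.mem_filter.1 he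
  have hinv : ∀ e' ∈ ((X.erase e : Finset (ℕ × ℕ)) : Set (ℕ × ℕ)), L e'.1 = a ↔ L e'.2 = a := by
    intro e' he'
    obtain ⟨hne, heX'⟩ := Finset.mem_erase.1 (Finset.mem_coe.1 he')
    by_cases hc : L e'.1 = L e'.2
    · rw [hc]
    · have := hother e' (Finset.mem_filter.2 ⟨heX', hc⟩) hne
      simp only [incidence, Nat.add_eq_zero_iff, ite_eq_right_iff, one_ne_zero, imp_false] at this
      exact iff_of_false this.1 this.2
  have hnc := hX.2 e heX
  have : ∃ d ∈ I.demands, ¬ Conn ((X.erase e : Finset (ℕ × ℕ)) : Set (ℕ × ℕ)) d.1 d.2 := by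
    by_contra! hcon
    exact hnc ⟨(Finset.erase_subset _ _).trans hX.1.1, hcon⟩
  obtain ⟨d, hd, hdn⟩ := this
  have hdX := hX.1.2 d hd
  have hXe : (X : Set (ℕ × ℕ)) = insert (e.1, e.2) ((X.erase e : Finset (ℕ × ℕ)) : Set (ℕ × ℕ)) := by
    rw [Prod.mk.eta, ← Finset.coe_insert, Finset.insert_erase heX]
  -- The demand is connected through `e`, and the two remaining pieces avoid `e`, so each stays on
  -- its side of the class.
  rw [hXe, Conn.insert_iff] at hdX
  refine hact ⟨d, hd, ?_⟩
  rcases hdX with h | ⟨h, h'⟩ | ⟨h, h'⟩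
  · exact absurd h hdn
  · have e1 := h.invariant (p := fun z => L z = a) hinv
    have e2 := h'.invariant (p := fun z => L z = a) hinv
    rw [e1, ← e2]
    grind
  · have e1 := h.invariant (p := fun z => L z = a) hinv
    have e2 := h'.invariant (p := fun z => L z = a) hinv
    rw [e1, ← e2]
    grind

/-- A sparse irredundant solution leaves active classes on average at most twice. -/
theorem sum_leaves_le {X : Finset (ℕ × ℕ)} (hX : Irredundant I.Connects X) {L : ℕ → ℕ}
    (hs : Sparse L X) : ∑ e ∈ X, I.leaves L e ≤ 2 * (I.activeLabels L).card := by
  classical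
  set Y := X.filter fun e => L e.1 ≠ L e.2 with hY
  set T := touched L Y with hT
  -- A nonempty forest would satisfy this strictly. The weak form suffices, and it needs no
  -- exception for `Y = ∅`.
  have hcard : Y.card ≤ T.card :=
    hs Y (Finset.filter_subset _ _) fun e he => (Finset.mem_filter.1 he).2
  have hact : ∀ a, I.act L a + (1 - I.act L a) = 1 := fun a => by
    unfold act; split_ifs <;> rfl
  -- The total degree `2 * Y.card` is split into an active and an inactive part. Inactive touched
  -- classes use up at least 2 each, which leaves at most 2 on average for the active ones.
  have e1 : ∑ e ∈ Y, (I.act L (L e.1) + I.act L (L e.2)) +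
      ∑ e ∈ Y, ((1 - I.act L (L e.1)) + (1 - I.act L (L e.2))) = 2 * Y.card := by
    rw [← Finset.sum_add_distrib, Finset.card_eq_sum_ones, Finset.mul_sum]
    refine Finset.sum_congr rfl fun e _ => ?_
    have := hact (L e.1)
    have := hact (L e.2)
    omega
  have e2 : ∑ e ∈ Y, ((1 - I.act L (L e.1)) + (1 - I.act L (L e.2))) ≥
      ∑ a ∈ T, (1 - I.act L a) * 2 := by
    rw [sum_endpoints L Y (fun a => 1 - I.act L a)]
    refine Finset.sum_le_sum fun a ha => ?_
    by_cases h : I.Active L a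
    · simp [act, h]
    · exact Nat.mul_le_mul_left _ (two_le_incidence hX L ha h)
  have e3 : ∑ a ∈ T, I.act L a * 2 + ∑ a ∈ T, (1 - I.act L a) * 2 = 2 * T.card := by
    rw [← Finset.sum_add_distrib, Finset.card_eq_sum_ones, Finset.mul_sum]
    refine Finset.sum_congr rfl fun a _ => ?_
    have := hact a
    omega
  have e4 : ∑ a ∈ T, I.act L a * 2 ≤ 2 * (I.activeLabels L).card := by
    rw [← Finset.sum_mul, mul_comm]
    refine Nat.mul_le_mul_left _ ?_
    unfold act
    rw [← Finset.card_filter]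
    exact Finset.card_le_card fun a ha => mem_activeLabels.2 (Finset.mem_filter.1 ha).2
  rw [sum_leaves, ← sum_endpoints, ← hY]
  omega

variable (I) in
/-- The invariant of the local ratio method. The current weights are `c`, the zero weight edges
chosen so far are `F`, and `L` are the labels of the components of `F`. -/
structure LocalRatio (L : ℕ → ℕ) (c : ℕ × ℕ → ℝ) (F : Finset (ℕ × ℕ)) : Prop where
  labels : Labels I.n L F
  subset : F ⊆ I.edges
  nonneg : ∀ e ∈ I.edges, 0 ≤ c e
  eq_zero : ∀ e ∈ F, c e = 0
  ratio : ∀ X, Irredundant I.Connects X → (∀ e ∈ X, L e.1 = L e.2 → e ∈ F) → Sparse L X →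
    ∀ N, I.Connects N → I.cost X + 2 * ∑ e ∈ N, c e ≤ ∑ e ∈ X, c e + 2 * I.cost N

theorem LocalRatio.init {L : ℕ → ℕ} {c : ℕ × ℕ → ℝ} (hL : ∀ x < I.n, L x = x)
    (hc : ∀ e ∈ I.edges, c e = I.weight e) : I.LocalRatio L c ∅ where
  labels := by simpa using labels_id I.n hL
  subset := by simp
  nonneg e he := by rw [hc e he]; exact I.weight_nonneg e he
  eq_zero := by simp
  ratio X hX _ _ N hN := by
    rw [Finset.sum_congr rfl fun e he => hc e (hX.1.1 he),
      Finset.sum_congr rfl fun e he => hc e (hN.1 he)]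
    exact le_rfl

/-- The weight removed in this round is `ε * leaves`, for which a sparse irredundant solution pays
at most twice as much as any solution. The main work is to transfer the conditions on `X` from the
merged labels back to the old ones, where the inequality is already known. -/
theorem LocalRatio.step {L L' : ℕ → ℕ} {c c' : ℕ × ℕ → ℝ} {F : Finset (ℕ × ℕ)}
    (h : I.LocalRatio L c F) {u v : ℕ} (huv : (u, v) ∈ I.edges) (hne : L u ≠ L v) {ε : ℝ}
    (hε : 0 ≤ ε) (hmin : ∀ e ∈ I.edges, ε * I.leaves L e ≤ c e)
    (heq : ε * I.leaves L (u, v) = c (u, v))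
    (hL' : ∀ x < I.n, L' x = if L x = L v then L u else L x)
    (hc' : ∀ e ∈ I.edges, c' e = c e - ε * I.leaves L e) :
    I.LocalRatio L' c' (insert (u, v) F) := by
  obtain ⟨hu, hv⟩ := I.edges_lt _ huv
  simp only at hu hv
  have hF : ∀ e ∈ F, L e.1 = L e.2 := fun e he =>
    (h.labels _ (I.edges_lt _ (h.subset he)).1 _ (I.edges_lt _ (h.subset he)).2).2 (Conn.edge he)
  refine ⟨?_, ?_, ?_, ?_, ?_⟩
  · rw [Finset.coe_insert]
    exact h.labels.merge hu hv hL'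
  · exact Finset.insert_subset huv h.subset
  · intro e he
    rw [hc' e he]
    linarith [hmin e he]
  · intro e he
    rcases Finset.mem_insert.1 he with rfl | he
    · rw [hc' _ huv]; linarith
    · rw [hc' _ (h.subset he), h.eq_zero e he]
      simp [leaves, hF e he]
  · intro X hX hXF hs N hN
    have hLL' : ∀ e ∈ X, L e.1 = L e.2 → L' e.1 = L' e.2 := by
      intro e he h1
      have := I.edges_lt e (hX.1.1 he)
      rw [hL' _ this.1, hL' _ this.2, h1]
    have hXF' : ∀ e ∈ X, L e.1 = L e.2 → e ∈ F := by
      intro e he h1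
      rcases Finset.mem_insert.1 (hXF e he (hLL' e he h1)) with rfl | h2
      · exact absurd h1 hne
      · exact h2
    -- Inside the new classes `X` has only edges of `F` and possibly `(u, v)`; every other crossing
    -- edge therefore still crosses.
    have hcr : ∀ e ∈ X, L e.1 ≠ L e.2 → e ≠ (u, v) → L' e.1 ≠ L' e.2 := by
      intro e he h1 h2 h3
      rcases Finset.mem_insert.1 (hXF e he h3) with h4 | h4
      · exact h2 h4
      · exact h1 (hF e h4)
    have hsp : Sparse L X := by
      intro Y hYX hYc
      by_cases heY : (u, v) ∈ Y
      -- Merging costs the edge `(u, v)` on the left and the label `L v` on the right, so the two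
      -- sides drop together.
      · have h1 := hs (Y.erase (u, v)) ((Finset.erase_subset _ _).trans hYX) fun e he =>
          hcr e (hYX (Finset.mem_of_mem_erase he)) (hYc e (Finset.mem_of_mem_erase he))
            (Finset.ne_of_mem_erase he)
        have hLu : L u ∈ touched L Y := Finset.mem_union_left _ (Finset.mem_image_of_mem
          (fun e : ℕ × ℕ => L e.1) heY)
        have hLv : L v ∈ touched L Y := Finset.mem_union_right _ (Finset.mem_image_of_mem
          (fun e : ℕ × ℕ => L e.2) heY)
        have h2 : touched L' (Y.erase (u, v)) ⊆ (touched L Y).erase (L v) := by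
          intro a ha
          rcases Finset.mem_union.1 ha with h | h <;> obtain ⟨e, he, rfl⟩ := Finset.mem_image.1 h
          · have heY' := Finset.mem_of_mem_erase he
            rw [hL' _ (I.edges_lt e (hX.1.1 (hYX heY'))).1]
            split_ifs with hlab
            · exact Finset.mem_erase.2 ⟨hne, hLu⟩
            · exact Finset.mem_erase.2 ⟨hlab, Finset.mem_union_left _
                (Finset.mem_image_of_mem (fun e : ℕ × ℕ => L e.1) heY')⟩
          · have heY' := Finset.mem_of_mem_erase he
            rw [hL' _ (I.edges_lt e (hX.1.1 (hYX heY'))).2]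
            split_ifs with hlab
            · exact Finset.mem_erase.2 ⟨hne, hLu⟩
            · exact Finset.mem_erase.2 ⟨hlab, Finset.mem_union_right _
                (Finset.mem_image_of_mem (fun e : ℕ × ℕ => L e.2) heY')⟩
        have h3 := Finset.card_le_card h2
        rw [Finset.card_erase_of_mem hLv] at h3
        rw [Finset.card_erase_of_mem heY] at h1
        have h4 := Finset.card_pos.2 ⟨_, hLv⟩
        omega
      -- Here the edge count is unchanged, and relabelling can only lower the number of touched
      -- classes.
      · have h1 := hs Y hYX fun e he => hcr e (hYX he) (hYc e he) fun h => heY (h ▸ he)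
        have h2 : touched L' Y = (touched L Y).image fun a => if a = L v then L u else a := by
          unfold touched
          rw [Finset.image_union, Finset.image_image, Finset.image_image]
          congr 1
          · exact Finset.image_congr fun e he => hL' _ (I.edges_lt e (hX.1.1 (hYX he))).1
          · exact Finset.image_congr fun e he => hL' _ (I.edges_lt e (hX.1.1 (hYX he))).2
        rw [h2] at h1
        exact h1.trans Finset.card_image_le
    have h1 := h.ratio X hX hXF' hsp N hN
    have h2 : ((∑ e ∈ X, I.leaves L e : ℕ) : ℝ) ≤ 2 * (∑ e ∈ N, I.leaves L e : ℕ) := by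
      exact_mod_cast (sum_leaves_le hX hsp).trans
        (Nat.mul_le_mul_left 2 (hN.card_activeLabels_le L))
    have h3 : ∀ Z, I.Connects Z →
        ∑ e ∈ Z, c' e = ∑ e ∈ Z, c e - ε * (∑ e ∈ Z, I.leaves L e : ℕ) := by
      intro Z hZ
      rw [Finset.sum_congr rfl fun e he => hc' e (hZ.1 he), Finset.sum_sub_distrib, Nat.cast_sum,
        Finset.mul_sum]
    rw [h3 X hX.1, h3 N hN]
    nlinarith

theorem LocalRatio.connects {L : ℕ → ℕ} {c : ℕ × ℕ → ℝ} {F : Finset (ℕ × ℕ)}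
    (h : I.LocalRatio L c F) (hL : ∀ d ∈ I.demands, L d.1 = L d.2) : I.Connects F :=
  ⟨h.subset, fun d hd => (h.labels _ (I.demands_lt d hd).1 _ (I.demands_lt d hd).2).1 (hL d hd)⟩

/-- All edges of `X` are free and inside classes, so sparsity is vacuous and the remaining weight of
`X` is zero; that of `N` is nonnegative and can be dropped. -/
theorem LocalRatio.cost_le {L : ℕ → ℕ} {c : ℕ × ℕ → ℝ} {F X N : Finset (ℕ × ℕ)}
    (h : I.LocalRatio L c F) (hX : Irredundant I.Connects X) (hXF : X ⊆ F) (hN : I.Connects N) :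
    I.cost X ≤ 2 * I.cost N := by
  have hF : ∀ e ∈ F, L e.1 = L e.2 := fun e he =>
    (h.labels _ (I.edges_lt _ (h.subset he)).1 _ (I.edges_lt _ (h.subset he)).2).2 (Conn.edge he)
  have h1 := h.ratio X hX (fun e he _ => hXF he) (fun Y hY hcr => ?_) N hN
  · rw [Finset.sum_eq_zero fun e he => h.eq_zero e (hXF he)] at h1
    have : 0 ≤ ∑ e ∈ N, c e := Finset.sum_nonneg fun e he => h.nonneg e (hN.1 he)
    linarith
  · have : Y = ∅ := Finset.eq_empty_of_forall_notMem fun e he => hcr e he (hF e (hXF (hY he)))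
    simp [this]

end Instance

/-! ## Programs on networks -/

/-- The network that is described by a 0-1 matrix. -/
def netOf (n : ℕ) (G : ℕ → ℕ → ℕ) : Finset (ℕ × ℕ) :=
  (Finset.range n ×ˢ Finset.range n).filter fun e => G e.1 e.2 ≠ 0

theorem mem_netOf {n : ℕ} {G : ℕ → ℕ → ℕ} {u v : ℕ} :
    (u, v) ∈ netOf n G ↔ u < n ∧ v < n ∧ G u v ≠ 0 := by
  simp [netOf, and_assoc]

theorem netOf_inter (n : ℕ) (G : ℕ → ℕ → ℕ) :
    netOf n G ∩ (Finset.range n ×ˢ Finset.range n) = netOf n G :=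
  Finset.inter_eq_left.2 (Finset.filter_subset _ _)

/-- The parts of the memory that hold the input `I`. -/
structure Env (I : Instance) (σ : Mem) : Prop where
  size : σ.idx 0 0 0 = I.n
  edges : σ.idx 1 = I.input.idx 1
  demands : σ.idx 2 = I.input.idx 2
  weight : σ.wt 0 = I.input.wt 0

namespace Env

variable {I : Instance} {σ τ : Mem}

theorem input (I : Instance) : Env I I.input := ⟨by simp [Instance.input], rfl, rfl, rfl⟩

theorem frame (h : Env I σ) {P : Prog} (hf : Frame P σ τ)
    (hP : (!P.modI 0 && !P.modI 1 && !P.modI 2 && !P.modW 0) = true) : Env I τ := by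
  simp only [Bool.and_eq_true, Bool.not_eq_true'] at hP
  obtain ⟨⟨⟨h0, h1⟩, h2⟩, h3⟩ := hP
  exact ⟨by rw [hf.1 0 h0, h.size], by rw [hf.1 1 h1, h.edges], by rw [hf.1 2 h2, h.demands],
    by rw [hf.2 0 h3, h.weight]⟩

theorem edge_pos (h : Env I σ) (u v : ℕ) : 1 ≤ σ.idx 1 u v ↔ (u, v) ∈ I.edges := by
  rw [h.edges]
  by_cases hm : (u, v) ∈ I.edges <;> simp [Instance.input, hm]

theorem demand_pos (h : Env I σ) (u v : ℕ) : 1 ≤ σ.idx 2 u v ↔ (u, v) ∈ I.demands := by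
  rw [h.demands]
  by_cases hm : (u, v) ∈ I.demands <;> simp [Instance.input, hm]

theorem weight_eq (h : Env I σ) {e : ℕ × ℕ} (he : e ∈ I.edges) :
    σ.wt 0 e.1 e.2 = I.weight e := by
  rw [h.weight]
  simp [Instance.input, he]

end Env

/-- The vertex labels that are stored in table `5`. -/
def lab (σ : Mem) (x : ℕ) : ℕ := σ.idx 5 x 0

theorem lab_setIdx_of_ne (σ : Mem) {a : ℕ} (i j x : ℕ) (h : 5 ≠ a) :
    lab (σ.setIdx a i j x) = lab σ := by
  funext y
  simp [lab, h]

/-- Give different labels to all vertices. -/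
def initLabels : Prog := .forLoop 13 0 (.setIdx 5 (.var 13) (.const 0) (.var 13))

/-- Identify the labels of the vertices in variables `a` and `b`. -/
def mergeLabels (a b : ℕ) : Prog :=
  .seq (.setVar 15 (.cell 5 (.var a) (.const 0)))
    (.seq (.setVar 16 (.cell 5 (.var b) (.const 0)))
      (.forLoop 13 0 (.cond (.ieq (.cell 5 (.var 13) (.const 0)) (.var 16))
        (.setIdx 5 (.var 13) (.const 0) (.var 15)))))

/-- Label the components of the network in table `4`. -/
def computeLabels : Prog :=
  .seq initLabels
    (.forLoop₂ 11 0 12 0 (.cond (.pos (.cell 4 (.var 11) (.var 12))) (mergeLabels 11 12)))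

/-- Equality of the labels of the vertices in variables `11` and `12`. -/
def sameLabel : Test :=
  .ieq (.cell 5 (.var 11) (.const 0)) (.cell 5 (.var 12) (.const 0))

/-- Test whether the network in table `4` connects all demands. -/
def testConnected : Prog :=
  .seq computeLabels
    (.seq (.setVar 17 (.const 1))
      (.forLoop₂ 11 0 12 0
        (.cond (.and (.pos (.cell 2 (.var 11) (.var 12))) (.not sameLabel))
          (.setVar 17 (.const 0)))))

/-- Remove edges from the network in table `4` as long as the test succeeds. -/
def prune (P : Prog) : Prog :=
  .forLoop₂ 14 0 18 0 (.cond (.pos (.cell 4 (.var 14) (.var 18)))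
    (.seq (.setIdx 4 (.var 14) (.var 18) (.const 0))
      (.seq P
        (.cond (.ile (.var 17) (.const 0)) (.setIdx 4 (.var 14) (.var 18) (.const 1))))))

/-- Output the network in table `4` with both directions of every edge. -/
def outputBoth : Prog :=
  .forLoop₂ 11 0 12 0 (.cond (.pos (.cell 4 (.var 11) (.var 12)))
    (.seq (.setIdx 3 (.var 11) (.var 12) (.const 1)) (.setIdx 3 (.var 12) (.var 11) (.const 1))))

/-! ### Correctness of component labelling, pruning and output -/

theorem initLabels_spec {I : Instance} {σ : Mem} {B : ℕ} (hσ : Env I σ) (hB : I.n ≤ B) :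
    Ensures B initLabels σ fun τ => ∀ x < I.n, lab τ x = x := by
  refine Ensures.forLoop hσ.size hB rfl (fun i τ => ∀ x < i, lab τ x = x)
    (fun i τ y h => by simpa [lab] using h) (by simp) ?_ (fun τ h => h)
  intro i τ hi _ hx h
  refine Ensures.setIdx fun x hxi => ?_
  simp only [IExp.eval, hx, lab, Mem.idx_setIdx, and_true]
  split_ifs with h1
  · exact h1.symm
  · exact h x (by omega)

/-- Both labels are saved before the loop, which overwrites that of `v`. Variable `15` is written
before `b` is read, hence the condition on `b`. -/
theorem mergeLabels_spec {I : Instance} {σ : Mem} {B a b u v : ℕ} (hσ : Env I σ) (hB : I.n ≤ B)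
    (ha : σ.idx a 0 0 = u) (hb : σ.idx b 0 0 = v) (hab : (b != 15) = true) :
    Ensures B (mergeLabels a b) σ fun τ => ∀ x < I.n,
      lab τ x = if lab σ x = lab σ v then lab σ u else lab σ x := by
  have hb15 : b ≠ 15 := by simpa using hab
  refine Ensures.seq' (Ensures.setIdx (Ensures.seq' (Ensures.setIdx ?_)))
  simp only [IExp.eval, ha]
  set σ' := (σ.setIdx 15 0 0 (σ.idx 5 u 0)) with hσ'
  have e1 : σ'.idx b 0 0 = v := by rw [hσ', Mem.idx_setIdx_of_ne _ _ _ _ hb15, hb]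
  have e2 : σ'.idx 5 v 0 = lab σ v := by simp [hσ', lab]
  rw [e1, e2]
  refine Ensures.forLoop (N := I.n) (by simp [hσ', hσ.size]) hB rfl
    (fun i τ => (∀ x < i, lab τ x = if lab σ x = lab σ v then lab σ u else lab σ x) ∧
      (∀ x, i ≤ x → lab τ x = lab σ x))
    (fun i τ y h => by simpa [lab] using h) (by simp [lab, hσ']) ?_ (fun τ h => h.1)
  intro i τ hi hf hx ⟨h1, h2⟩
  have h15 : τ.idx 15 0 0 = lab σ u := by
    rw [hf.1 15 rfl]; simp [hσ', lab]
  have h16 : τ.idx 16 0 0 = lab σ v := by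
    rw [hf.1 16 rfl]; simp [hσ']
  refine Ensures.ite (fun h => Ensures.setIdx ?_) (fun h => Ensures.skip ?_)
  · simp only [Test.Holds, IExp.eval, hx, h16] at h
    have h3 : lab τ i = lab σ v := le_antisymm h.1 h.2
    rw [h2 i le_rfl] at h3
    refine ⟨fun x hxi => ?_, fun x hxi => ?_⟩
    · simp only [IExp.eval, hx, h15, lab, Mem.idx_setIdx, and_true]
      by_cases h4 : x = i
      · rw [if_pos h4]
        exact (if_pos (h4 ▸ h3)).symm
      · rw [if_neg h4]
        exact h1 x (by omega)
    · simp only [IExp.eval, hx, h15, lab, Mem.idx_setIdx, and_true]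
      rw [if_neg (by omega)]
      exact h2 x (by omega)
  · simp only [Test.Holds, IExp.eval, hx, h16] at h
    refine ⟨fun x hxi => ?_, fun x hxi => h2 x (by omega)⟩
    rcases Nat.lt_succ_iff_lt_or_eq.1 hxi with h3 | rfl
    · exact h1 x h3
    · rw [h2 x le_rfl, if_neg]
      intro h4
      rw [← h2 x le_rfl] at h4
      exact h ⟨h4.le, h4.ge⟩

theorem computeLabels_spec {I : Instance} {σ : Mem} {B : ℕ} (hσ : Env I σ) (hB : I.n ≤ B) :
    Ensures B computeLabels σ fun τ => Labels I.n (lab τ) (netOf I.n (σ.idx 4)) := by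
  refine Ensures.seq (initLabels_spec hσ hB) fun τ hf h => ?_
  have hτ := hσ.frame hf rfl
  refine Ensures.forLoop₂ hτ.size hτ.size hB hB rfl
    (fun S τ => Labels I.n (lab τ) ↑(netOf I.n (σ.idx 4) ∩ S))
    (fun S τ y h => by rwa [lab_setIdx_of_ne _ _ _ _ (by decide)])
    (fun S τ y h => by rwa [lab_setIdx_of_ne _ _ _ _ (by decide)])
    (by simpa using labels_id I.n h) ?_ ?_
  · intro u v S τ' hu hv hS huv hf' hxu hyv hI
    have h4 : τ'.idx 4 = σ.idx 4 := by rw [hf'.1 4 rfl, hf.1 4 rfl]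
    refine Ensures.ite (fun hc => ?_) (fun hc => Ensures.skip ?_)
    · simp only [Test.Holds, IExp.eval, hxu, hyv, h4] at hc
      refine (mergeLabels_spec (hτ.frame hf' rfl) hB hxu hyv rfl).mono fun ρ _ hρ => ?_
      rw [Finset.inter_insert_of_mem (mem_netOf.2 ⟨hu, hv, by omega⟩), Finset.coe_insert]
      exact hI.merge hu hv hρ
    · simp only [Test.Holds, IExp.eval, hxu, hyv, h4] at hc
      rw [Finset.inter_insert_of_notMem (fun h => by have := mem_netOf.1 h; omega)]
      exact hI
  · intro τ' h
    rwa [netOf_inter] at h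

theorem testConnected_spec {I : Instance} {σ : Mem} {B : ℕ} (hσ : Env I σ) (hB : I.n ≤ B) :
    Ensures B testConnected σ fun τ => τ.idx 17 0 0 ≠ 0 ↔
      ∀ d ∈ I.demands, Conn (netOf I.n (σ.idx 4) : Set (ℕ × ℕ)) d.1 d.2 := by
  refine Ensures.seq (computeLabels_spec hσ hB) fun τ hf h => ?_
  have hτ := hσ.frame hf rfl
  refine Ensures.seq' (Ensures.setIdx ?_)
  simp only [IExp.eval]
  refine Ensures.forLoop₂ (N := I.n) (M := I.n) (by simp [hτ.size]) (by simp [hτ.size]) hB hB rfl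
    (fun S τ => τ.idx 17 0 0 ≠ 0 ↔ ∀ d ∈ I.demands ∩ S,
      Conn (netOf I.n (σ.idx 4) : Set (ℕ × ℕ)) d.1 d.2)
    (fun S τ y h => by simpa using h) (fun S τ y h => by simpa using h)
    (by simp) ?_ ?_
  · intro u v S τ' hu hv hS huv hf' hxu hyv hI
    have h5 : τ'.idx 5 = τ.idx 5 := by rw [hf'.1 5 rfl]; simp
    have h2 : τ'.idx 2 = τ.idx 2 := by rw [hf'.1 2 rfl]; simp
    have hc2 : τ.idx 5 u 0 = τ.idx 5 v 0 ↔ _ := h u hu v hv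
    refine Ensures.ite (fun hc => Ensures.setIdx ?_) (fun hc => Ensures.skip ?_)
    · simp only [Test.Holds, sameLabel, IExp.eval, hxu, hyv, h5, h2, hτ.demand_pos,
        ← le_antisymm_iff, hc2] at hc
      simp only [IExp.eval, Mem.idx_setIdx, and_self, if_true, ne_eq, not_true, false_iff]
      intro hall
      exact hc.2 (hall (u, v) (Finset.mem_inter.2 ⟨hc.1, Finset.mem_insert_self _ _⟩))
    · simp only [Test.Holds, sameLabel, IExp.eval, hxu, hyv, h5, h2, hτ.demand_pos,
        ← le_antisymm_iff, hc2] at hc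
      rw [hI]
      by_cases hd : (u, v) ∈ I.demands
      · rw [Finset.inter_insert_of_mem hd, Finset.forall_mem_insert]
        exact ⟨fun h => ⟨by tauto, h⟩, fun h => h.2⟩
      · rw [Finset.inter_insert_of_notMem hd]
  · intro τ' h
    have hsub : I.demands ∩ (Finset.range I.n ×ˢ Finset.range I.n) = I.demands :=
      Finset.inter_eq_left.2 fun d hd => by
        have := I.demands_lt d hd
        simp [this.1, this.2]
    rwa [hsub] at h

theorem netOf_zero {n : ℕ} {G G' : ℕ → ℕ → ℕ} {u v : ℕ}
    (h : ∀ x y, G' x y = if x = u ∧ y = v then 0 else G x y) :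
    netOf n G' = (netOf n G).erase (u, v) := by
  ext ⟨x, y⟩
  simp only [mem_netOf, Finset.mem_erase, h, ne_eq, Prod.mk.injEq]
  split_ifs with hxy <;> simp [hxy]

theorem netOf_one {n : ℕ} {G G' : ℕ → ℕ → ℕ} {u v : ℕ} (hu : u < n) (hv : v < n)
    (h : ∀ x y, G' x y = if x = u ∧ y = v then 1 else G x y) :
    netOf n G' = insert (u, v) (netOf n G) := by
  ext ⟨x, y⟩
  simp only [mem_netOf, Finset.mem_insert, h, Prod.mk.injEq]
  split_ifs with hxy <;> simp [hxy, hu, hv]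

/-- One pass suffices: as `φ` is monotone, an edge that is needed when it is examined is needed in
every smaller network too. `E` stands for the parts of the memory on which the test relies, so that
both algorithms can share the procedure. -/
theorem prune_spec {I : Instance} {σ : Mem} {B : ℕ} {P : Prog} {E : Mem → Prop}
    {φ : Finset (ℕ × ℕ) → Prop}
    (hP : (!P.modI 0 && !P.modI 4 && !P.modI 14 && !P.modI 18) = true)
    (hB : I.n ≤ B) (hn : σ.idx 0 0 0 = I.n) (hσ : E σ)
    (hE : ∀ τ τ', Frame (prune P) τ τ' → E τ → E τ')
    (hmono : ∀ X Y, φ X → X ⊆ Y → φ Y)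
    (htest : ∀ τ, 0 < I.n → netOf I.n (τ.idx 4) ⊆ netOf I.n (σ.idx 4) → E τ →
      Ensures B P τ fun τ' => τ'.idx 17 0 0 ≠ 0 ↔ φ (netOf I.n (τ.idx 4))) :
    Ensures B (prune P) σ fun τ => netOf I.n (τ.idx 4) ⊆ netOf I.n (σ.idx 4) ∧
      (φ (netOf I.n (σ.idx 4)) → Irredundant φ (netOf I.n (τ.idx 4))) := by
  simp only [Bool.and_eq_true, Bool.not_eq_true'] at hP
  obtain ⟨⟨⟨hP0, hP4⟩, hP14⟩, hP18⟩ := hP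
  have hmI : ∀ a, a ≠ 4 → P.modI a = false → a ≠ 14 → a ≠ 18 → (prune P).modI a = false := by
    intro a h1 h2 h3 h4
    simp [prune, Prog.forLoop₂, Prog.forLoop, Prog.modI, h2, h1.symm, h3.symm, h4.symm]
  refine Ensures.forLoop₂ hn hn hB hB (by simp [Prog.modI, hP0, hP14, hP18])
    (fun S τ => netOf I.n (τ.idx 4) ⊆ netOf I.n (σ.idx 4) ∧
      (φ (netOf I.n (σ.idx 4)) → φ (netOf I.n (τ.idx 4)) ∧
        ∀ e ∈ netOf I.n (τ.idx 4), e ∈ S → ¬ φ ((netOf I.n (τ.idx 4)).erase e)))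
    (fun S τ y h => by simpa using h) (fun S τ y h => by simpa using h)
    ⟨subset_rfl, fun h => ⟨h, by simp⟩⟩ ?_ ?_
  · intro u v S τ hu hv hS huv hf hxu hyv ⟨h1, hI⟩
    refine Ensures.ite (fun hc => ?_) (fun hc => Ensures.skip ?_)
    · simp only [Test.Holds, IExp.eval, hxu, hyv] at hc
      have hmem : (u, v) ∈ netOf I.n (τ.idx 4) := mem_netOf.2 ⟨hu, hv, by omega⟩
      refine Ensures.seq' (Ensures.setIdx ?_)
      simp only [IExp.eval, hxu, hyv]
      set τ₁ := τ.setIdx 4 u v 0 with hτ₁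
      have hnet : netOf I.n (τ₁.idx 4) = (netOf I.n (τ.idx 4)).erase (u, v) :=
        netOf_zero fun x y => by simp [hτ₁]
      have hEτ₁ : E τ₁ := by
        refine hE τ τ₁ ⟨fun a ha => ?_, fun a _ => rfl⟩ (hE _ _ hf hσ)
        refine Mem.idx_setIdx_of_ne _ _ _ _ ?_
        rintro rfl
        simp [prune, Prog.forLoop₂, Prog.forLoop, Prog.modI] at ha
      -- The test may assume `0 < I.n`, because the body runs only for an existing pair of vertices.
      refine Ensures.seq (htest τ₁ (by omega)
        (hnet ▸ (Finset.erase_subset _ _).trans h1) hEτ₁) fun τ₂ hf₂ h17 => ?_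
      have h4 : τ₂.idx 4 = τ₁.idx 4 := hf₂.1 4 hP4
      have hu2 : τ₂.idx 14 0 0 = u := by rw [hf₂.1 14 hP14]; simp [hτ₁, hxu]
      have hv2 : τ₂.idx 18 0 0 = v := by rw [hf₂.1 18 hP18]; simp [hτ₁, hyv]
      rw [hnet] at h17
      refine Ensures.ite (fun hc' => Ensures.setIdx ?_) (fun hc' => Ensures.skip ?_)
      · simp only [Test.Holds, IExp.eval, Nat.le_zero] at hc'
        simp only [IExp.eval, hu2, hv2]
        have hnet' : netOf I.n ((τ₂.setIdx 4 u v 1).idx 4) = netOf I.n (τ.idx 4) := by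
          rw [netOf_one (G := τ₁.idx 4) hu hv fun x y => by simp [h4], hnet,
            Finset.insert_erase hmem]
        rw [hnet']
        refine ⟨h1, fun h0 => ?_⟩
        obtain ⟨h2, h3⟩ := hI h0
        refine ⟨h2, fun e he heS => ?_⟩
        rcases Finset.mem_insert.1 heS with rfl | heS
        · exact fun h => (h17.2 h) hc'
        · exact h3 e he heS
      · simp only [Test.Holds, IExp.eval, Nat.le_zero] at hc'
        rw [h4, hnet]
        refine ⟨(Finset.erase_subset _ _).trans h1, fun h0 => ?_⟩
        obtain ⟨h2, h3⟩ := hI h0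
        refine ⟨h17.1 hc', fun e he heS h => ?_⟩
        obtain ⟨hne, he⟩ := Finset.mem_erase.1 he
        -- If the earlier edge could be removed now, it could have been removed from the larger
        -- network as well.
        exact h3 e he (Finset.mem_of_mem_insert_of_ne heS hne)
          (hmono _ _ h (Finset.erase_subset_erase _ (Finset.erase_subset _ _)))
    · simp only [Test.Holds, IExp.eval, hxu, hyv] at hc
      refine ⟨h1, fun h0 => ?_⟩
      obtain ⟨h2, h3⟩ := hI h0
      refine ⟨h2, fun e he heS => ?_⟩
      rcases Finset.mem_insert.1 heS with rfl | heS
      · exact absurd (mem_netOf.1 he).2.2 (by omega)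
      · exact h3 e he heS
  · rintro τ ⟨h1, h⟩
    refine ⟨h1, fun h0 => ?_⟩
    obtain ⟨h2, h3⟩ := h h0
    exact ⟨h2, fun e he => h3 e he (Finset.filter_subset _ _ he)⟩

theorem outputBoth_spec {I : Instance} {σ : Mem} {B : ℕ} (hσ : Env I σ) (hB : I.n ≤ B)
    (h3 : ∀ u v, σ.idx 3 u v = 0) :
    Ensures B outputBoth σ fun τ => I.output τ =
      netOf I.n (σ.idx 4) ∪ (netOf I.n (σ.idx 4)).image Prod.swap := by
  refine Ensures.forLoop₂ hσ.size hσ.size hB hB rfl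
    (fun S τ => netOf I.n (τ.idx 3) =
      (netOf I.n (σ.idx 4) ∩ S) ∪ (netOf I.n (σ.idx 4) ∩ S).image Prod.swap)
    (fun S τ y h => by simpa using h) (fun S τ y h => by simpa using h)
    (by simp [netOf, h3]) ?_ ?_
  · intro u v S τ hu hv hS huv hf hxu hyv hI
    have h4 : τ.idx 4 = σ.idx 4 := hf.1 4 rfl
    refine Ensures.ite (fun hc => ?_) (fun hc => Ensures.skip ?_)
    · simp only [Test.Holds, IExp.eval, hxu, hyv, h4] at hc
      refine Ensures.seq' (Ensures.setIdx (Ensures.setIdx ?_))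
      simp only [IExp.eval, hxu, hyv, Mem.idx_setIdx_of_ne, ne_eq, Nat.reduceEqDiff,
        not_false_eq_true]
      rw [netOf_one (G := (τ.setIdx 3 u v 1).idx 3) hv hu fun x y => by simp,
        netOf_one (G := τ.idx 3) hu hv fun x y => by simp, hI,
        Finset.inter_insert_of_mem (mem_netOf.2 ⟨hu, hv, by omega⟩), Finset.image_insert]
      ext e
      simp only [Finset.mem_insert, Finset.mem_union, Prod.swap_prod_mk]
      tauto
    · simp only [Test.Holds, IExp.eval, hxu, hyv, h4] at hc
      rw [hI, Finset.inter_insert_of_notMem (fun h => by have := mem_netOf.1 h; omega)]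
  · intro τ h
    rwa [netOf_inter] at h

/-! ## The local ratio algorithm -/

/-- The current weights, which are stored in table `1` of the weights. -/
noncomputable def curWeight (σ : Mem) (e : ℕ × ℕ) : ℝ := σ.wt 1 e.1 e.2

theorem curWeight_setIdx (σ : Mem) (a i j x : ℕ) :
    curWeight (σ.setIdx a i j x) = curWeight σ := rfl

/-- Mark the labels of the active classes in table `6`. -/
def markActive : Prog :=
  .seq (.forLoop 13 0 (.setIdx 6 (.var 13) (.const 0) (.const 0)))
    (.forLoop₂ 11 0 12 0
      (.cond (.and (.pos (.cell 2 (.var 11) (.var 12))) (.not sameLabel))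
        (.seq (.setIdx 6 (.cell 5 (.var 11) (.const 0)) (.const 0) (.const 1))
          (.setIdx 6 (.cell 5 (.var 12) (.const 0)) (.const 0) (.const 1)))))

/-- The activity of the class of the vertex in variable `a`. -/
abbrev activity (a : ℕ) : IExp := .cell 6 (.cell 5 (.var a) (.const 0)) (.const 0)

/-- Find an edge whose weight is the smallest multiple of the number of active classes that it
leaves. -/
def findEdge : Prog :=
  .seq (.setVar 7 (.const 0))
    (.forLoop₂ 11 0 12 0
      (.cond (.and (.pos (.cell 1 (.var 11) (.var 12)))
          (.and (.not sameLabel) (.pos (.add (activity 11) (activity 12)))))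
        (.seq
          (.ite (.ile (.const 2) (.add (activity 11) (activity 12)))
            (.setWt 3 (.const 0) (.const 0) (.half (.cell 1 (.var 11) (.var 12))))
            (.setWt 3 (.const 0) (.const 0) (.cell 1 (.var 11) (.var 12))))
          (.cond (.not (.and (.pos (.var 7)) (.wle (.var 2) (.var 3))))
            (.seq (.setWt 2 (.const 0) (.const 0) (.var 3))
              (.seq (.setVar 8 (.var 11)) (.seq (.setVar 9 (.var 12))
                (.setVar 7 (.const 1)))))))))

/-- Subtract the multiple of the number of active classes that each edge leaves. -/
def reduceWeights : Prog :=
  .forLoop₂ 11 0 12 0 (.cond (.not sameLabel)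
    (.seq
      (.cond (.pos (activity 11))
        (.setWt 1 (.var 11) (.var 12) (.sub (.cell 1 (.var 11) (.var 12)) (.var 2))))
      (.cond (.pos (activity 12))
        (.setWt 1 (.var 11) (.var 12) (.sub (.cell 1 (.var 11) (.var 12)) (.var 2))))))

/-- One step of the local ratio algorithm. -/
def localRatioStep : Prog :=
  .seq markActive (.seq findEdge (.cond (.pos (.var 7))
    (.seq reduceWeights (.seq (.setIdx 4 (.var 8) (.var 9) (.const 1)) (mergeLabels 8 9)))))

/-- The local ratio algorithm, without the removal of redundant edges. -/
def localRatio : Prog :=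
  .seq initLabels
    (.seq (.forLoop₂ 11 0 12 0 (.setWt 1 (.var 11) (.var 12) (.cell 0 (.var 11) (.var 12))))
      (.forLoop 10 0 localRatioStep))

/-! ### Correctness of the local ratio algorithm -/

theorem Instance.act_le_one (I : Instance) (L : ℕ → ℕ) (a : ℕ) : I.act L a ≤ 1 := by
  unfold Instance.act; split_ifs <;> simp

theorem markActive_spec {I : Instance} {σ : Mem} {B : ℕ} (hσ : Env I σ) (hB : I.n ≤ B) :
    Ensures B markActive σ fun τ => ∀ a < I.n, τ.idx 6 a 0 = I.act (lab σ) a := by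
  classical
  refine Ensures.seq (Q := fun τ => ∀ a < I.n, τ.idx 6 a 0 = 0) ?_ fun τ hf h => ?_
  · refine Ensures.forLoop hσ.size hB rfl (fun i τ => ∀ a < i, τ.idx 6 a 0 = 0)
      (fun i τ y h => by simpa using h) (by simp) ?_ (fun τ h => h)
    intro i τ hi _ hx h
    refine Ensures.setIdx fun a hai => ?_
    simp only [IExp.eval, hx, Mem.idx_setIdx, and_true]
    split_ifs with h1
    · rfl
    · exact h a (by omega)
  have hτ := hσ.frame hf rfl
  have h5 : τ.idx 5 = σ.idx 5 := hf.1 5 rfl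
  refine Ensures.forLoop₂ hτ.size hτ.size hB hB rfl
    (fun S τ' => ∀ a < I.n, τ'.idx 6 a 0 =
      if ∃ d ∈ I.demands ∩ S, ¬(lab σ d.1 = a ↔ lab σ d.2 = a) then 1 else 0)
    (fun S τ y h => by simpa using h) (fun S τ y h => by simpa using h)
    (by simpa using h) ?_ ?_
  · intro u v S τ' hu hv hS huv hf' hxu hyv hI
    have h5' : τ'.idx 5 = σ.idx 5 := by rw [hf'.1 5 rfl, h5]
    have h2 : τ'.idx 2 = τ.idx 2 := hf'.1 2 rfl
    refine Ensures.ite (fun hc => ?_) (fun hc => Ensures.skip ?_)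
    · simp only [Test.Holds, sameLabel, IExp.eval, hxu, hyv, h5', h2, hτ.demand_pos,
        ← le_antisymm_iff] at hc
      refine Ensures.seq' (Ensures.setIdx (Ensures.setIdx fun a ha => ?_))
      simp only [IExp.eval, hxu, hyv, Mem.idx_setIdx_of_ne, ne_eq, Nat.reduceEqDiff,
        not_false_eq_true, Mem.idx_setIdx, and_true, h5', hI a ha]
      rw [Finset.inter_insert_of_mem hc.1]
      simp only [Finset.exists_mem_insert, lab]
      have := hc.2
      by_cases h1 : a = σ.idx 5 u 0 <;> by_cases h2 : a = σ.idx 5 v 0 <;>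
        simp [h1, h2, eq_comm] <;> grind
    · intro a ha
      simp only [Test.Holds, sameLabel, IExp.eval, hxu, hyv, h5', h2, hτ.demand_pos,
        ← le_antisymm_iff] at hc
      rw [hI a ha]
      by_cases hd : (u, v) ∈ I.demands
      · rw [Finset.inter_insert_of_mem hd]
        have huv' : lab σ u = lab σ v := by by_contra hne; exact hc ⟨hd, hne⟩
        simp [huv']
      · rw [Finset.inter_insert_of_notMem hd]
  · intro τ' h' a ha
    have hsub : I.demands ∩ (Finset.range I.n ×ˢ Finset.range I.n) = I.demands :=
      Finset.inter_eq_left.2 fun d hd => by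
        have := I.demands_lt d hd
        simp [this.1, this.2]
    rw [h' a ha, hsub]
    simp only [Instance.act, Instance.Active]
    congr

/-- An edge with the smallest weight per active class that it leaves has been found. -/
structure MinEdge (I : Instance) (L : ℕ → ℕ) (c : ℕ × ℕ → ℝ) (S : Finset (ℕ × ℕ)) (u v : ℕ)
    (ε : ℝ) : Prop where
  mem : (u, v) ∈ I.edges
  ne : L u ≠ L v
  eq : ε * I.leaves L (u, v) = c (u, v)
  nonneg : 0 ≤ ε
  le : ∀ e ∈ I.edges, e ∈ S → ε * I.leaves L e ≤ c e

/-- The edge minimizes `c e / leaves e` among edges with `leaves e ≠ 0`, and the minimum is the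
largest admissible `ε`. Variable `7` records whether there is such an edge. `hlt` keeps all lookups
of activities in the initialized part of table `6`. -/
theorem findEdge_spec {I : Instance} {σ : Mem} {B : ℕ} (hσ : Env I σ) (hB : I.n ≤ B)
    (hlt : ∀ x < I.n, lab σ x < I.n) (hact : ∀ a < I.n, σ.idx 6 a 0 = I.act (lab σ) a)
    (hc : ∀ e ∈ I.edges, 0 ≤ curWeight σ e) :
    Ensures B findEdge σ fun τ =>
      (τ.idx 7 0 0 = 0 → ∀ e ∈ I.edges, I.leaves (lab σ) e = 0) ∧
      (τ.idx 7 0 0 ≠ 0 → MinEdge I (lab σ) (curWeight σ) I.edges (τ.idx 8 0 0) (τ.idx 9 0 0)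
        (τ.wt 2 0 0)) := by
  refine Ensures.seq' (Ensures.setIdx ?_)
  simp only [IExp.eval]
  refine Ensures.forLoop₂ (N := I.n) (M := I.n) (by simp [hσ.size]) (by simp [hσ.size]) hB hB rfl
    (fun S τ => (τ.idx 7 0 0 = 0 → ∀ e ∈ I.edges, e ∈ S → I.leaves (lab σ) e = 0) ∧
      (τ.idx 7 0 0 ≠ 0 → MinEdge I (lab σ) (curWeight σ) S (τ.idx 8 0 0) (τ.idx 9 0 0)
        (τ.wt 2 0 0)))
    (fun S τ y h => by simpa using h) (fun S τ y h => by simpa using h) (by simp) ?_ ?_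
  · intro u v S τ hu hv hS huv hf hxu hyv ⟨hI1, hI2⟩
    have h5 : τ.idx 5 = σ.idx 5 := by rw [hf.1 5 rfl]; simp
    have h6 : τ.idx 6 = σ.idx 6 := by rw [hf.1 6 rfl]; simp
    have h1 : τ.idx 1 = σ.idx 1 := by rw [hf.1 1 rfl]; simp
    have hw1 : τ.wt 1 u v = curWeight σ (u, v) := by rw [hf.2 1 rfl]; rfl
    have hau : σ.idx 6 (σ.idx 5 u 0) 0 = I.act (lab σ) (lab σ u) := hact _ (hlt u hu)
    have hav : σ.idx 6 (σ.idx 5 v 0) 0 = I.act (lab σ) (lab σ v) := hact _ (hlt v hv)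
    refine Ensures.ite (fun hcd => ?_) (fun hcd => Ensures.skip ?_)
    · simp only [Test.Holds, sameLabel, IExp.eval, hxu, hyv, h5, h6, h1, hσ.edge_pos,
        ← le_antisymm_iff, hau, hav] at hcd
      obtain ⟨hE, hne, hpos⟩ := hcd
      have hlv : I.leaves (lab σ) (u, v) = I.act (lab σ) (lab σ u) + I.act (lab σ) (lab σ v) := by
        unfold Instance.leaves; exact if_neg hne
      -- Weight variable `3` receives the quotient of weight and `leaves`. Since `leaves` is 1 or 2
      -- here, halving is the only division needed.
      refine Ensures.seq (Q := fun τ' => τ'.idx = τ.idx ∧ τ'.wt 2 = τ.wt 2 ∧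
        τ'.wt 3 0 0 * I.leaves (lab σ) (u, v) = curWeight σ (u, v)) ?_ ?_
      · refine Ensures.ite (fun h2 => Ensures.setWt ?_) (fun h2 => Ensures.setWt ?_)
        · simp only [Test.Holds, IExp.eval, hxu, hyv, h5, h6, hau, hav] at h2
          have := I.act_le_one (lab σ) (lab σ u)
          have := I.act_le_one (lab σ) (lab σ v)
          have hl2 : I.leaves (lab σ) (u, v) = 2 := by omega
          refine ⟨by simp, by simp, ?_⟩
          simp [WExp.eval, IExp.eval, hxu, hyv, hw1, hl2]
        · simp only [Test.Holds, IExp.eval, hxu, hyv, h5, h6, hau, hav] at h2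
          have hl1 : I.leaves (lab σ) (u, v) = 1 := by omega
          refine ⟨by simp, by simp, ?_⟩
          simp [WExp.eval, IExp.eval, hxu, hyv, hw1, hl1]
      rintro τ' - ⟨hi, hw2, hw3⟩
      have hlpos : (0 : ℝ) < I.leaves (lab σ) (u, v) := by
        rw [hlv]; exact_mod_cast hpos
      have hw30 : 0 ≤ τ'.wt 3 0 0 := by
        have := hc _ hE
        rw [← hw3] at this
        exact nonneg_of_mul_nonneg_left this hlpos
      refine Ensures.ite (fun h2 => ?_) (fun h2 => Ensures.skip ?_)
      · simp only [Test.Holds, IExp.eval, WExp.eval, hi, hw2] at h2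
        refine Ensures.seq' (Ensures.setWt (Ensures.seq' (Ensures.setIdx
          (Ensures.seq' (Ensures.setIdx (Ensures.setIdx ?_))))))
        simp only [IExp.eval, WExp.eval, hi, hxu, hyv, Mem.idx_setIdx_of_ne, ne_eq,
          Nat.reduceEqDiff, not_false_eq_true, Mem.idx_setIdx, and_self, if_true,
          Mem.idx_setWt, Mem.wt_setIdx, Mem.wt_setWt, one_ne_zero, false_imp_iff, true_and,
          true_imp_iff]
        refine ⟨hE, hne, hw3, hw30, fun e he heS => ?_⟩
        rcases Finset.mem_insert.1 heS with rfl | heS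
        · exact hw3.le
        -- Before the first candidate all visited edges have `leaves = 0`, so any `ε` satisfies
        -- their bound.
        · by_cases h7 : τ.idx 7 0 0 = 0
          · rw [hI1 h7 e he heS]
            simpa using hc e he
          · have hle : τ'.wt 3 0 0 ≤ τ.wt 2 0 0 := by
              by_contra! hlt'
              exact h2 ⟨Nat.one_le_iff_ne_zero.2 h7, hlt'.le⟩
            exact (mul_le_mul_of_nonneg_right hle (Nat.cast_nonneg _)).trans
              ((hI2 h7).le e he heS)
      · simp only [Test.Holds, IExp.eval, WExp.eval, hi, hw2, not_not] at h2
        rw [hi, hw2]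
        refine ⟨fun h => by omega, fun h7 => ?_⟩
        obtain ⟨g1, g2, g3, g4, g5⟩ := hI2 h7
        refine ⟨g1, g2, g3, g4, fun e he heS => ?_⟩
        rcases Finset.mem_insert.1 heS with rfl | heS
        · rw [← hw3]
          exact mul_le_mul_of_nonneg_right h2.2 (Nat.cast_nonneg _)
        · exact g5 e he heS
    · simp only [Test.Holds, sameLabel, IExp.eval, hxu, hyv, h5, h6, h1, hσ.edge_pos,
        ← le_antisymm_iff, hau, hav] at hcd
      have hl0 : (u, v) ∈ I.edges → I.leaves (lab σ) (u, v) = 0 := by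
        intro hE
        unfold Instance.leaves
        split_ifs with hne
        · rfl
        · by_contra h
          exact hcd ⟨hE, hne, Nat.one_le_iff_ne_zero.2 h⟩
      refine ⟨fun h7 e he heS => ?_, fun h7 => ?_⟩
      · rcases Finset.mem_insert.1 heS with rfl | heS
        · exact hl0 he
        · exact hI1 h7 e he heS
      · obtain ⟨g1, g2, g3, g4, g5⟩ := hI2 h7
        refine ⟨g1, g2, g3, g4, fun e he heS => ?_⟩
        rcases Finset.mem_insert.1 heS with rfl | heS
        · rw [hl0 he]
          simpa using hc _ he
        · exact g5 e he heS
  · rintro τ ⟨h1, h2⟩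
    have hsub : ∀ e ∈ I.edges, e ∈ Finset.range I.n ×ˢ Finset.range I.n := fun e he => by
      have := I.edges_lt e he
      simp [this.1, this.2]
    refine ⟨fun h7 e he => h1 h7 e he (hsub e he), fun h7 => ?_⟩
    obtain ⟨g1, g2, g3, g4, g5⟩ := h2 h7
    exact ⟨g1, g2, g3, g4, fun e he _ => g5 e he (hsub e he)⟩

/-- One subtraction per active end class adds up to `ε * leaves`. The loop also changes weights of
non-edges, which play no role. -/
theorem reduceWeights_spec {I : Instance} {σ : Mem} {B : ℕ} (hσ : Env I σ) (hB : I.n ≤ B)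
    (hlt : ∀ x < I.n, lab σ x < I.n) (hact : ∀ a < I.n, σ.idx 6 a 0 = I.act (lab σ) a) :
    Ensures B reduceWeights σ fun τ => ∀ e ∈ I.edges,
      curWeight τ e = curWeight σ e - σ.wt 2 0 0 * I.leaves (lab σ) e := by
  classical
  refine Ensures.forLoop₂ hσ.size hσ.size hB hB rfl
    (fun S τ => ∀ e, curWeight τ e =
      if e ∈ S then curWeight σ e - σ.wt 2 0 0 * I.leaves (lab σ) e else curWeight σ e)
    (fun S τ y h => by simpa [curWeight_setIdx] using h)
    (fun S τ y h => by simpa [curWeight_setIdx] using h)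
    (by simp) ?_ ?_
  · intro u v S τ hu hv hS huv hf hxu hyv hI
    have h5 : τ.idx 5 = σ.idx 5 := hf.1 5 rfl
    have h6 : τ.idx 6 = σ.idx 6 := hf.1 6 rfl
    have hw2 : τ.wt 2 = σ.wt 2 := hf.2 2 rfl
    have hau : σ.idx 6 (σ.idx 5 u 0) 0 = I.act (lab σ) (lab σ u) := hact _ (hlt u hu)
    have hav : σ.idx 6 (σ.idx 5 v 0) 0 = I.act (lab σ) (lab σ v) := hact _ (hlt v hv)
    have hw1 : τ.wt 1 u v = curWeight σ (u, v) := by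
      have := hI (u, v)
      rw [if_neg huv] at this
      exact this
    refine Ensures.ite (fun hcd => ?_) (fun hcd => Ensures.skip ?_)
    · simp only [Test.Holds, sameLabel, IExp.eval, hxu, hyv, h5, ← le_antisymm_iff] at hcd
      have hlv : I.leaves (lab σ) (u, v) = I.act (lab σ) (lab σ u) + I.act (lab σ) (lab σ v) := by
        unfold Instance.leaves; exact if_neg hcd
      have a1 := I.act_le_one (lab σ) (lab σ u)
      have a2 := I.act_le_one (lab σ) (lab σ v)
      refine Ensures.seq (Q := fun τ' => τ'.idx = τ.idx ∧ τ'.wt 2 = τ.wt 2 ∧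
        ∀ x y, τ'.wt 1 x y = if (x, y) = (u, v) then
          curWeight σ (u, v) - σ.wt 2 0 0 * I.act (lab σ) (lab σ u) else τ.wt 1 x y) ?_ ?_
      · refine Ensures.ite (fun h2 => Ensures.setWt ?_) (fun h2 => Ensures.skip ?_)
        · simp only [Test.Holds, IExp.eval, hxu, h5, h6, hau] at h2
          have : I.act (lab σ) (lab σ u) = 1 := by omega
          refine ⟨by simp, by simp, fun x y => ?_⟩
          simp [WExp.eval, IExp.eval, hxu, hyv, hw1, hw2, this]
        · simp only [Test.Holds, IExp.eval, hxu, h5, h6, hau] at h2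
          have : I.act (lab σ) (lab σ u) = 0 := by omega
          refine ⟨rfl, rfl, fun x y => ?_⟩
          rw [this]
          split_ifs with hxy
          · obtain ⟨rfl, rfl⟩ := Prod.mk.inj hxy
            simp [hw1]
          · rfl
      rintro τ' - ⟨hi, hw2', hw1'⟩
      have hgoal : ∀ ρ : Mem, (∀ x y, ρ.wt 1 x y = if (x, y) = (u, v) then
          curWeight σ (u, v) - σ.wt 2 0 0 * I.leaves (lab σ) (u, v) else τ.wt 1 x y) →
          ∀ e, curWeight ρ e = if e ∈ insert (u, v) S then
            curWeight σ e - σ.wt 2 0 0 * I.leaves (lab σ) e else curWeight σ e := by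
        rintro ρ hρ ⟨x, y⟩
        have := hI (x, y)
        simp only [curWeight] at this hρ ⊢
        rw [hρ]
        by_cases hxy : (x, y) = (u, v)
        · rw [if_pos hxy, if_pos (hxy ▸ Finset.mem_insert_self _ _)]
          obtain ⟨rfl, rfl⟩ := Prod.mk.inj hxy
          rfl
        · rw [if_neg hxy, this]
          simp [Finset.mem_insert, hxy]
      refine Ensures.ite (fun h2 => Ensures.setWt ?_) (fun h2 => Ensures.skip ?_)
      · simp only [Test.Holds, IExp.eval, hi, hyv, h5, h6, hav] at h2
        have : I.act (lab σ) (lab σ v) = 1 := by omega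
        refine hgoal _ fun x y => ?_
        simp only [IExp.eval, WExp.eval, hi, hxu, hyv, Mem.wt_setWt, hw1', hlv, this, hw2', hw2,
          if_true, Prod.mk.injEq]
        split_ifs
        · push_cast; ring
        · rfl
      · simp only [Test.Holds, IExp.eval, hi, hyv, h5, h6, hav] at h2
        have : I.act (lab σ) (lab σ v) = 0 := by omega
        refine hgoal _ fun x y => ?_
        rw [hw1', hlv, this, add_zero]
    · simp only [Test.Holds, sameLabel, IExp.eval, hxu, hyv, h5, ← le_antisymm_iff,
        not_not] at hcd
      have hl0 : I.leaves (lab σ) (u, v) = 0 := by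
        unfold Instance.leaves; exact if_pos hcd
      intro e
      rw [hI e]
      by_cases he : e = (u, v)
      · subst he
        simp [huv, hl0]
      · simp [Finset.mem_insert, he]
  · intro τ h e he
    rw [h e, if_pos]
    have := I.edges_lt e he
    simp [this.1, this.2]

/-- The label `L v` disappears and no new one is created; this is the progress measure of the main
loop. -/
theorem card_image_merge_lt {n u v : ℕ} {L L' : ℕ → ℕ} (hu : u < n) (hv : v < n)
    (hne : L u ≠ L v) (hL' : ∀ x < n, L' x = if L x = L v then L u else L x) :
    ((Finset.range n).image L').card < ((Finset.range n).image L).card := by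
  refine Finset.card_lt_card (Finset.ssubset_iff_subset_ne.2 ⟨?_, fun h => ?_⟩)
  · intro a ha
    obtain ⟨x, hx, rfl⟩ := Finset.mem_image.1 ha
    rw [hL' x (Finset.mem_range.1 hx)]
    split_ifs
    · exact Finset.mem_image_of_mem _ (Finset.mem_range.2 hu)
    · exact Finset.mem_image_of_mem _ hx
  · have : L v ∈ (Finset.range n).image L := Finset.mem_image_of_mem _ (Finset.mem_range.2 hv)
    rw [← h] at this
    obtain ⟨x, hx, hxv⟩ := Finset.mem_image.1 this
    rw [hL' x (Finset.mem_range.1 hx)] at hxv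
    split_ifs at hxv with h1
    · exact hne hxv
    · exact h1 hxv

/-- The invariant of the main loop after `i` rounds. -/
structure LocalRatioState (I : Instance) (i : ℕ) (σ : Mem) : Prop where
  lt : ∀ x < I.n, lab σ x < I.n
  inv : I.LocalRatio (lab σ) (curWeight σ) (netOf I.n (σ.idx 4))
  progress : (∃ M, I.Connects M) → (∀ d ∈ I.demands, lab σ d.1 = lab σ d.2) ∨
    ((Finset.range I.n).image (lab σ)).card + i ≤ I.n

theorem LocalRatioState.congr {I : Instance} {i : ℕ} {σ τ : Mem} (h : LocalRatioState I i σ)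
    (h5 : τ.idx 5 = σ.idx 5) (h4 : τ.idx 4 = σ.idx 4) (h1 : τ.wt 1 = σ.wt 1) :
    LocalRatioState I i τ := by
  have e1 : lab τ = lab σ := by funext x; simp [lab, h5]
  have e2 : curWeight τ = curWeight σ := by funext e; simp [curWeight, h1]
  refine ⟨by rw [e1]; exact h.lt, by rw [e1, e2, h4]; exact h.inv, by rw [e1]; exact h.progress⟩

/-- Either two classes are merged and a label disappears, or no edge leaves an active class; in the
latter case a solvable instance has no active class left. Solvability enters only the claim about
progress, since the program must halt on unsolvable inputs too. -/
theorem localRatioStep_spec {I : Instance} {σ : Mem} {B i : ℕ} (hσ : Env I σ) (hB : I.n ≤ B)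
    (h : LocalRatioState I i σ) :
    Ensures B localRatioStep σ (LocalRatioState I (i + 1)) := by
  refine Ensures.seq (markActive_spec hσ hB) fun τ hf hact => ?_
  have hτ := hσ.frame hf rfl
  have hlab : lab σ = lab τ := by funext x; simp [lab, hf.1 5 rfl]
  have hs := h.congr (hf.1 5 rfl) (hf.1 4 rfl) (hf.2 1 rfl)
  rw [hlab] at hact
  refine Ensures.seq (findEdge_spec hτ hB hs.lt hact hs.inv.nonneg) fun ρ hf' hm => ?_
  have hρ := hτ.frame hf' rfl
  have hlab' : lab τ = lab ρ := by funext x; simp [lab, hf'.1 5 rfl]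
  have hcw : curWeight τ = curWeight ρ := by funext e; simp [curWeight, hf'.2 1 rfl]
  have hr := hs.congr (hf'.1 5 rfl) (hf'.1 4 rfl) (hf'.2 1 rfl)
  have hact' : ∀ a < I.n, ρ.idx 6 a 0 = I.act (lab ρ) a := by
    rw [hf'.1 6 rfl, ← hlab']; exact hact
  rw [hlab', hcw] at hm
  refine Ensures.ite (fun h7 => ?_) (fun h7 => Ensures.skip ?_)
  · simp only [Test.Holds, IExp.eval] at h7
    have hmin := hm.2 (by omega)
    refine Ensures.seq (reduceWeights_spec hρ hB hr.lt hact') fun π hf'' hw => ?_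
    have hπ := hρ.frame hf'' rfl
    refine Ensures.seq' (Ensures.setIdx ?_)
    have h8 : π.idx 8 = ρ.idx 8 := hf''.1 8 rfl
    have h9 : π.idx 9 = ρ.idx 9 := hf''.1 9 rfl
    simp only [IExp.eval, h8, h9]
    set u := ρ.idx 8 0 0 with hu
    set v := ρ.idx 9 0 0 with hv
    have hlt := I.edges_lt _ hmin.mem
    simp only at hlt
    have hπ' : Env I (π.setIdx 4 u v 1) :=
      ⟨by simp [hπ.size], by simp [hπ.edges], by simp [hπ.demands], hπ.weight⟩
    refine (mergeLabels_spec (u := u) (v := v) hπ' hB (by simp [h8, hu]) (by simp [h9, hv])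
      rfl).mono fun κ hf₃ hL => ?_
    have hlabπ : lab (π.setIdx 4 u v 1) = lab ρ := by
      funext x; simp [lab, hf''.1 5 rfl]
    rw [hlabπ] at hL
    have h4 : netOf I.n (κ.idx 4) = insert (u, v) (netOf I.n (ρ.idx 4)) := by
      rw [hf₃.1 4 rfl]
      exact netOf_one hlt.1 hlt.2 fun x y => by simp [hf''.1 4 rfl]
    have hcκ : curWeight κ = curWeight π := by
      funext e; simp [curWeight, hf₃.2 1 rfl]
    refine ⟨fun x hx => ?_, ?_, fun hM => ?_⟩
    · rw [hL x hx]
      split_ifs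
      · exact hr.lt u hlt.1
      · exact hr.lt x hx
    · rw [h4]
      exact hr.inv.step hmin.mem hmin.ne hmin.nonneg (fun e he => hmin.le e he he) hmin.eq hL
        (fun e he => by rw [hcκ]; exact hw e he)
    · rcases hr.progress hM with h1 | h1
      · left
        intro d hd
        have := I.demands_lt d hd
        rw [hL _ this.1, hL _ this.2, h1 d hd]
      · right
        have := card_image_merge_lt hlt.1 hlt.2 hmin.ne hL
        omega
  · simp only [Test.Holds, IExp.eval] at h7
    refine ⟨hr.lt, hr.inv, fun ⟨M, hM⟩ => Or.inl fun d hd => ?_⟩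
    by_contra hne
    -- A solution leaves every active class, but here no edge leaves any.
    have h1 := hM.card_activeLabels_le (lab ρ)
    rw [Finset.sum_eq_zero fun e he => hm.1 (by omega) e (hM.1 he), Nat.le_zero,
      Finset.card_eq_zero] at h1
    have h2 : lab ρ d.1 ∈ I.activeLabels (lab ρ) :=
      Instance.mem_activeLabels.2 ⟨d, hd, fun h => hne (h.1 rfl).symm⟩
    rw [h1] at h2
    simp at h2

theorem localRatio_spec {I : Instance} {σ : Mem} {B : ℕ} (hσ : Env I σ) (hB : I.n ≤ B)
    (h4 : ∀ u v, σ.idx 4 u v = 0) :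
    Ensures B localRatio σ fun τ => (∃ M, I.Connects M) →
      I.Connects (netOf I.n (τ.idx 4)) ∧ ∀ X, Irredundant I.Connects X →
        X ⊆ netOf I.n (τ.idx 4) → ∀ N, I.Connects N → I.cost X ≤ 2 * I.cost N := by
  classical
  refine Ensures.seq (initLabels_spec hσ hB) fun τ hf hL => ?_
  have hτ := hσ.frame hf rfl
  refine Ensures.seq (Q := fun τ' => ∀ e ∈ I.edges, curWeight τ' e = I.weight e) ?_
    fun ρ hf' hc => ?_
  · refine Ensures.forLoop₂ hτ.size hτ.size hB hB rfl
      (fun S τ' => ∀ e ∈ I.edges, e ∈ S → curWeight τ' e = I.weight e)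
      (fun S τ y h => by simpa [curWeight_setIdx] using h)
      (fun S τ y h => by simpa [curWeight_setIdx] using h) (by simp) ?_ ?_
    · intro u v S τ' hu hv hS huv hf' hxu hyv hI
      refine Ensures.setWt fun e he heS => ?_
      have hw := (hτ.frame hf' rfl).weight_eq he
      simp only [curWeight, IExp.eval, WExp.eval, hxu, hyv, Mem.wt_setWt]
      split_ifs with h1
      · rw [← h1.1, ← h1.2, hw]
      · refine hI e he ((Finset.mem_insert.1 heS).resolve_left ?_)
        rintro rfl
        exact h1 ⟨rfl, rfl⟩
    · intro τ' h e he
      have := I.edges_lt e he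
      exact h e he (by simp [this.1, this.2])
  have hρ := hτ.frame hf' rfl
  have hLρ : ∀ x < I.n, lab ρ x = x := fun x hx => by
    simpa [lab, hf'.1 5 rfl] using hL x hx
  refine Ensures.forLoop hρ.size hB rfl (LocalRatioState I)
    (fun i τ y h => h.congr (by simp) (by simp) rfl) ?_ ?_ ?_
  · have hnet : netOf I.n (ρ.idx 4) = ∅ := by
      rw [hf'.1 4 rfl, hf.1 4 rfl]; simp [netOf, h4]
    refine ⟨fun x hx => by rw [hLρ x hx]; exact hx, ?_, fun _ => Or.inr ?_⟩
    · rw [hnet]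
      exact .init hLρ hc
    · simpa using Finset.card_image_le (s := Finset.range I.n) (f := lab ρ)
  · intro i κ _ hfκ _ h
    exact localRatioStep_spec (hρ.frame hfκ rfl) hB h
  · intro κ h hM
    have hdem : ∀ d ∈ I.demands, lab κ d.1 = lab κ d.2 := by
      -- After `n` rounds the second alternative would leave no label at all, although the end
      -- points of a demand carry labels.
      rcases h.progress hM with h1 | h1
      · exact h1
      · intro d hd
        have hd := (I.demands_lt d hd).1
        have : 0 < ((Finset.range I.n).image (lab κ)).card :=
          Finset.card_pos.2 ⟨_, Finset.mem_image_of_mem _ (Finset.mem_range.2 hd)⟩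
        omega
    exact ⟨h.inv.connects hdem, fun X hX hXF N hN => h.inv.cost_le hX hXF hN⟩

/-- The approximation algorithm with ratio `4`. -/
def fourApprox : Prog := .seq localRatio (.seq (prune testConnected) outputBoth)

/-- One factor 2 is lost by local ratio and another one by taking both directions of every edge. -/
theorem fourApprox_spec {I : Instance} (hI : I.Bidirected) :
    Ensures I.n fourApprox I.input fun τ => (∃ M, I.Feasible M) → I.IsApprox 4 (I.output τ) := by
  have h0 : Env I I.input := .input I
  refine Ensures.seq (localRatio_spec h0 le_rfl fun u v => by simp [Instance.input])
    fun σ hf hσ => ?_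
  have hEσ := h0.frame hf rfl
  refine Ensures.seq (prune_spec (E := Env I)
    (φ := fun X => ∀ d ∈ I.demands, Conn (X : Set (ℕ × ℕ)) d.1 d.2) rfl le_rfl hEσ.size hEσ
    (fun τ τ' hf h => h.frame hf rfl)
    (fun X Y hX hXY d hd => (hX d hd).mono (Finset.coe_subset.2 hXY))
    (fun τ _ _ hτ => testConnected_spec hτ le_rfl)) fun τ hf' hτ => ?_
  have hEτ := hEσ.frame hf' rfl
  refine (outputBoth_spec hEτ le_rfl fun u v => ?_).mono ?_
  · rw [hf'.1 3 rfl, hf.1 3 rfl]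
    simp [Instance.input]
  · rintro ρ - hρ ⟨M, hM⟩
    obtain ⟨h1, h2⟩ := hσ ⟨M, .of_feasible hM⟩
    obtain ⟨h4, h5⟩ := hτ.2 h1.2
    have h3 := hτ.1
    -- The pruned property omits containment in the edge set, which is inherited from the unpruned
    -- network.
    have hX : Irredundant I.Connects (netOf I.n (τ.idx 4)) :=
      ⟨⟨h3.trans h1.1, h4⟩, fun e he h => h5 e he h.2⟩
    rw [hρ, show (4 : ℝ) = 2 * 2 by norm_num]
    exact Instance.isApprox_of_connects hI hX.1 (h2 _ hX h3)

theorem exists_fourApprox : ∃ (P : Prog) (p : Polynomial ℕ),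
    ApproximatesInTime P 4 (fun n _ => ((p.eval n : ℕ) : ℝ)) := by
  obtain ⟨c, d, h⟩ := fourApprox.timeBound_le_poly
  refine ⟨fourApprox, Polynomial.C c * (Polynomial.X + 1) ^ d, fun I hI => ?_⟩
  obtain ⟨t, τ, hr, ht, hτ⟩ := fourApprox_spec hI
  refine ⟨t, τ, hr, ?_, hτ⟩
  have := ht.trans (h I.n)
  simp only [Polynomial.eval_mul, Polynomial.eval_C, Polynomial.eval_pow, Polynomial.eval_add,
    Polynomial.eval_X, Polynomial.eval_one]
  exact_mod_cast this

/-! ## Optimum solutions by dynamic programming over sets of terminals -/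

/-- A list of `m` terminals `loc j` with partners `par j`, and `K` sets of terminals, described by
the rows of a 0-1 matrix. -/
structure TerminalData where
  m : ℕ
  K : ℕ
  loc : ℕ → ℕ
  par : ℕ → ℕ
  mask : ℕ → ℕ → ℕ

namespace TerminalData

/-- The terminals are the end points of the nontrivial demands, and all sets occur. -/
structure Valid (T : TerminalData) (I : Instance) : Prop where
  par_lt : ∀ j < T.m, T.par j < T.m
  par_par : ∀ j < T.m, T.par (T.par j) = j
  ne : ∀ j < T.m, T.loc j ≠ T.loc (T.par j)
  sound : ∀ j < T.m, (T.loc j, T.loc (T.par j)) ∈ I.demands ∨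
    (T.loc (T.par j), T.loc j) ∈ I.demands
  complete : ∀ d ∈ I.demands, d.1 ≠ d.2 → ∃ j < T.m, T.loc j = d.1 ∧ T.loc (T.par j) = d.2
  mask_le : ∀ A < T.K, ∀ j < T.m, T.mask A j ≤ 1
  exists_mask : ∀ p : ℕ → Prop, ∃ A < T.K, ∀ j < T.m, T.mask A j = 1 ↔ p j
  pos : 0 < T.K
  full : ∀ j < T.m, T.mask (T.K - 1) j = 1

variable (T : TerminalData)

/-- `N` connects the pairs of terminals in the set `A`, and the terminals in `A` whose partner is
not in `A` are connected to `v`. -/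
def Realizes (A v : ℕ) (N : Finset (ℕ × ℕ)) : Prop :=
  ∀ j < T.m, T.mask A j = 1 →
    (T.mask A (T.par j) = 1 → Conn (N : Set (ℕ × ℕ)) (T.loc j) (T.loc (T.par j))) ∧
    (T.mask A (T.par j) ≠ 1 → Conn (N : Set (ℕ × ℕ)) (T.loc j) v)

/-- All terminals in `A` are located at `v`. -/
def AllAt (A v : ℕ) : Prop := ∀ j < T.m, T.mask A j = 1 → T.loc j = v

/-- `A` contains the partners of its terminals. -/
def Closed (A : ℕ) : Prop := ∀ j < T.m, T.mask A j = T.mask A (T.par j)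

/-- `A` is the disjoint union of `B` and `C`. -/
def Splits (A B C : ℕ) : Prop := ∀ j < T.m, T.mask B j + T.mask C j = T.mask A j

variable {T} {I : Instance} {A B C u v : ℕ} {N M : Finset (ℕ × ℕ)}

/-! ### Soundness of the dynamic programming rules -/

theorem Realizes.mono (h : T.Realizes A v N) (hNM : N ⊆ M) : T.Realizes A v M :=
  fun j hj hA => ⟨fun hp => ((h j hj hA).1 hp).mono (Finset.coe_subset.2 hNM),
    fun hp => ((h j hj hA).2 hp).mono (Finset.coe_subset.2 hNM)⟩

/-- Partners lie at different vertices, so `A` contains no complete pair, and every terminal of `A`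
already is at `v`. -/
theorem AllAt.realizes (h : T.AllAt A v) (hT : T.Valid I) : T.Realizes A v ∅ := by
  intro j hj hA
  have h1 := h j hj hA
  refine ⟨fun hp => ?_, fun _ => h1 ▸ Conn.refl _ _⟩
  have h2 := h _ (hT.par_lt j hj) hp
  exact absurd (h1.trans h2.symm) (hT.ne j hj)

theorem Realizes.move (h : T.Realizes A u N) (huv : Conn (N : Set (ℕ × ℕ)) u v) :
    T.Realizes A v N :=
  fun j hj hA => ⟨(h j hj hA).1, fun hp => ((h j hj hA).2 hp).trans huv⟩

/-- When no terminal waits for its partner, the vertex of the state is irrelevant. This is what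
admits networks with several components. -/
theorem Realizes.jump (h : T.Realizes A u N) (hA : T.Closed A) : T.Realizes A v N :=
  fun j hj hjA => ⟨(h j hj hjA).1, fun hp => absurd ((hA j hj).symm.trans hjA) hp⟩

/-- A pair divided between `B` and `C` has both terminals connected to `v`, one in each network, so
the union connects it. -/
theorem Realizes.union (hT : T.Valid I) (hA : A < T.K)
    (hs : T.Splits A B C) (h : T.Realizes B v N) (h' : T.Realizes C v M) :
    T.Realizes A v (N ∪ M) := by
  have hN := h.mono (Finset.subset_union_left (s₂ := M))
  have hM := h'.mono (Finset.subset_union_right (s₁ := N))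
  intro j hj hjA
  have hj' := hT.par_lt j hj
  have e1 := hs j hj
  have e2 := hs _ hj'
  have e3 := hT.mask_le A hA _ hj'
  have hpp := hT.par_par j hj
  -- The two sides play symmetric roles: `D` is the one that contains `j`.
  have key : ∀ {D E : ℕ}, T.Realizes D v (N ∪ M) → T.Realizes E v (N ∪ M) →
      T.mask D j = 1 → T.mask E j = 0 →
      T.mask D (T.par j) + T.mask E (T.par j) = T.mask A (T.par j) →
      (T.mask A (T.par j) = 1 →
        Conn ((N ∪ M : Finset (ℕ × ℕ)) : Set (ℕ × ℕ)) (T.loc j) (T.loc (T.par j))) ∧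
      (T.mask A (T.par j) ≠ 1 →
        Conn ((N ∪ M : Finset (ℕ × ℕ)) : Set (ℕ × ℕ)) (T.loc j) v) := by
    intro D E hD hE hDj hEj hsum
    refine ⟨fun hp => ?_, fun hp => (hD j hj hDj).2 (by omega)⟩
    by_cases hDp : T.mask D (T.par j) = 1
    · exact (hD j hj hDj).1 hDp
    · have h1 := (hD j hj hDj).2 hDp
      have h2 := (hE _ hj' (by omega)).2 (by rw [hpp, hEj]; simp)
      exact h1.trans h2.symm
  have e4 := hT.mask_le A hA j hj
  rcases Nat.eq_zero_or_pos (T.mask B j) with h0 | h0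
  · exact key hM hN (by omega) h0 (by omega)
  · exact key hN hM (by omega) (by omega) e2

/-- The values that the dynamic programming rules yield in `r` rounds. -/
inductive Derivable (T : TerminalData) (I : Instance) (G : Finset (ℕ × ℕ)) :
    ℕ → ℕ → ℕ → ℝ → Prop where
  | base {r A v : ℕ} : A < T.K → v < I.n → T.AllAt A v → Derivable T I G (r + 1) A v 0
  | edge {r A u v : ℕ} {x : ℝ} : (u, v) ∈ G → Derivable T I G r A u x →
      Derivable T I G (r + 1) A v (x + I.weight (u, v))
  | revEdge {r A u v : ℕ} {x : ℝ} : (v, u) ∈ G → Derivable T I G r A u x →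
      Derivable T I G (r + 1) A v (x + I.weight (v, u))
  | jump {r A u v : ℕ} {x : ℝ} : v < I.n → T.Closed A → Derivable T I G r A u x →
      Derivable T I G (r + 1) A v x
  | union {r A B C v : ℕ} {x y : ℝ} : A < T.K → T.Splits A B C → Derivable T I G r B v x →
      Derivable T I G r C v y → Derivable T I G (r + 1) A v (x + y)
  | keep {r A v : ℕ} {x : ℝ} : Derivable T I G r A v x → Derivable T I G (r + 1) A v x

/-! ### Completeness of the dynamic programming rules -/

theorem Derivable.mono {G : Finset (ℕ × ℕ)} {r s : ℕ} {x : ℝ} (h : Derivable T I G r A v x)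
    (hrs : r ≤ s) : Derivable T I G s A v x := by
  induction hrs with
  | refl => exact h
  | step _ ih => exact ih.keep

theorem Derivable.lt {G : Finset (ℕ × ℕ)} (hG : G ⊆ I.edges) {r : ℕ} {x : ℝ}
    (h : Derivable T I G r A v x) : A < T.K ∧ v < I.n := by
  induction h with
  | base hA hv _ => exact ⟨hA, hv⟩
  | edge he _ ih => exact ⟨ih.1, (I.edges_lt _ (hG he)).2⟩
  | revEdge he _ ih => exact ⟨ih.1, (I.edges_lt _ (hG he)).1⟩
  | jump hv _ _ ih => exact ⟨ih.1, hv⟩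
  | union hA _ _ _ ih _ => exact ⟨hA, ih.2⟩
  | keep _ ih => exact ih

/-- Every set of terminals splits into the terminals with and without a given property. -/
theorem Valid.exists_split (hT : T.Valid I) (hA : A < T.K) (p : ℕ → Prop) :
    ∃ B < T.K, ∃ C < T.K, T.Splits A B C ∧
      (∀ j < T.m, T.mask B j = 1 ↔ T.mask A j = 1 ∧ p j) ∧
      (∀ j < T.m, T.mask C j = 1 ↔ T.mask A j = 1 ∧ ¬ p j) := by
  obtain ⟨B, hB, hB'⟩ := hT.exists_mask fun j => T.mask A j = 1 ∧ p j
  obtain ⟨C, hC, hC'⟩ := hT.exists_mask fun j => T.mask A j = 1 ∧ ¬ p j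
  refine ⟨B, hB, C, hC, fun j hj => ?_, hB', hC'⟩
  have h1 := hT.mask_le A hA j hj
  have h2 := hT.mask_le B hB j hj
  have h3 := hT.mask_le C hC j hj
  have h4 := hB' j hj
  have h5 := hC' j hj
  by_cases hp : p j <;> simp only [hp, and_true, not_true, and_false, iff_false, not_false_eq_true]
    at h4 h5 <;> omega

/-- Remove the edge `e` at `v`. If its ends stay connected, it is superfluous. Otherwise the
terminals still connected to `v` form a state at `v`, and all others form a state at `u`, which is
moved along `e` and then united with the first. The move and the union account for the two extra
rounds. -/
theorem derivable_of_incident (hT : T.Valid I) {G : Finset (ℕ × ℕ)} (hG : G ⊆ I.edges) {c : ℕ}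
    (ih : ∀ N ⊆ G, N.card ≤ c → ∀ A < T.K, ∀ v < I.n, T.Realizes A v N →
      ∃ x ≤ I.cost N, Derivable T I G (4 * c + 1) A v x)
    {N : Finset (ℕ × ℕ)} (hN : N ⊆ G) (hcard : N.card = c + 1) {A u v : ℕ} (hA : A < T.K)
    (hu : u < I.n) (hv : v < I.n) {e : ℕ × ℕ} (he : e ∈ N) (heuv : e = (u, v) ∨ e = (v, u))
    (h : T.Realizes A v N) : ∃ x ≤ I.cost N, Derivable T I G (4 * c + 3) A v x := by
  classical
  set N' := N.erase e with hN'
  have hN'c : N'.card = c := by rw [Finset.card_erase_of_mem he]; omega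
  have hN'N : N' ⊆ N := Finset.erase_subset _ _
  have hcost : I.cost N = I.weight e + I.cost N' := (Finset.add_sum_erase _ _ he).symm
  have hw : 0 ≤ I.weight e := I.weight_nonneg e (hG (hN he))
  have hins : ∀ x y, Conn (N : Set (ℕ × ℕ)) x y ↔ Conn (N' : Set (ℕ × ℕ)) x y ∨
      (Conn (N' : Set (ℕ × ℕ)) x u ∧ Conn (N' : Set (ℕ × ℕ)) v y) ∨
      (Conn (N' : Set (ℕ × ℕ)) x v ∧ Conn (N' : Set (ℕ × ℕ)) u y) := by
    intro x y
    have : (N : Set (ℕ × ℕ)) = insert e (N' : Set (ℕ × ℕ)) := by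
      rw [← Finset.coe_insert, Finset.insert_erase he]
    rw [this]
    rcases heuv with rfl | rfl
    · exact Conn.insert_iff
    · rw [Conn.insert_iff]; tauto
  by_cases huv : Conn (N' : Set (ℕ × ℕ)) v u
  · have hsame : ∀ x y, Conn (N : Set (ℕ × ℕ)) x y → Conn (N' : Set (ℕ × ℕ)) x y := by
      intro x y hxy
      rcases (hins x y).1 hxy with h | ⟨h, h'⟩ | ⟨h, h'⟩
      · exact h
      · exact (h.trans huv.symm).trans h'
      · exact (h.trans huv).trans h'
    obtain ⟨x, hx, hd⟩ := ih N' (hN'N.trans hN) hN'c.le A hA v hv fun j hj hjA =>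
      ⟨fun hp => hsame _ _ ((h j hj hjA).1 hp), fun hp => hsame _ _ ((h j hj hjA).2 hp)⟩
    exact ⟨x, by linarith, hd.mono (by omega)⟩
  -- `N₁` is the component of `v`; `N₂` retains all other components, not only that of `u`.
  · set N₁ := N'.filter fun f => Conn (N' : Set (ℕ × ℕ)) v f.1 with hN₁
    set N₂ := N'.filter fun f => ¬ Conn (N' : Set (ℕ × ℕ)) v f.1 with hN₂
    have hsplit : I.cost N' = I.cost N₁ + I.cost N₂ :=
      (Finset.sum_filter_add_sum_filter_not N' _ _).symm
    have hinv : ∀ f ∈ (N' : Set (ℕ × ℕ)),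
        Conn (N' : Set (ℕ × ℕ)) v f.1 ↔ Conn (N' : Set (ℕ × ℕ)) v f.2 := fun f hf =>
      ⟨fun h => h.trans (Conn.edge hf), fun h => h.trans (Conn.edge hf).symm⟩
    have hto₁ : ∀ x, Conn (N' : Set (ℕ × ℕ)) x v → Conn (N₁ : Set (ℕ × ℕ)) x v := fun x hx =>
      (Conn.of_mem_iff (T := (N₁ : Set (ℕ × ℕ))) hinv
        (fun f hf hp => Finset.mem_coe.2 (Finset.mem_filter.2 ⟨hf, hp⟩)) hx.symm
        (Conn.refl _ _)).symm
    have hto₂ : ∀ x y, ¬ Conn (N' : Set (ℕ × ℕ)) x v → Conn (N' : Set (ℕ × ℕ)) x y →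
        Conn (N₂ : Set (ℕ × ℕ)) x y := fun x y hx hxy =>
      Conn.of_mem_iff (p := fun z => ¬ Conn (N' : Set (ℕ × ℕ)) v z) (T := (N₂ : Set (ℕ × ℕ)))
        (fun f hf => not_congr (hinv f hf))
        (fun f hf hp => Finset.mem_coe.2 (Finset.mem_filter.2 ⟨hf, hp⟩)) hxy
        (fun h => hx h.symm)
    obtain ⟨A₁, hA₁, A₂, hA₂, hs, hm₁, hm₂⟩ :=
      hT.exists_split hA fun j => Conn (N' : Set (ℕ × ℕ)) (T.loc j) v
    have hr₁ : T.Realizes A₁ v N₁ := by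
      intro j hj hj₁
      have h1 := hto₁ _ ((hm₁ j hj).1 hj₁).2
      refine ⟨fun hp => ?_, fun _ => h1⟩
      exact h1.trans (hto₁ _ ((hm₁ _ (hT.par_lt j hj)).1 hp).2).symm
    have hr₂ : T.Realizes A₂ u N₂ := by
      intro j hj hj₂
      obtain ⟨hjA, hjv⟩ := (hm₂ j hj).1 hj₂
      refine ⟨fun hp => ?_, fun hp => ?_⟩
      · obtain ⟨hpA, hpv⟩ := (hm₂ _ (hT.par_lt j hj)).1 hp
        refine hto₂ _ _ hjv ?_
        rcases (hins _ _).1 ((h j hj hjA).1 hpA) with h | ⟨-, h⟩ | ⟨h, -⟩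
        · exact h
        · exact absurd h.symm hpv
        · exact absurd h hjv
      -- The partner is outside `A`, or it is in `A₁` and hence connected to `v`. In both cases the
      -- terminal reaches `v` in `N`, which without `e` it cannot, so it reaches `u` first.
      · have hNv : Conn (N : Set (ℕ × ℕ)) (T.loc j) v := by
          by_cases hpA : T.mask A (T.par j) = 1
          · have hpv : Conn (N' : Set (ℕ × ℕ)) (T.loc (T.par j)) v := by
              by_contra hcon
              exact hp ((hm₂ _ (hT.par_lt j hj)).2 ⟨hpA, hcon⟩)
            exact ((h j hj hjA).1 hpA).trans (hpv.mono (Finset.coe_subset.2 hN'N))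
          · exact (h j hj hjA).2 hpA
        refine hto₂ _ _ hjv ?_
        rcases (hins _ _).1 hNv with h | ⟨h, -⟩ | ⟨h, -⟩
        · exact absurd h hjv
        · exact h
        · exact absurd h hjv
    have hsub₁ : N₁ ⊆ N' := Finset.filter_subset _ _
    have hsub₂ : N₂ ⊆ N' := Finset.filter_subset _ _
    obtain ⟨x₁, hx₁, hd₁⟩ := ih N₁ ((hsub₁.trans hN'N).trans hN)
      ((Finset.card_le_card hsub₁).trans hN'c.le) A₁ hA₁ v hv hr₁
    obtain ⟨x₂, hx₂, hd₂⟩ := ih N₂ ((hsub₂.trans hN'N).trans hN)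
      ((Finset.card_le_card hsub₂).trans hN'c.le) A₂ hA₂ u hu hr₂
    have hd₃ : Derivable T I G (4 * c + 2) A₂ v (x₂ + I.weight e) := by
      rcases heuv with rfl | rfl
      · exact hd₂.edge (hN he)
      · exact hd₂.revEdge (hN he)
    exact ⟨x₁ + (x₂ + I.weight e), by linarith, .union hA hs hd₁.keep hd₃⟩

/-- The base rule takes one round. Each edge takes at most four more: the move along it, the union
of the two sides, and a jump and a further union if `v` is isolated. -/
theorem derivable_of_realizes (hT : T.Valid I) {G : Finset (ℕ × ℕ)} (hG : G ⊆ I.edges) (c : ℕ) :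
    ∀ N ⊆ G, N.card ≤ c → ∀ A < T.K, ∀ v < I.n, T.Realizes A v N →
      ∃ x ≤ I.cost N, Derivable T I G (4 * c + 1) A v x := by
  induction c with
  | zero =>
    intro N _ hc A hA v hv h
    obtain rfl : N = ∅ := Finset.card_eq_zero.1 (Nat.le_zero.1 hc)
    have heq : ∀ x y, Conn ((∅ : Finset (ℕ × ℕ)) : Set (ℕ × ℕ)) x y → x = y := fun x y hxy =>
      (hxy.invariant (p := fun z => x = z) (by simp)).1 rfl
    refine ⟨0, by simp [Instance.cost], .base hA hv fun j hj hjA => heq _ _ ((h j hj hjA).2 ?_)⟩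
    exact fun hp => hT.ne j hj (heq _ _ ((h j hj hjA).1 hp))
  | succ c ih =>
    intro N hN hc A hA v hv h
    rcases Nat.lt_or_ge N.card (c + 1) with hlt | hge
    · obtain ⟨x, hx, hd⟩ := ih N hN (by omega) A hA v hv h
      exact ⟨x, hx, hd.mono (by omega)⟩
    have hcard : N.card = c + 1 := le_antisymm hc hge
    by_cases hinc : ∃ e ∈ N, e.1 = v ∨ e.2 = v
    · obtain ⟨⟨a, b⟩, he, rfl | rfl⟩ := hinc
      · obtain ⟨x, hx, hd⟩ := derivable_of_incident hT hG ih hN hcard hA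
          (I.edges_lt _ (hG (hN he))).2 hv he (Or.inr rfl) h
        exact ⟨x, hx, hd.mono (by omega)⟩
      · obtain ⟨x, hx, hd⟩ := derivable_of_incident hT hG ih hN hcard hA
          (I.edges_lt _ (hG (hN he))).1 hv he (Or.inl rfl) h
        exact ⟨x, hx, hd.mono (by omega)⟩
    -- Now `v` is isolated, so the terminals elsewhere form complete pairs. Their state can be
    -- derived at an end point `a` of any edge of `N` and then jump to `v`.
    · push Not at hinc
      have hiso : ∀ x, Conn (N : Set (ℕ × ℕ)) x v → x = v := fun x hx =>
        (hx.invariant (p := fun z => z = v) fun e he =>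
          iff_of_false (hinc e he).1 (hinc e he).2).2 rfl
      obtain ⟨⟨a, b⟩, he⟩ : N.Nonempty := Finset.card_pos.1 (by omega)
      obtain ⟨ha, hb⟩ := I.edges_lt _ (hG (hN he))
      obtain ⟨A₁, hA₁, A₂, hA₂, hs, hm₁, hm₂⟩ := hT.exists_split hA fun j => T.loc j = v
      have hpar : ∀ j < T.m, T.mask A₂ j = 1 → T.mask A₂ (T.par j) = 1 := by
        intro j hj hj₂
        obtain ⟨hjA, hjv⟩ := (hm₂ j hj).1 hj₂
        have hpA : T.mask A (T.par j) = 1 := by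
          by_contra hp
          exact hjv (hiso _ ((h j hj hjA).2 hp))
        refine (hm₂ _ (hT.par_lt j hj)).2 ⟨hpA, fun hpv => hjv (hiso _ ?_)⟩
        have := (h j hj hjA).1 hpA
        rwa [hpv] at this
      have hcl : T.Closed A₂ := by
        intro j hj
        have h1 := hpar j hj
        have h2 := hpar _ (hT.par_lt j hj)
        rw [hT.par_par j hj] at h2
        have h3 := hT.mask_le A₂ hA₂ j hj
        have h4 := hT.mask_le A₂ hA₂ _ (hT.par_lt j hj)
        omega
      have hr₂ : T.Realizes A₂ a N := fun j hj hj₂ =>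
        ⟨fun hp => (h j hj ((hm₂ j hj).1 hj₂).1).1 ((hm₂ _ (hT.par_lt j hj)).1 hp).1,
          fun hp => absurd (hpar j hj hj₂) hp⟩
      obtain ⟨x, hx, hd⟩ := derivable_of_incident hT hG ih hN hcard hA₂ hb ha he (Or.inr rfl) hr₂
      refine ⟨0 + x, by linarith, ?_⟩
      have hd₁ : Derivable T I G (4 * c + 3 + 1) A₁ v 0 :=
        .base hA₁ hv fun j hj hj₁ => ((hm₁ j hj).1 hj₁).2
      exact .union hA hs hd₁ (.jump hv hcl hd)

theorem Valid.realizes_full_iff (hT : T.Valid I) :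
    T.Realizes (T.K - 1) v N ↔ ∀ d ∈ I.demands, Conn (N : Set (ℕ × ℕ)) d.1 d.2 := by
  constructor
  · intro h d hd
    by_cases hne : d.1 = d.2
    · rw [hne]; exact Conn.refl _ _
    · obtain ⟨j, hj, h1, h2⟩ := hT.complete d hd hne
      rw [← h1, ← h2]
      exact (h j hj (hT.full j hj)).1 (hT.full _ (hT.par_lt j hj))
  · intro h j hj _
    refine ⟨fun _ => ?_, fun hp => absurd (hT.full _ (hT.par_lt j hj)) hp⟩
    rcases hT.sound j hj with hd | hd
    · exact h _ hd
    · exact (h _ hd).symm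

end TerminalData

/-! ### The program for the dynamic programming rules -/

/-- The terminal data that is stored in tables `20` to `24`. -/
def dataOf (σ : Mem) : TerminalData where
  m := σ.idx 20 0 0
  K := σ.idx 23 0 0
  loc j := σ.idx 21 j 0
  par j := σ.idx 22 j 0
  mask := σ.idx 24

/-- The parts of the memory that hold the input, the terminal data and the network. -/
structure Static (I : Instance) (T : TerminalData) (G : Finset (ℕ × ℕ)) (σ : Mem) : Prop where
  env : Env I σ
  data : dataOf σ = T
  net : netOf I.n (σ.idx 4) = G

namespace Static

variable {I : Instance} {T : TerminalData} {G : Finset (ℕ × ℕ)} {σ τ : Mem}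

theorem _root_.BiDSN.dataOf_frame {P : Prog} (hf : Frame P σ τ)
    (hP : (!P.modI 20 && !P.modI 21 && !P.modI 22 && !P.modI 23 && !P.modI 24) = true) :
    dataOf τ = dataOf σ := by
  simp only [Bool.and_eq_true, Bool.not_eq_true'] at hP
  obtain ⟨⟨⟨⟨h1, h2⟩, h3⟩, h4⟩, h5⟩ := hP
  simp only [dataOf, hf.1 _ h1, hf.1 _ h2, hf.1 _ h3, hf.1 _ h4, hf.1 _ h5]

theorem frame (h : Static I T G σ) {P : Prog} (hf : Frame P σ τ)
    (hP : (!P.modI 0 && !P.modI 1 && !P.modI 2 && !P.modW 0) = true)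
    (hP' : (!P.modI 20 && !P.modI 21 && !P.modI 22 && !P.modI 23 && !P.modI 24) = true)
    (hP4 : P.modI 4 = false) : Static I T G τ :=
  ⟨h.env.frame hf hP, (dataOf_frame hf hP').trans h.data, by rw [hf.1 4 hP4, h.net]⟩

theorem m_eq (h : Static I T G σ) : σ.idx 20 0 0 = T.m := congrArg TerminalData.m h.data
theorem K_eq (h : Static I T G σ) : σ.idx 23 0 0 = T.K := congrArg TerminalData.K h.data
theorem loc_eq (h : Static I T G σ) (j : ℕ) : σ.idx 21 j 0 = T.loc j :=
  congrFun (congrArg TerminalData.loc h.data) j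
theorem par_eq (h : Static I T G σ) (j : ℕ) : σ.idx 22 j 0 = T.par j :=
  congrFun (congrArg TerminalData.par h.data) j
theorem mask_eq (h : Static I T G σ) : σ.idx 24 = T.mask := congrArg TerminalData.mask h.data

theorem net_pos (h : Static I T G σ) {u v : ℕ} (hu : u < I.n) (hv : v < I.n) :
    1 ≤ σ.idx 4 u v ↔ (u, v) ∈ G := by
  rw [← h.net, mem_netOf]
  simp [hu, hv, Nat.one_le_iff_ne_zero]

end Static

/-- The table entry for `(A, v)` is defined and at most `x`. -/
def Entry (σ : Mem) (A v : ℕ) (x : ℝ) : Prop := 1 ≤ σ.idx 25 A v ∧ σ.wt 4 A v ≤ x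

/-- All defined table entries are bounds on the cost of networks. -/
def SoundTable (I : Instance) (T : TerminalData) (G : Finset (ℕ × ℕ)) (σ : Mem) : Prop :=
  ∀ A < T.K, ∀ v < I.n, 1 ≤ σ.idx 25 A v →
    ∃ N ⊆ G, T.Realizes A v N ∧ I.cost N ≤ σ.wt 4 A v

/-- The table entries of `τ` are at least as good as those of `σ`. -/
def Improves (σ τ : Mem) : Prop := ∀ A v x, Entry σ A v x → Entry τ A v x

/-- The tables of `σ` and `τ` have the same entries. -/
def SameTable (σ τ : Mem) : Prop := τ.idx 25 = σ.idx 25 ∧ τ.wt 4 = σ.wt 4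

section tables

variable {I : Instance} {T : TerminalData} {G : Finset (ℕ × ℕ)} {σ τ ρ : Mem}

theorem Entry.le {A v : ℕ} {x y : ℝ} (h : Entry σ A v x) (hxy : x ≤ y) : Entry σ A v y :=
  ⟨h.1, h.2.trans hxy⟩

theorem Improves.refl (σ : Mem) : Improves σ σ := fun _ _ _ h => h

theorem Improves.trans (h : Improves σ τ) (h' : Improves τ ρ) : Improves σ ρ :=
  fun _ _ _ hx => h' _ _ _ (h _ _ _ hx)

theorem SameTable.entry (h : SameTable σ τ) (A v : ℕ) (x : ℝ) :
    Entry τ A v x ↔ Entry σ A v x := by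
  simp [Entry, h.1, h.2]

theorem SameTable.improves (h : SameTable σ τ) : Improves σ τ :=
  fun A v x hx => (h.entry A v x).2 hx

theorem SameTable.sound (h : SameTable σ τ) (hσ : SoundTable I T G σ) : SoundTable I T G τ := by
  unfold SoundTable
  rw [h.1, h.2]
  exact hσ

theorem SameTable.setIdx (σ : Mem) {a : ℕ} (i j x : ℕ) (ha : 25 ≠ a) :
    SameTable σ (σ.setIdx a i j x) := ⟨Mem.idx_setIdx_of_ne _ _ _ _ ha, rfl⟩

end tables

/-- Set variable `37` to `1` if the test fails for all terminals `j` in variable `35`, and to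
`0` otherwise. -/
def checkNone (t : Test) : Prog :=
  .seq (.setVar 37 (.const 1)) (.forLoop 35 20 (.cond t (.setVar 37 (.const 0))))

/-- Lower the table entry for the indices in variables `30` and `31` to the value of `e`. -/
def relax (e : WExp) : Prog :=
  .cond (.not (.and (.pos (.cell 25 (.var 30) (.var 31))) (.wle (.cell 4 (.var 30) (.var 31)) e)))
    (.seq (.setWt 4 (.var 30) (.var 31) e) (.setIdx 25 (.var 30) (.var 31) (.const 1)))

/-- Apply the rule `TerminalData.Derivable.base`. -/
def applyBase : Prog :=
  .seq (checkNone (.and (.pos (.cell 24 (.var 30) (.var 35)))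
      (.not (.ieq (.cell 21 (.var 35) (.const 0)) (.var 31)))))
    (.cond (.pos (.var 37)) (relax .zero))

/-- Apply the rules `TerminalData.Derivable.edge` and `TerminalData.Derivable.jump`. -/
def applyMoves : Prog :=
  .seq (checkNone (.not (.ieq (.cell 24 (.var 30) (.var 35))
      (.cell 24 (.var 30) (.cell 22 (.var 35) (.const 0))))))
    (.forLoop 32 0
      (.seq (.cond (.and (.pos (.var 37)) (.pos (.cell 25 (.var 30) (.var 32))))
          (relax (.cell 4 (.var 30) (.var 32))))
        (.seq (.cond (.and (.pos (.cell 4 (.var 32) (.var 31))) (.pos (.cell 25 (.var 30) (.var 32))))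
            (relax (.add (.cell 4 (.var 30) (.var 32)) (.cell 0 (.var 32) (.var 31)))))
          (.cond (.and (.pos (.cell 4 (.var 31) (.var 32))) (.pos (.cell 25 (.var 30) (.var 32))))
            (relax (.add (.cell 4 (.var 30) (.var 32)) (.cell 0 (.var 31) (.var 32))))))))

/-- Apply the rule `TerminalData.Derivable.union`. -/
def applyUnion : Prog :=
  .forLoop₂ 33 23 34 23
    (.seq (checkNone (.not (.ieq
        (.add (.cell 24 (.var 33) (.var 35)) (.cell 24 (.var 34) (.var 35)))
        (.cell 24 (.var 30) (.var 35)))))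
      (.cond (.and (.pos (.var 37))
          (.and (.pos (.cell 25 (.var 33) (.var 31))) (.pos (.cell 25 (.var 34) (.var 31)))))
        (relax (.add (.cell 4 (.var 33) (.var 31)) (.cell 4 (.var 34) (.var 31))))))

/-- Compute the optimum values for the network in table `4`. -/
def solve : Prog :=
  .seq (.forLoop₂ 30 23 31 0 (.setIdx 25 (.var 30) (.var 31) (.const 0)))
    (.forLoop 36 26 (.forLoop₂ 30 23 31 0 (.seq applyBase (.seq applyMoves applyUnion))))

/-! ### Correctness of the dynamic program -/

theorem checkNone_spec {t : Test} {σ : Mem} {B m : ℕ} {φ : ℕ → Prop}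
    (hm : σ.idx 20 0 0 = m) (hB : m ≤ B)
    (ht : ∀ j < m, ∀ τ, Frame (checkNone t) σ τ → τ.idx 35 0 0 = j → (t.Holds τ ↔ ¬ φ j)) :
    Ensures B (checkNone t) σ fun τ => 1 ≤ τ.idx 37 0 0 ↔ ∀ j < m, φ j := by
  refine Ensures.seq' (Ensures.setIdx ?_)
  simp only [IExp.eval]
  refine Ensures.forLoop (N := m) (by simp [hm]) hB rfl
    (fun i τ => 1 ≤ τ.idx 37 0 0 ↔ ∀ j < i, φ j) (fun i τ y h => by simpa using h) (by simp) ?_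
    (fun τ h => h)
  intro j τ hj hf hxj hI
  have hf' : Frame (checkNone t) σ τ := by
    refine ⟨fun a ha => ?_, fun a ha => hf.2 a ha⟩
    have h1 : a ≠ 37 ∧ a ≠ 35 := by
      refine ⟨?_, ?_⟩ <;> rintro rfl <;> simp [checkNone, Prog.forLoop, Prog.modI] at ha
    rw [hf.1 a (by simp [Prog.forLoop, Prog.modI, h1.1.symm, h1.2.symm]),
      Mem.idx_setIdx_of_ne _ _ _ _ h1.1]
  refine Ensures.ite (fun hc => Ensures.setIdx ?_) (fun hc => Ensures.skip ?_)
  · rw [ht j hj τ hf' hxj] at hc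
    simp only [IExp.eval, Mem.idx_setIdx, and_self, if_true]
    exact iff_of_false (by omega) fun h => hc (h j (by omega))
  · rw [ht j hj τ hf' hxj, not_not] at hc
    rw [hI, Nat.forall_lt_succ_right]
    exact ⟨fun h => ⟨h, hc⟩, fun h => h.1⟩

section rules

variable {I : Instance} {T : TerminalData} {G : Finset (ℕ × ℕ)} {σ : Mem} {B A v : ℕ}

/-- An entry is overwritten only if it is undefined or gets smaller, so the table improves; the
network in `hN` justifies the new value. -/
theorem relax_spec {e : WExp} (hA : σ.idx 30 0 0 = A) (hv : σ.idx 31 0 0 = v)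
    (hσ : SoundTable I T G σ)
    (hN : ∃ N ⊆ G, T.Realizes A v N ∧ I.cost N ≤ e.eval σ) :
    Ensures B (relax e) σ fun τ =>
      SoundTable I T G τ ∧ Improves σ τ ∧ Entry τ A v (e.eval σ) := by
  refine Ensures.ite (fun hc => ?_) (fun hc => Ensures.skip ?_)
  · simp only [Test.Holds, IExp.eval, WExp.eval, hA, hv] at hc
    refine Ensures.seq' (Ensures.setWt (Ensures.setIdx ?_))
    simp only [IExp.eval, hA, hv, Mem.idx_setWt]
    refine ⟨fun A' hA' v' hv' h => ?_, fun A' v' x h => ?_, by simp [Entry]⟩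
    · simp only [Mem.wt_setIdx, Mem.wt_setWt, Mem.idx_setIdx, Mem.idx_setWt] at h ⊢
      by_cases heq : A' = A ∧ v' = v
      · rw [if_pos heq, heq.1, heq.2]
        exact hN
      · rw [if_neg heq] at h ⊢
        exact hσ A' hA' v' hv' h
    · simp only [Entry, Mem.wt_setIdx, Mem.wt_setWt, Mem.idx_setIdx, Mem.idx_setWt] at h ⊢
      by_cases heq : A' = A ∧ v' = v
      · rw [if_pos heq, if_pos heq]
        rw [heq.1, heq.2] at h
        refine ⟨le_rfl, ?_⟩
        by_contra! hlt
        exact hc ⟨h.1, h.2.trans hlt.le⟩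
      · rw [if_neg heq, if_neg heq]
        exact h
  · simp only [Test.Holds, IExp.eval, WExp.eval, hA, hv, not_not] at hc
    exact ⟨hσ, .refl _, hc⟩

theorem cond_relax_spec {e : WExp} {t : Test} (hA : σ.idx 30 0 0 = A) (hv : σ.idx 31 0 0 = v)
    (hσ : SoundTable I T G σ)
    (hN : t.Holds σ → ∃ N ⊆ G, T.Realizes A v N ∧ I.cost N ≤ e.eval σ) :
    Ensures B (.cond t (relax e)) σ fun τ =>
      SoundTable I T G τ ∧ Improves σ τ ∧ (t.Holds σ → Entry τ A v (e.eval σ)) :=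
  Ensures.ite
    (fun hc => (relax_spec hA hv hσ (hN hc)).mono fun _ _ h => ⟨h.1, h.2.1, fun _ => h.2.2⟩)
    (fun hc => Ensures.skip ⟨hσ, .refl _, fun h => absurd h hc⟩)

theorem applyBase_spec (hst : Static I T G σ) (hT : T.Valid I) (hm : T.m ≤ B)
    (hA : σ.idx 30 0 0 = A) (hv : σ.idx 31 0 0 = v) (hAK : A < T.K) (hσ : SoundTable I T G σ) :
    Ensures B applyBase σ fun τ => SoundTable I T G τ ∧ Improves σ τ ∧
      (T.AllAt A v → Entry τ A v 0) := by
  refine Ensures.seq (checkNone_spec (φ := fun j => T.mask A j = 1 → T.loc j = v) hst.m_eq hm ?_)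
    fun τ hf h37 => ?_
  · intro j hj τ hf hxj
    have hst' := hst.frame hf rfl rfl rfl
    have hA' : τ.idx 30 0 0 = A := by rw [hf.1 30 rfl, hA]
    have hv' : τ.idx 31 0 0 = v := by rw [hf.1 31 rfl, hv]
    have := hT.mask_le A hAK j hj
    simp only [Test.Holds, IExp.eval, hxj, hA', hv', hst'.mask_eq, hst'.loc_eq,
      ← le_antisymm_iff, Classical.not_imp]
    exact and_congr_left fun _ => by omega
  · have hsame : SameTable σ τ := ⟨hf.1 25 rfl, hf.2 4 rfl⟩
    refine (cond_relax_spec (T := T) (G := G) (A := A) (v := v) (by rw [hf.1 30 rfl, hA])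
      (by rw [hf.1 31 rfl, hv]) (hsame.sound hσ) fun hc => ?_).mono fun ρ _ h =>
        ⟨h.1, hsame.improves.trans h.2.1, fun hall => h.2.2 (h37.2 hall)⟩
    have hall : T.AllAt A v := h37.1 hc
    exact ⟨∅, by simp, hall.realizes hT, by simp [Instance.cost, WExp.eval]⟩

/-- The table is updated in place, so entries may improve while they are being read. Completeness is
therefore measured against the table at the start, and soundness against the current one. -/
theorem applyMoves_spec (hst : Static I T G σ) (hG : G ⊆ I.edges)
    (hm : T.m ≤ B) (hB : I.n ≤ B) (hA : σ.idx 30 0 0 = A) (hv : σ.idx 31 0 0 = v)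
    (hAK : A < T.K) (hvn : v < I.n) (hσ : SoundTable I T G σ) :
    Ensures B applyMoves σ fun τ => SoundTable I T G τ ∧ Improves σ τ ∧
      ∀ u < I.n, ∀ x, Entry σ A u x → (T.Closed A → Entry τ A v x) ∧
        ((u, v) ∈ G → Entry τ A v (x + I.weight (u, v))) ∧
        ((v, u) ∈ G → Entry τ A v (x + I.weight (v, u))) := by
  refine Ensures.seq (checkNone_spec (φ := fun j => T.mask A j = T.mask A (T.par j)) hst.m_eq hm ?_)
    fun τ hf h37 => ?_
  · intro j hj τ hf hxj
    have hst' := hst.frame hf rfl rfl rfl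
    have hA' : τ.idx 30 0 0 = A := by rw [hf.1 30 rfl, hA]
    simp only [Test.Holds, IExp.eval, hxj, hA', hst'.mask_eq, hst'.par_eq, ← le_antisymm_iff]
  · have hst' := hst.frame hf rfl rfl rfl
    have hsame : SameTable σ τ := ⟨hf.1 25 rfl, hf.2 4 rfl⟩
    refine Ensures.forLoop hst'.env.size hB rfl
      (fun i ρ => SoundTable I T G ρ ∧ Improves σ ρ ∧
        ∀ u < i, ∀ x, Entry σ A u x → (T.Closed A → Entry ρ A v x) ∧
          ((u, v) ∈ G → Entry ρ A v (x + I.weight (u, v))) ∧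
          ((v, u) ∈ G → Entry ρ A v (x + I.weight (v, u))))
      ?_ ⟨hsame.sound hσ, hsame.improves, by simp⟩ ?_ (fun ρ h => h)
    · rintro i ρ y ⟨h1, h2, h3⟩
      have hs := SameTable.setIdx ρ (a := 32) 0 0 y (by decide)
      refine ⟨hs.sound h1, h2.trans hs.improves, ?_⟩
      simpa only [hs.entry] using h3
    intro u ρ hu hf' hxu ⟨h1, h2, h3⟩
    have hvars : ∀ {ρ' : Mem} {P : Prog}, Frame P ρ ρ' →
        (!P.modI 30 && !P.modI 31 && !P.modI 32 && !P.modI 37) = true →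
        ρ'.idx 30 0 0 = A ∧ ρ'.idx 31 0 0 = v ∧ ρ'.idx 32 0 0 = u ∧
          (1 ≤ ρ'.idx 37 0 0 ↔ T.Closed A) := by
      intro ρ' P hP hmod
      simp only [Bool.and_eq_true, Bool.not_eq_true'] at hmod
      obtain ⟨⟨⟨m1, m2⟩, m3⟩, m4⟩ := hmod
      refine ⟨?_, ?_, ?_, ?_⟩
      · rw [hP.1 30 m1, hf'.1 30 rfl, hf.1 30 rfl, hA]
      · rw [hP.1 31 m2, hf'.1 31 rfl, hf.1 31 rfl, hv]
      · rw [hP.1 32 m3, hxu]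
      · rw [hP.1 37 m4, hf'.1 37 rfl]
        exact h37
    have hst₁ := hst'.frame hf' rfl rfl rfl
    obtain ⟨a1, a2, a3, a4⟩ := hvars (Frame.refl .skip ρ) rfl
    refine Ensures.seq (cond_relax_spec a1 a2 h1 fun hc => ?_) fun ρ₁ hf₁ ⟨k1, k2, k3⟩ => ?_
    · simp only [Test.Holds, IExp.eval, a1, a3, a4] at hc
      obtain ⟨N, hN, hr, hx⟩ := h1 A hAK u hu hc.2
      refine ⟨N, hN, hr.jump hc.1, ?_⟩
      simpa [WExp.eval, IExp.eval, a1, a3] using hx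
    have hst₂ := hst₁.frame hf₁ rfl rfl rfl
    obtain ⟨b1, b2, b3, b4⟩ := hvars hf₁ rfl
    refine Ensures.seq (cond_relax_spec b1 b2 k1 fun hc => ?_) fun ρ₂ hf₂ ⟨l1, l2, l3⟩ => ?_
    · simp only [Test.Holds, IExp.eval, b1, b2, b3, hst₂.net_pos hu hvn] at hc
      obtain ⟨N, hN, hr, hx⟩ := k1 A hAK u hu hc.2
      refine ⟨{(u, v)} ∪ N, Finset.union_subset (by simpa using hc.1) hN,
        (hr.mono Finset.subset_union_right).move (Conn.edge (by simp)), ?_⟩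
      refine (Instance.cost_union_le (N := {(u, v)}) (by simpa using hG hc.1)).trans ?_
      simp only [WExp.eval, IExp.eval, b1, b2, b3, hst₂.env.weight_eq (hG hc.1)]
      simp only [Instance.cost, Finset.sum_singleton] at hx ⊢
      linarith
    have hst₃ := hst₂.frame hf₂ rfl rfl rfl
    have hf₁₂ : Frame (.seq (.cond (.and (.pos (.var 37)) (.pos (.cell 25 (.var 30) (.var 32))))
          (relax (.cell 4 (.var 30) (.var 32))))
          (.cond (.and (.pos (.cell 4 (.var 32) (.var 31))) (.pos (.cell 25 (.var 30) (.var 32))))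
            (relax (.add (.cell 4 (.var 30) (.var 32)) (.cell 0 (.var 32) (.var 31)))))) ρ ρ₂ :=
      (hf₁.mono (fun a ha => by simp_all [Prog.modI]) (fun a ha => by simp_all [Prog.modW])).trans
        (hf₂.mono (fun a ha => by simp_all [Prog.modI]) (fun a ha => by simp_all [Prog.modW]))
    obtain ⟨c1, c2, c3, c4⟩ := hvars hf₁₂ rfl
    refine (cond_relax_spec (T := T) (G := G) c1 c2 l1 fun hc => ?_).mono fun ρ₃ hf₃ ⟨m1, m2, m3⟩ =>
      ?_
    · simp only [Test.Holds, IExp.eval, c1, c2, c3, hst₃.net_pos hvn hu] at hc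
      obtain ⟨N, hN, hr, hx⟩ := l1 A hAK u hu hc.2
      refine ⟨{(v, u)} ∪ N, Finset.union_subset (by simpa using hc.1) hN,
        (hr.mono Finset.subset_union_right).move (Conn.symm (Conn.edge (by simp))), ?_⟩
      refine (Instance.cost_union_le (N := {(v, u)}) (by simpa using hG hc.1)).trans ?_
      simp only [WExp.eval, IExp.eval, c1, c2, c3, hst₃.env.weight_eq (hG hc.1)]
      simp only [Instance.cost, Finset.sum_singleton] at hx ⊢
      linarith
    refine ⟨m1, h2.trans (k2.trans (l2.trans m2)), fun u' hu' x hx => ?_⟩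
    have h0 := k2.trans (l2.trans m2)
    rcases Nat.lt_succ_iff_lt_or_eq.1 hu' with hlt | rfl
    · obtain ⟨g1, g2, g3⟩ := h3 u' hlt x hx
      exact ⟨fun h => h0 _ _ _ (g1 h), fun h => h0 _ _ _ (g2 h), fun h => h0 _ _ _ (g3 h)⟩
    · have x1 := h2 _ _ _ hx
      have x2 := k2 _ _ _ x1
      have x3 := l2 _ _ _ x2
      simp only [Test.Holds, WExp.eval, IExp.eval, a1, a3, a4] at k3
      simp only [Test.Holds, WExp.eval, IExp.eval, b1, b2, b3, hst₂.net_pos hu hvn] at l3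
      simp only [Test.Holds, WExp.eval, IExp.eval, c1, c2, c3, hst₃.net_pos hvn hu] at m3
      refine ⟨fun h => (l2.trans m2) _ _ _ ((k3 ⟨h, x1.1⟩).le x1.2), fun h => m2 _ _ _
        ((l3 ⟨h, x2.1⟩).le ?_), fun h => (m3 ⟨h, x3.1⟩).le ?_⟩
      · rw [hst₂.env.weight_eq (hG h)]
        linarith [x2.2]
      · rw [hst₃.env.weight_eq (hG h)]
        linarith [x3.2]

theorem applyUnion_spec (hst : Static I T G σ) (hT : T.Valid I) (hG : G ⊆ I.edges)
    (hm : T.m ≤ B) (hK : T.K ≤ B) (hA : σ.idx 30 0 0 = A) (hv : σ.idx 31 0 0 = v)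
    (hAK : A < T.K) (hvn : v < I.n) (hσ : SoundTable I T G σ) :
    Ensures B applyUnion σ fun τ => SoundTable I T G τ ∧ Improves σ τ ∧
      ∀ C < T.K, ∀ D < T.K, T.Splits A C D → ∀ x y, Entry σ C v x → Entry σ D v y →
        Entry τ A v (x + y) := by
  refine Ensures.forLoop₂ hst.K_eq hst.K_eq hK hK rfl
    (fun S τ => SoundTable I T G τ ∧ Improves σ τ ∧
      ∀ p ∈ S, T.Splits A p.1 p.2 → ∀ x y, Entry σ p.1 v x → Entry σ p.2 v y →
        Entry τ A v (x + y)) ?_ ?_ ⟨hσ, .refl _, by simp⟩ ?_ ?_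
  · rintro S ρ y ⟨h1, h2, h3⟩
    have hs := SameTable.setIdx ρ (a := 33) 0 0 y (by decide)
    exact ⟨hs.sound h1, h2.trans hs.improves, by simpa only [hs.entry] using h3⟩
  · rintro S ρ y ⟨h1, h2, h3⟩
    have hs := SameTable.setIdx ρ (a := 34) 0 0 y (by decide)
    exact ⟨hs.sound h1, h2.trans hs.improves, by simpa only [hs.entry] using h3⟩
  · intro C D S τ hC hD _ _ hf hxC hyD ⟨h1, h2, h3⟩
    have hstτ := hst.frame hf rfl rfl rfl
    have hAτ : τ.idx 30 0 0 = A := by rw [hf.1 30 rfl, hA]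
    have hvτ : τ.idx 31 0 0 = v := by rw [hf.1 31 rfl, hv]
    refine Ensures.seq (checkNone_spec (φ := fun j => T.mask C j + T.mask D j = T.mask A j)
      hstτ.m_eq hm ?_) fun ρ hf' h37 => ?_
    · intro j hj ρ hf' hxj
      have hst' := hstτ.frame hf' rfl rfl rfl
      have e1 : ρ.idx 30 0 0 = A := by rw [hf'.1 30 rfl, hAτ]
      have e2 : ρ.idx 33 0 0 = C := by rw [hf'.1 33 rfl, hxC]
      have e3 : ρ.idx 34 0 0 = D := by rw [hf'.1 34 rfl, hyD]
      simp only [Test.Holds, IExp.eval, hxj, e1, e2, e3, hst'.mask_eq, ← le_antisymm_iff]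
    · have hs : SameTable τ ρ := ⟨hf'.1 25 rfl, hf'.2 4 rfl⟩
      have e1 : ρ.idx 30 0 0 = A := by rw [hf'.1 30 rfl, hAτ]
      have e2 : ρ.idx 33 0 0 = C := by rw [hf'.1 33 rfl, hxC]
      have e3 : ρ.idx 34 0 0 = D := by rw [hf'.1 34 rfl, hyD]
      have e4 : ρ.idx 31 0 0 = v := by rw [hf'.1 31 rfl, hvτ]
      have hsρ := hs.sound h1
      refine (cond_relax_spec (T := T) (G := G) e1 e4 hsρ fun hc => ?_).mono
        fun κ _ ⟨k1, k2, k3⟩ => ⟨k1, h2.trans (hs.improves.trans k2), fun p hp hsp x y hx hy => ?_⟩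
      · simp only [Test.Holds, IExp.eval, e2, e3, e4, h37] at hc
        obtain ⟨N, hN, hr, hx⟩ := hsρ C hC v hvn hc.2.1
        obtain ⟨M, hM, hr', hy⟩ := hsρ D hD v hvn hc.2.2
        refine ⟨N ∪ M, Finset.union_subset hN hM, hr.union hT hAK hc.1 hr', ?_⟩
        refine (Instance.cost_union_le (hN.trans hG)).trans ?_
        simp only [WExp.eval, IExp.eval, e2, e3, e4]
        linarith
      · rcases Finset.mem_insert.1 hp with rfl | hp
        · simp only [Test.Holds, WExp.eval, IExp.eval, e2, e3, e4, h37] at k3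
          have x1 := (h2.trans hs.improves) _ _ _ hx
          have x2 := (h2.trans hs.improves) _ _ _ hy
          exact (k3 ⟨hsp, x1.1, x2.1⟩).le (add_le_add x1.2 x2.2)
        · exact (hs.improves.trans k2) _ _ _ (h3 p hp hsp x y hx hy)
  · rintro τ ⟨h1, h2, h3⟩
    exact ⟨h1, h2, fun C hC D hD => h3 (C, D) (by simp [hC, hD])⟩

end rules

/-- After `r` rounds the table is at least as good as every value derivable in `r` rounds; updates
in place can only be better. Soundness is preserved by each rule, so the entries are exact once `r`
reaches the bound from `TerminalData.derivable_of_realizes` for `n * n` edges. -/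
theorem solve_spec {I : Instance} {T : TerminalData} {G : Finset (ℕ × ℕ)} {σ : Mem} {B : ℕ}
    (hst : Static I T G σ) (hT : T.Valid I) (hG : G ⊆ I.edges) (hn : I.n ≤ B) (hm : T.m ≤ B)
    (hK : T.K ≤ B) (hR : σ.idx 26 0 0 ≤ B) (hR' : 4 * (I.n * I.n) + 1 ≤ σ.idx 26 0 0) :
    Ensures B solve σ fun τ => SoundTable I T G τ ∧
      ∀ A < T.K, ∀ v < I.n, ∀ N ⊆ G, T.Realizes A v N → Entry τ A v (I.cost N) := by
  refine Ensures.seq (Q := SoundTable I T G) ?_ fun τ hf hτ => ?_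
  · refine Ensures.forLoop₂ hst.K_eq hst.env.size hK hn rfl
      (fun S τ => ∀ p ∈ S, τ.idx 25 p.1 p.2 = 0) (fun S τ y h => by simpa using h)
      (fun S τ y h => by simpa using h) (by simp) ?_ ?_
    · intro A v S τ _ _ _ _ _ hxA hyv h
      refine Ensures.setIdx fun p hp => ?_
      simp only [IExp.eval, hxA, hyv, Mem.idx_setIdx]
      split_ifs with hpv
      · rfl
      · refine h p ((Finset.mem_insert.1 hp).resolve_left ?_)
        rintro rfl
        exact hpv ⟨rfl, rfl⟩
    -- Only the flags in table `25` are reset. Weights left over from an earlier call do no harm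
    -- while their flags are zero.
    · intro τ h A hA v hv h1
      rw [h (A, v) (by simp [hA, hv])] at h1
      omega
  have hstτ := hst.frame hf rfl rfl rfl
  refine Ensures.forLoop (N := σ.idx 26 0 0) (by rw [hf.1 26 rfl]) hR rfl
    (fun r τ => SoundTable I T G τ ∧
      ∀ A v x, T.Derivable I G r A v x → Entry τ A v x) ?_ ⟨hτ, ?_⟩ ?_ ?_
  · rintro r ρ y ⟨h1, h2⟩
    have hs := SameTable.setIdx ρ (a := 36) 0 0 y (by decide)
    exact ⟨hs.sound h1, by simpa only [hs.entry] using h2⟩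
  · intro A v x h
    cases h
  · intro r ρ hr hfρ _ ⟨h1, h2⟩
    have hstρ := hstτ.frame hfρ rfl rfl rfl
    refine Ensures.forLoop₂ hstρ.K_eq hstρ.env.size hK hn rfl
      (fun S π => SoundTable I T G π ∧ Improves ρ π ∧
        ∀ p ∈ S, ∀ x, T.Derivable I G (r + 1) p.1 p.2 x → Entry π p.1 p.2 x) ?_ ?_
      ⟨h1, .refl _, by simp⟩ ?_ ?_
    · rintro S π y ⟨g1, g2, g3⟩
      have hs := SameTable.setIdx π (a := 30) 0 0 y (by decide)
      exact ⟨hs.sound g1, g2.trans hs.improves, by simpa only [hs.entry] using g3⟩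
    · rintro S π y ⟨g1, g2, g3⟩
      have hs := SameTable.setIdx π (a := 31) 0 0 y (by decide)
      exact ⟨hs.sound g1, g2.trans hs.improves, by simpa only [hs.entry] using g3⟩
    · intro A v S π hA hv _ _ hfπ hxA hyv ⟨g1, g2, g3⟩
      have hstπ := hstρ.frame hfπ rfl rfl rfl
      refine Ensures.seq (applyBase_spec hstπ hT hm hxA hyv hA g1) fun π₁ f₁ ⟨a1, a2, a3⟩ => ?_
      have hst₁ := hstπ.frame f₁ rfl rfl rfl
      have hA₁ : π₁.idx 30 0 0 = A := by rw [f₁.1 30 rfl, hxA]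
      have hv₁ : π₁.idx 31 0 0 = v := by rw [f₁.1 31 rfl, hyv]
      refine Ensures.seq (applyMoves_spec hst₁ hG hm hn hA₁ hv₁ hA hv a1)
        fun π₂ f₂ ⟨b1, b2, b3⟩ => ?_
      have hst₂ := hst₁.frame f₂ rfl rfl rfl
      refine (applyUnion_spec hst₂ hT hG hm hK (by rw [f₂.1 30 rfl, hA₁])
        (by rw [f₂.1 31 rfl, hv₁]) hA hv b1).mono fun π₃ _ ⟨c1, c2, c3⟩ => ?_
      have i1 := g2.trans a2
      have i2 := i1.trans b2
      refine ⟨c1, i2.trans c2, fun p hp x hx => ?_⟩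
      rcases Finset.mem_insert.1 hp with rfl | hp
      · simp only at hx ⊢
        cases hx with
        | base _ _ hall => exact (b2.trans c2) _ _ _ (a3 hall)
        | edge he hd =>
          exact c2 _ _ _ ((b3 _ (I.edges_lt _ (hG he)).1 _ (i1 _ _ _ (h2 _ _ _ hd))).2.1 he)
        | revEdge he hd =>
          exact c2 _ _ _ ((b3 _ (I.edges_lt _ (hG he)).2 _ (i1 _ _ _ (h2 _ _ _ hd))).2.2 he)
        | jump _ hcl hd =>
          exact c2 _ _ _ ((b3 _ (hd.lt hG).2 _ (i1 _ _ _ (h2 _ _ _ hd))).1 hcl)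
        | union _ hs hd hd' =>
          exact c3 _ (hd.lt hG).1 _ (hd'.lt hG).1 hs _ _ (i2 _ _ _ (h2 _ _ _ hd))
            (i2 _ _ _ (h2 _ _ _ hd'))
        | keep hd => exact (i2.trans c2) _ _ _ (h2 _ _ _ hd)
      · exact (a2.trans (b2.trans c2)) _ _ _ (g3 p hp x hx)
    · rintro π ⟨g1, g2, g3⟩
      refine ⟨g1, fun A v x hx => ?_⟩
      obtain ⟨hA, hv⟩ := hx.lt hG
      exact g3 (A, v) (by simp [hA, hv]) x hx
  · rintro ρ ⟨h1, h2⟩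
    refine ⟨h1, fun A hA v hv N hN hr => ?_⟩
    obtain ⟨x, hx, hd⟩ := TerminalData.derivable_of_realizes hT hG N.card N hN le_rfl A hA v hv hr
    refine (h2 A v x (hd.mono ?_)).le hx
    have hcard : N.card ≤ I.n * I.n := by
      have : N ⊆ Finset.range I.n ×ˢ Finset.range I.n := fun e he => by
        have := I.edges_lt e (hG (hN he))
        simp [this.1, this.2]
      simpa using Finset.card_le_card this
    omega

/-! ### Listing terminals and sets of terminals -/

/-- List the end points of the nontrivial demands, and count the sets of terminals. -/
def listTerminals : Prog :=
  .seq (.setVar 20 (.const 0)) (.seq (.setVar 23 (.const 1))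
    (.forLoop₂ 11 0 12 0
      (.cond (.and (.pos (.cell 2 (.var 11) (.var 12))) (.not (.ieq (.var 11) (.var 12))))
        (.seq (.setIdx 21 (.var 20) (.const 0) (.var 11))
        (.seq (.setIdx 21 (.add (.var 20) (.const 1)) (.const 0) (.var 12))
        (.seq (.setIdx 22 (.var 20) (.const 0) (.add (.var 20) (.const 1)))
        (.seq (.setIdx 22 (.add (.var 20) (.const 1)) (.const 0) (.var 20))
        (.seq (.setVar 20 (.add (.var 20) (.const 2)))
        (.seq (.setVar 23 (.add (.var 23) (.var 23)))
          (.setVar 23 (.add (.var 23) (.var 23))))))))))))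

/-- Write the sets of terminals into the rows of table `24`. -/
def listMasks : Prog :=
  .forLoop 30 23 (.seq (.setVar 38 (.var 30))
    (.forLoop 35 20
      (.seq (.setIdx 24 (.var 30) (.var 35)
          (.sub (.var 38) (.add (.half (.var 38)) (.half (.var 38)))))
        (.setVar 38 (.half (.var 38))))))

/-- Compute the number of rounds of the dynamic program. -/
def countRounds : Prog :=
  .seq (.setVar 26 (.const 1)) (.forLoop₂ 11 0 12 0 (.setVar 26 (.add (.var 26) (.const 4))))

/-- The first `m` terminals are the end points of the demands in `D`. -/
structure Listing (D : Finset (ℕ × ℕ)) (m : ℕ) (loc par : ℕ → ℕ) : Prop where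
  card : m = 2 * D.card
  par_lt : ∀ j < m, par j < m
  par_par : ∀ j < m, par (par j) = j
  sound : ∀ j < m, (loc j, loc (par j)) ∈ D ∨ (loc (par j), loc j) ∈ D
  complete : ∀ d ∈ D, ∃ j < m, loc j = d.1 ∧ loc (par j) = d.2

theorem Listing.push {D : Finset (ℕ × ℕ)} {m : ℕ} {loc par loc' par' : ℕ → ℕ}
    (h : Listing D m loc par) {u v : ℕ} (huv : (u, v) ∉ D)
    (hloc : ∀ j, loc' j = if j = m + 1 then v else if j = m then u else loc j)
    (hpar : ∀ j, par' j = if j = m + 1 then m else if j = m then m + 1 else par j) :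
    Listing (insert (u, v) D) (m + 2) loc' par' := by
  have l0 : loc' m = u := by rw [hloc]; simp
  have l1 : loc' (m + 1) = v := by rw [hloc]; simp
  have p0 : par' m = m + 1 := by rw [hpar]; simp
  have p1 : par' (m + 1) = m := by rw [hpar]; simp
  have ll : ∀ j < m, loc' j = loc j := fun j hj => by
    rw [hloc, if_neg (by omega), if_neg (by omega)]
  have pp : ∀ j < m, par' j = par j := fun j hj => by
    rw [hpar, if_neg (by omega), if_neg (by omega)]
  have cases3 : ∀ j < m + 2, j < m ∨ j = m ∨ j = m + 1 := fun j hj => by omega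
  refine ⟨?_, fun j hj => ?_, fun j hj => ?_, fun j hj => ?_, fun d hd => ?_⟩
  · rw [Finset.card_insert_of_notMem huv, h.card]
    ring
  · rcases cases3 j hj with h1 | rfl | rfl
    · rw [pp j h1]
      have := h.par_lt j h1
      omega
    · rw [p0]; omega
    · rw [p1]; omega
  · rcases cases3 j hj with h1 | rfl | rfl
    · rw [pp j h1, pp _ (h.par_lt j h1), h.par_par j h1]
    · rw [p0, p1]
    · rw [p1, p0]
  · rcases cases3 j hj with h1 | rfl | rfl
    · rw [pp j h1, ll j h1, ll _ (h.par_lt j h1)]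
      exact (h.sound j h1).imp (Finset.mem_insert_of_mem ·) (Finset.mem_insert_of_mem ·)
    · rw [p0, l0, l1]; exact Or.inl (Finset.mem_insert_self _ _)
    · rw [p1, l0, l1]; exact Or.inr (Finset.mem_insert_self _ _)
  · rcases Finset.mem_insert.1 hd with rfl | hd
    · exact ⟨m, by omega, l0, by rw [p0, l1]⟩
    · obtain ⟨j, hj, h1, h2⟩ := h.complete d hd
      exact ⟨j, by omega, by rw [ll j hj, h1], by rw [pp j hj, ll _ (h.par_lt j hj), h2]⟩

/-- The demands between different vertices. -/
def Instance.properDemands (I : Instance) : Finset (ℕ × ℕ) :=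
  I.demands.filter fun d => d.1 ≠ d.2

/-- Each proper demand contributes two terminals of its own, even at vertices that occur before, so
the number of sets is doubled twice. -/
theorem listTerminals_spec {I : Instance} {σ : Mem} {B : ℕ} (hσ : Env I σ) (hB : I.n ≤ B) :
    Ensures B listTerminals σ fun τ =>
      Listing I.properDemands (dataOf τ).m (dataOf τ).loc (dataOf τ).par ∧
      (dataOf τ).K = 4 ^ I.properDemands.card := by
  refine Ensures.seq' (Ensures.setIdx (Ensures.seq' (Ensures.setIdx ?_)))
  simp only [IExp.eval]
  refine Ensures.forLoop₂ (N := I.n) (M := I.n) (by simp [hσ.size]) (by simp [hσ.size]) hB hB rfl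
    (fun S τ => Listing (I.properDemands ∩ S) (τ.idx 20 0 0) (fun j => τ.idx 21 j 0)
      (fun j => τ.idx 22 j 0) ∧ τ.idx 23 0 0 = 4 ^ (I.properDemands ∩ S).card)
    (fun S τ y h => by simpa using h) (fun S τ y h => by simpa using h) ?_ ?_ ?_
  · refine ⟨⟨?_, ?_, ?_, ?_, ?_⟩, ?_⟩ <;> simp
  · intro u v S τ hu hv _ huv hf hxu hyv ⟨h1, h2⟩
    have e2 : τ.idx 2 = σ.idx 2 := by rw [hf.1 2 rfl]; simp
    have huv' : (u, v) ∉ I.properDemands ∩ S := fun h => huv (Finset.mem_inter.1 h).2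
    have hmem : (u, v) ∈ I.properDemands ↔ (u, v) ∈ I.demands ∧ u ≠ v := by
      simp [Instance.properDemands]
    refine Ensures.ite (fun hc => ?_) (fun hc => Ensures.skip ?_)
    · simp only [Test.Holds, IExp.eval, hxu, hyv, e2, hσ.demand_pos, ← le_antisymm_iff] at hc
      rw [Finset.inter_insert_of_mem (hmem.2 hc), Finset.card_insert_of_notMem huv']
      refine Ensures.seq' (Ensures.setIdx (Ensures.seq' (Ensures.setIdx (Ensures.seq'
        (Ensures.setIdx (Ensures.seq' (Ensures.setIdx (Ensures.seq' (Ensures.setIdx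
        (Ensures.seq' (Ensures.setIdx (Ensures.setIdx ?_))))))))))))
      refine ⟨?_, ?_⟩
      · have := h1.push huv'
          (loc' := fun j => if j = τ.idx 20 0 0 + 1 then v else if j = τ.idx 20 0 0 then u else
            τ.idx 21 j 0)
          (par' := fun j => if j = τ.idx 20 0 0 + 1 then τ.idx 20 0 0 else
            if j = τ.idx 20 0 0 then τ.idx 20 0 0 + 1 else τ.idx 22 j 0)
          (fun _ => rfl) (fun _ => rfl)
        simpa [IExp.eval, hxu, hyv] using this
      · simp only [IExp.eval, Mem.idx_setIdx_of_ne, Mem.idx_setIdx, ne_eq, Nat.reduceEqDiff,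
          not_false_eq_true, and_self, if_true, h2]
        ring
    · simp only [Test.Holds, IExp.eval, hxu, hyv, e2, hσ.demand_pos, ← le_antisymm_iff] at hc
      rw [Finset.inter_insert_of_notMem fun h => hc (hmem.1 h)]
      exact ⟨h1, h2⟩
  · intro τ h
    have hsub : I.properDemands ∩ (Finset.range I.n ×ˢ Finset.range I.n) = I.properDemands :=
      Finset.inter_eq_left.2 fun d hd => by
        have := I.demands_lt d (Finset.mem_filter.1 hd).1
        simp [this.1, this.2]
    rw [hsub] at h
    exact h

/-- Variable `38` runs through the quotients `A / 2 ^ j`; subtracting twice the half of such a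
number leaves its last bit. -/
theorem listMasks_spec {σ : Mem} {B : ℕ} (hm : (dataOf σ).m ≤ B) (hK : (dataOf σ).K ≤ B) :
    Ensures B listMasks σ fun τ => ∀ A < (dataOf σ).K, ∀ j < (dataOf σ).m,
      τ.idx 24 A j = A / 2 ^ j % 2 := by
  refine Ensures.forLoop rfl hK rfl (fun i τ => ∀ A < i, ∀ j < (dataOf σ).m,
    τ.idx 24 A j = A / 2 ^ j % 2) (fun i τ y h => by simpa using h) (by simp) ?_ (fun τ h => h)
  intro A τ hA hf hxA h
  refine Ensures.seq' (Ensures.setIdx ?_)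
  simp only [IExp.eval, hxA]
  refine Ensures.forLoop (N := (dataOf σ).m) (by simp [hf.1 20 rfl, dataOf]) hm rfl
    (fun i ρ => ρ.idx 38 0 0 = A / 2 ^ i ∧ (∀ A' < A, ∀ j < (dataOf σ).m,
      ρ.idx 24 A' j = A' / 2 ^ j % 2) ∧ ∀ j < i, ρ.idx 24 A j = A / 2 ^ j % 2)
    (fun i τ y h => by simpa using h) (by simpa using h) ?_ ?_
  · intro i ρ hi hf' hxi ⟨h1, h2, h3⟩
    have hA' : ρ.idx 30 0 0 = A := by rw [hf'.1 30 rfl]; simpa using hxA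
    refine Ensures.seq' (Ensures.setIdx (Ensures.setIdx ⟨?_, fun A' hA'' j hj => ?_,
      fun j hj => ?_⟩))
    · simp [IExp.eval, h1, Nat.div_div_eq_div_mul, pow_succ]
    · simp only [IExp.eval, hA', hxi, Mem.idx_setIdx_of_ne, Mem.idx_setIdx, ne_eq,
        Nat.reduceEqDiff, not_false_eq_true]
      rw [if_neg (by omega)]
      exact h2 A' hA'' j hj
    · simp only [IExp.eval, hA', hxi, Mem.idx_setIdx_of_ne, Mem.idx_setIdx, ne_eq,
        Nat.reduceEqDiff, not_false_eq_true, true_and, h1]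
      split_ifs with hji
      · subst hji; omega
      · exact h3 j (by omega)
  · rintro ρ ⟨-, h2, h3⟩ A' hA' j hj
    rcases Nat.lt_succ_iff_lt_or_eq.1 hA' with hlt | rfl
    · exact h2 A' hlt j hj
    · exact h3 j hj

/-- Counting the pairs of vertices replaces the multiplication that the machine lacks. -/
theorem countRounds_spec {I : Instance} {σ : Mem} {B : ℕ} (hσ : Env I σ) (hB : I.n ≤ B) :
    Ensures B countRounds σ fun τ => τ.idx 26 0 0 = 4 * (I.n * I.n) + 1 := by
  refine Ensures.seq' (Ensures.setIdx ?_)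
  simp only [IExp.eval]
  refine Ensures.forLoop₂ (N := I.n) (M := I.n) (by simp [hσ.size]) (by simp [hσ.size]) hB hB rfl
    (fun S τ => τ.idx 26 0 0 = 4 * S.card + 1)
    (fun S τ y h => by simpa using h) (fun S τ y h => by simpa using h) (by simp) ?_ ?_
  · intro u v S τ _ _ _ huv _ _ _ h
    refine Ensures.setIdx ?_
    simp only [IExp.eval, Mem.idx_setIdx, and_self, if_true, h, Finset.card_insert_of_notMem huv]
    omega
  · intro τ h
    simpa using h

theorem exists_binary (m : ℕ) : ∀ p : ℕ → Prop, ∃ A < 2 ^ m, ∀ j < m, A / 2 ^ j % 2 = 1 ↔ p j := by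
  classical
  induction m with
  | zero => exact fun p => ⟨0, by simp, by simp⟩
  | succ m ih =>
    intro p
    obtain ⟨A, hA, h⟩ := ih fun j => p (j + 1)
    refine ⟨(if p 0 then 1 else 0) + 2 * A, ?_, fun j hj => ?_⟩
    · rw [pow_succ]; split_ifs <;> omega
    · rcases j with _ | j
      · by_cases hp : p 0 <;> simp [hp]
      · rw [pow_succ', ← Nat.div_div_eq_div_mul,
          show ((if p 0 then 1 else 0) + 2 * A) / 2 = A by split_ifs <;> omega]
        exact h j (by omega)

/-- Here `T.K = 2 ^ T.m`, so the rows run through all binary words of length `T.m`, and the last one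
consists of ones. -/
theorem Listing.valid {I : Instance} {T : TerminalData}
    (h : Listing I.properDemands T.m T.loc T.par) (hK : T.K = 4 ^ I.properDemands.card)
    (hmask : ∀ A < T.K, ∀ j < T.m, T.mask A j = A / 2 ^ j % 2) : T.Valid I := by
  have hK2 : T.K = 2 ^ T.m := by rw [hK, h.card, pow_mul]; norm_num
  have hpos : 0 < T.K := by rw [hK]; positivity
  refine ⟨h.par_lt, h.par_par, fun j hj => ?_, fun j hj => ?_, fun d hd hne => ?_,
    fun A hA j hj => ?_, fun p => ?_, hpos, fun j hj => ?_⟩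
  · rcases h.sound j hj with h1 | h1
    · exact (Finset.mem_filter.1 h1).2
    · exact (Finset.mem_filter.1 h1).2.symm
  · exact (h.sound j hj).imp (fun h1 => (Finset.mem_filter.1 h1).1)
      (fun h1 => (Finset.mem_filter.1 h1).1)
  · exact h.complete d (Finset.mem_filter.2 ⟨hd, hne⟩)
  · rw [hmask A hA j hj]; omega
  · obtain ⟨A, hA, hp⟩ := exists_binary T.m p
    rw [← hK2] at hA
    exact ⟨A, hA, fun j hj => by rw [hmask A hA j hj]; exact hp j hj⟩
  · rw [hmask _ (by omega) j hj, hK2]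
    have := Nat.testBit_two_pow_sub_one T.m j
    rw [Nat.testBit_eq_decide_div_mod_eq] at this
    simpa [hj] using this

/-! ### The second algorithm -/

/-- Test whether the network in table `4` has a solution of cost at most weight variable `5`. -/
def testOptimum : Prog :=
  .seq solve (.seq (.setVar 17 (.const 0))
    (.cond (.and (.pos (.cell 25 (.sub (.var 23) (.const 1)) (.const 0)))
        (.wle (.cell 4 (.sub (.var 23) (.const 1)) (.const 0)) (.var 5)))
      (.setVar 17 (.const 1))))

/-- The approximation algorithm with ratio `2`. -/
def twoApprox : Prog :=
  .seq listTerminals (.seq listMasks (.seq countRounds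
    (.seq (.forLoop₂ 11 0 12 0 (.setIdx 4 (.var 11) (.var 12) (.cell 1 (.var 11) (.var 12))))
      (.seq solve
        (.seq (.setWt 5 (.const 0) (.const 0) (.cell 4 (.sub (.var 23) (.const 1)) (.const 0)))
          (.seq (prune testOptimum) outputBoth))))))

/-- For the full set of terminals the vertex of the state does not matter; vertex `0` is used, which
exists because of `hpos`. Soundness and completeness of the table give the two directions. -/
theorem testOptimum_spec {I : Instance} {T : TerminalData} {G : Finset (ℕ × ℕ)} {σ : Mem} {B : ℕ}
    (hst : Static I T G σ) (hT : T.Valid I) (hG : G ⊆ I.edges) (hn : I.n ≤ B) (hm : T.m ≤ B)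
    (hK : T.K ≤ B) (hR : σ.idx 26 0 0 ≤ B) (hR' : 4 * (I.n * I.n) + 1 ≤ σ.idx 26 0 0)
    (hpos : 0 < I.n) :
    Ensures B testOptimum σ fun τ => τ.idx 17 0 0 ≠ 0 ↔
      ∃ N ⊆ G, (∀ d ∈ I.demands, Conn (N : Set (ℕ × ℕ)) d.1 d.2) ∧ I.cost N ≤ σ.wt 5 0 0 := by
  refine Ensures.seq (solve_spec hst hT hG hn hm hK hR hR') fun τ hf ⟨h1, h2⟩ => ?_
  have hst' := hst.frame hf rfl rfl rfl
  have hK' : T.K - 1 < T.K := Nat.sub_lt hT.pos one_pos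
  have hiff : Entry τ (T.K - 1) 0 (σ.wt 5 0 0) ↔ ∃ N ⊆ G,
      (∀ d ∈ I.demands, Conn (N : Set (ℕ × ℕ)) d.1 d.2) ∧ I.cost N ≤ σ.wt 5 0 0 := by
    constructor
    · rintro ⟨g1, g2⟩
      obtain ⟨N, hN, hr, hx⟩ := h1 _ hK' 0 hpos g1
      exact ⟨N, hN, hT.realizes_full_iff.1 hr, hx.trans g2⟩
    · rintro ⟨N, hN, hr, hx⟩
      exact (h2 _ hK' 0 hpos N hN (hT.realizes_full_iff.2 hr)).le hx
  refine Ensures.seq' (Ensures.setIdx (Ensures.ite (fun hc => Ensures.setIdx ?_)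
    (fun hc => Ensures.skip ?_)))
  · simp only [Test.Holds, WExp.eval, IExp.eval, Mem.wt_setIdx, Mem.idx_setIdx_of_ne, ne_eq,
      Nat.reduceEqDiff, not_false_eq_true, hst'.K_eq, hf.2 5 rfl] at hc
    simpa [IExp.eval] using hiff.1 hc
  · simp only [Test.Holds, WExp.eval, IExp.eval, Mem.wt_setIdx, Mem.idx_setIdx_of_ne, ne_eq,
      Nat.reduceEqDiff, not_false_eq_true, hst'.K_eq, hf.2 5 rfl] at hc
    simpa [IExp.eval] using fun N h3 h4 => lt_of_not_ge fun h5 => hc (hiff.2 ⟨N, h3, h4, h5⟩)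

/-- The dynamic program yields only the optimum value. A solution is extracted by deleting edges as
long as the rest contains a solution of that value, at the price of rerunning the dynamic program
for every test. -/
theorem twoApprox_spec {I : Instance} (hI : I.Bidirected) {B : ℕ}
    (hB : 4 ^ I.k * (4 * (I.n * I.n) + I.n + 1) ≤ B) :
    Ensures B twoApprox I.input fun τ => (∃ M, I.Feasible M) → I.IsApprox 2 (I.output τ) := by
  have h0 : Env I I.input := .input I
  have h4k : 1 ≤ 4 ^ I.k := Nat.one_le_pow _ _ (by norm_num)
  -- A single `B` has to bound all loop lengths: vertices, rounds, sets of terminals and terminals.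
  have hnB : I.n ≤ B := by nlinarith
  have hRB : 4 * (I.n * I.n) + 1 ≤ B := by nlinarith
  have hck : I.properDemands.card ≤ I.k := Finset.card_le_card (Finset.filter_subset _ _)
  have hKB : 4 ^ I.properDemands.card ≤ B :=
    (Nat.pow_le_pow_right (by norm_num) hck).trans (by nlinarith)
  have hmB : 2 * I.properDemands.card ≤ B := by
    have h1 : I.properDemands.card < 2 ^ I.properDemands.card := Nat.lt_two_pow_self
    have h2 : 4 ^ I.properDemands.card = 2 ^ I.properDemands.card * 2 ^ I.properDemands.card := by
      rw [← mul_pow]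
      norm_num
    nlinarith
  refine Ensures.seq (listTerminals_spec h0 hnB) fun σ₁ f₁ ⟨hl, hK⟩ => ?_
  have e₁ := h0.frame f₁ rfl
  have hm₁ : (dataOf σ₁).m ≤ B := by rw [hl.card]; exact hmB
  have hK₁ : (dataOf σ₁).K ≤ B := by rw [hK]; exact hKB
  refine Ensures.seq (listMasks_spec hm₁ hK₁) fun σ₂ f₂ hmask => ?_
  have e₂ := e₁.frame f₂ rfl
  have hm₂ : (dataOf σ₂).m = (dataOf σ₁).m := by simp only [dataOf, f₂.1 20 rfl]
  have hK₂ : (dataOf σ₂).K = (dataOf σ₁).K := by simp only [dataOf, f₂.1 23 rfl]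
  have hT : (dataOf σ₂).Valid I := by
    refine Listing.valid ?_ (hK₂.trans hK) ?_
    · have h1 : (dataOf σ₂).loc = (dataOf σ₁).loc := by simp only [dataOf, f₂.1 21 rfl]
      have h2 : (dataOf σ₂).par = (dataOf σ₁).par := by simp only [dataOf, f₂.1 22 rfl]
      rw [h1, h2, hm₂]
      exact hl
    · rw [hm₂, hK₂]
      exact hmask
  rw [← hm₂] at hm₁
  rw [← hK₂] at hK₁
  refine Ensures.seq (countRounds_spec e₂ hnB) fun σ₃ f₃ hR => ?_
  have e₃ := e₂.frame f₃ rfl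
  have d₃ := dataOf_frame f₃ rfl
  refine Ensures.seq (Q := fun τ => netOf I.n (τ.idx 4) = I.edges) ?_ fun σ₄ f₄ hnet => ?_
  · refine Ensures.forLoop₂ e₃.size e₃.size hnB hnB rfl
      (fun S τ => ∀ p ∈ S, τ.idx 4 p.1 p.2 = σ₃.idx 1 p.1 p.2) (fun S τ y h => by simpa using h)
      (fun S τ y h => by simpa using h) (by simp) ?_ ?_
    · intro u v S τ _ _ _ _ hf hxu hyv h
      refine Ensures.setIdx fun p hp => ?_
      simp only [IExp.eval, hxu, hyv, Mem.idx_setIdx, hf.1 1 rfl]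
      split_ifs with hpv
      · rw [hpv.1, hpv.2]
      · refine h p ((Finset.mem_insert.1 hp).resolve_left ?_)
        rintro rfl
        exact hpv ⟨rfl, rfl⟩
    · intro τ h
      ext ⟨u, v⟩
      rw [mem_netOf, ← e₃.edge_pos]
      constructor
      · rintro ⟨hu, hv, h1⟩
        rw [h (u, v) (by simp [hu, hv])] at h1
        exact Nat.one_le_iff_ne_zero.2 h1
      · intro h1
        obtain ⟨hu, hv⟩ := I.edges_lt _ ((e₃.edge_pos u v).1 h1)
        refine ⟨hu, hv, ?_⟩
        rw [h (u, v) (by simpa using ⟨hu, hv⟩)]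
        exact Nat.one_le_iff_ne_zero.1 h1
  have e₄ := e₃.frame f₄ rfl
  have d₄ := (dataOf_frame f₄ rfl).trans d₃
  have hst₄ : Static I (dataOf σ₂) I.edges σ₄ := ⟨e₄, d₄, hnet⟩
  have hR₄ : σ₄.idx 26 0 0 = 4 * (I.n * I.n) + 1 := by rw [f₄.1 26 rfl, hR]
  refine Ensures.seq (solve_spec hst₄ hT subset_rfl hnB hm₁ hK₁ (hR₄.trans_le hRB) hR₄.ge)
    fun σ₅ f₅ ⟨hs, hopt⟩ => ?_
  have hst₅ := hst₄.frame f₅ rfl rfl rfl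
  refine Ensures.seq' (Ensures.setWt ?_)
  simp only [IExp.eval, WExp.eval, hst₅.K_eq]
  set K := (dataOf σ₂).K with hKdef
  set σ₆ := σ₅.setWt 5 0 0 (σ₅.wt 4 (K - 1) 0) with hσ₆
  have hst₆ : Static I (dataOf σ₂) I.edges σ₆ :=
    ⟨⟨hst₅.env.size, hst₅.env.edges, hst₅.env.demands, by
      rw [hσ₆, Mem.wt_setWt_of_ne _ _ _ _ (by decide), hst₅.env.weight]⟩, hst₅.data, hst₅.net⟩
  have hW₆ : σ₆.wt 5 0 0 = σ₅.wt 4 (K - 1) 0 := by simp [hσ₆]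
  set W := σ₅.wt 4 (K - 1) 0 with hW
  have hR₆ : σ₆.idx 26 0 0 = 4 * (I.n * I.n) + 1 := by
    rw [hσ₆, Mem.idx_setWt, f₅.1 26 rfl, hR₄]
  refine Ensures.seq (prune_spec
    (E := fun τ => Env I τ ∧ dataOf τ = dataOf σ₂ ∧ τ.idx 26 0 0 = 4 * (I.n * I.n) + 1 ∧
      τ.wt 5 0 0 = W)
    (φ := fun X => ∃ N ⊆ X, (∀ d ∈ I.demands, Conn (N : Set (ℕ × ℕ)) d.1 d.2) ∧ I.cost N ≤ W)
    rfl hnB hst₆.env.size ⟨hst₆.env, hst₆.data, hR₆, hW₆⟩ ?_ ?_ ?_) fun σ₇ f₇ hp => ?_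
  · rintro τ τ' hf ⟨g1, g2, g3, g4⟩
    exact ⟨g1.frame hf rfl, (dataOf_frame hf rfl).trans g2, by rw [hf.1 26 rfl, g3],
      by rw [hf.2 5 rfl, g4]⟩
  · rintro X Y ⟨N, hN, h⟩ hXY
    exact ⟨N, hN.trans hXY, h⟩
  · rintro τ hpos hsub ⟨g1, g2, g3, g4⟩
    rw [hst₆.net] at hsub
    have := testOptimum_spec (σ := τ) (B := B) ⟨g1, g2, rfl⟩ hT hsub hnB hm₁ hK₁
      (g3.trans_le hRB) g3.ge hpos
    rwa [g4] at this
  rw [hst₆.net] at hp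
  have e₇ := hst₆.env.frame f₇ rfl
  refine (outputBoth_spec e₇ hnB fun u v => ?_).mono ?_
  · rw [f₇.1 3 rfl, hσ₆, Mem.idx_setWt, f₅.1 3 rfl, f₄.1 3 rfl, f₃.1 3 rfl, f₂.1 3 rfl, f₁.1 3 rfl]
    simp [Instance.input]
  rintro ρ - hρ ⟨M, hM⟩
  have hM' := Instance.Connects.of_feasible hM
  rw [hρ, show (2 : ℝ) = 2 * 1 by norm_num]
  -- Without vertices there is no state at vertex `0`, but then the empty network is optimal.
  rcases Nat.eq_zero_or_pos I.n with hn0 | hpos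
  · have hempty : netOf I.n (σ₇.idx 4) = ∅ := by simp [netOf, hn0]
    rw [hempty]
    refine Instance.isApprox_of_connects hI ⟨by simp, fun d hd => ?_⟩ fun N hN => ?_
    · have := (I.demands_lt d hd).1
      omega
    · simpa [Instance.cost] using Instance.cost_nonneg hN.1
  have hK' : K - 1 < K := Nat.sub_lt hT.pos one_pos
  have hlow : ∀ N, I.Connects N → 1 ≤ σ₅.idx 25 (K - 1) 0 ∧ W ≤ I.cost N := fun N hN =>
    hopt _ hK' 0 hpos N hN.1 (hT.realizes_full_iff.2 hN.2)
  obtain ⟨N, hN, hr, hx⟩ := hs _ hK' 0 hpos (hlow M hM').1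
  obtain ⟨⟨X, hXsub, hX, hXc⟩, hirr⟩ := hp.2 ⟨N, hN, hT.realizes_full_iff.1 hr, hx⟩
  -- By irredundancy the solution inside the pruned network is all of it, as an unused edge could be
  -- deleted.
  have hXeq : X = netOf I.n (σ₇.idx 4) := by
    refine hXsub.antisymm fun e he => ?_
    by_contra heX
    exact hirr e he ⟨X, fun f hf => Finset.mem_erase.2 ⟨fun h => heX (h ▸ hf), hXsub hf⟩, hX, hXc⟩
  rw [← hXeq]
  refine Instance.isApprox_of_connects hI ⟨hXsub.trans hp.1, hX⟩ fun N hN => ?_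
  rw [one_mul]
  exact hXc.trans (hlow N hN).2

/-! ### Running time bounds -/

theorem four_pow_le (k d : ℕ) :
    ((4 ^ k) ^ d : ℝ) ≤ 4 ^ d * 2 ^ ((2 * d : ℝ) * ((k : ℝ) * Real.logb 2 k)) := by
  have h2 : ∀ x : ℝ, 0 ≤ x → (1 : ℝ) ≤ 2 ^ x := fun x hx => Real.one_le_rpow (by norm_num) hx
  rcases Nat.lt_or_ge k 2 with hk | hk
  -- For `k ≤ 1` the exponent `k * log k` vanishes, and the factor `4 ^ d` takes over.
  · have h1 : ((4 ^ k) ^ d : ℝ) ≤ 4 ^ d := by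
      refine pow_le_pow_left₀ (by positivity) ?_ d
      calc (4 : ℝ) ^ k ≤ 4 ^ 1 := pow_le_pow_right₀ (by norm_num) (by omega)
        _ = 4 := by norm_num
    have h3 : (k : ℝ) * Real.logb 2 k = 0 := by
      interval_cases k <;> simp
    rw [h3]
    simpa using h1
  -- For `k ≥ 2` the binary logarithm is at least 1, so `k ≤ k * log k`.
  · have hk' : (2 : ℝ) ≤ k := by exact_mod_cast hk
    have hlog : 1 ≤ Real.logb 2 k := by
      rw [Real.le_logb_iff_rpow_le (by norm_num) (by linarith)]
      simpa using hk'
    have h3 : ((4 ^ k) ^ d : ℝ) = 2 ^ ((2 * d : ℝ) * k) := by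
      rw [show (2 * d : ℝ) * k = ((2 * k * d : ℕ) : ℝ) by push_cast; ring, Real.rpow_natCast,
        pow_mul, pow_mul]
      norm_num
    rw [h3]
    have h4 : (2 : ℝ) ^ ((2 * d : ℝ) * k) ≤ 2 ^ ((2 * d : ℝ) * ((k : ℝ) * Real.logb 2 k)) := by
      refine Real.rpow_le_rpow_of_exponent_le (by norm_num) ?_
      refine mul_le_mul_of_nonneg_left ?_ (by positivity)
      nlinarith
    have h5 : (1 : ℝ) ≤ 4 ^ d := one_le_pow₀ (by norm_num)
    have h6 : (0 : ℝ) < 2 ^ ((2 * d : ℝ) * ((k : ℝ) * Real.logb 2 k)) := by positivity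
    nlinarith

theorem exists_twoApprox : ∃ (P : Prog) (C : ℝ) (p : Polynomial ℕ),
    ApproximatesInTime P 2
      (fun n k => (2 : ℝ) ^ (C * ((k : ℝ) * Real.logb 2 (k : ℝ))) * ((p.eval n : ℕ) : ℝ)) := by
  obtain ⟨c, d, h⟩ := twoApprox.timeBound_le_poly
  refine ⟨twoApprox, 2 * d, Polynomial.C (c * 4 ^ d) *
    (4 * (Polynomial.X * Polynomial.X) + Polynomial.X + 2) ^ d, fun I hI => ?_⟩
  obtain ⟨t, τ, hr, ht, hτ⟩ := twoApprox_spec hI le_rfl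
  refine ⟨t, τ, hr, ?_, hτ⟩
  set q := 4 * (I.n * I.n) + I.n with hq
  have h4k : 1 ≤ 4 ^ I.k := Nat.one_le_pow _ _ (by norm_num)
  have h1 : t ≤ c * (4 ^ I.k) ^ d * (q + 2) ^ d := by
    refine (ht.trans (h _)).trans ?_
    rw [mul_assoc, ← mul_pow]
    refine Nat.mul_le_mul_left _ (Nat.pow_le_pow_left ?_ d)
    -- This is `4 ^ k * (q + 1) + 1 ≤ 4 ^ k * (q + 2)`; the additional 1 comes from the form of
    -- `Prog.timeBound_le_poly`.
    nlinarith
  have h2 : (t : ℝ) ≤ c * (4 ^ I.k) ^ d * (q + 2) ^ d := by exact_mod_cast h1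
  have h3 : ((((Polynomial.C (c * 4 ^ d) *
      (4 * (Polynomial.X * Polynomial.X) + Polynomial.X + 2) ^ d : Polynomial ℕ).eval I.n : ℕ)) : ℝ)
      = c * 4 ^ d * (q + 2) ^ d := by
    simp [hq]
  beta_reduce
  rw [h3]
  refine h2.trans ?_
  have h4 := four_pow_le I.k d
  have h5 : (0 : ℝ) ≤ c * (q + 2) ^ d := by positivity
  calc (c * (4 ^ I.k) ^ d * (q + 2) ^ d : ℝ) = c * (q + 2) ^ d * (4 ^ I.k) ^ d := by ring
    _ ≤ c * (q + 2) ^ d * (4 ^ d * 2 ^ ((2 * d : ℝ) * ((I.k : ℝ) * Real.logb 2 I.k))) :=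
      mul_le_mul_of_nonneg_left h4 h5
    _ = _ := by ring

end BiDSN

/-- Directed Steiner Network on bidirected graphs admits a `4`-approximation in polynomial time
and a `2`-approximation in time `2 ^ O(k log k) * poly(n)`. -/
theorem theorem6 :
    (∃ (P : BiDSN.Prog) (p : Polynomial ℕ),
      BiDSN.ApproximatesInTime P 4 (fun n _ => ((p.eval n : ℕ) : ℝ))) ∧
    (∃ (P : BiDSN.Prog) (C : ℝ) (p : Polynomial ℕ),
      BiDSN.ApproximatesInTime P 2
        (fun n k => (2 : ℝ) ^ (C * ((k : ℝ) * Real.logb 2 (k : ℝ))) * ((p.eval n : ℕ) : ℝ))) := by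
  exact ⟨BiDSN.exists_fourApprox, BiDSN.exists_twoApprox⟩
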